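/- \textbf{Notation.} Let $\langle j\rangle=\max(|j|,1)$ for $j\in\mathbb Z$. For $s>0$, $p\ge\frac12$, $0<\theta<1$ let $h_{s}=h_{s,p,\theta}$ be the space of $u\in\ell^2(\mathbb Z,\mathbb C)$ with $|u|_s^2=\sum_{j}\langle j\rangle^{2p}e^{2s\langle j\rangle^\theta}|u_j|^2<\infty$, with the symplectic form $\Omega(u,v)=2\,\mathrm{Im}\sum_j u_j\bar v_j$, and let $B_r(h_s)$ be its open ball of radius $r$ around $0$. For $\gamma>0$ let $\mathtt D_\gamma$ be the set of $\omega\in\mathbb R^{\mathbb Z}$ with $\sup_j|\omega_j-j^2|<\frac12$ and $$|\omega\cdot\ell|>\gamma\prod_{n\in\mathbb Z}\frac1{1+|\ell_n|^2\langle n\rangle^2}\qquad\text{for all finitely supported }\ell\in\mathbb Z^{\mathbb Z}\setminus\{0\}.$$ Let $\mathcal F$ be the space of formal power series $H=\sum_{\alpha,\beta}H_{\alpha,\beta}u^\alpha\bar u^\beta$, where $\alpha,\beta$ run over the finitely supported elements of $\mathbb N^{\mathbb Z}$, such that $H_{0,0}=H_{e_0,0}=H_{0,e_0}=0$, $H_{\alpha,\beta}=\overline{H_{\beta,\alpha}}$,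 and $H_{\alpha,\beta}=0$ unless $\sum_j j(\alpha_j-\beta_j)=0$ (momentum conservation). Let $\mathcal F^{\ge1}$ be the set of those $H\in\mathcal F$ with $H_{\alpha,\beta}=0$ whenever $|\alpha|+|\beta|<3$. The Poisson bracket on $\mathcal F$ is $$\{F,G\}=i\sum F_{\alpha',\beta'}G_{\alpha'',\beta''}\sum_j(\alpha'_j\beta''_j-\beta'_j\alpha''_j)\,u^{\alpha'+\alpha''-e_j}\bar u^{\beta'+\beta''-e_j},$$ and for $G\in\mathcal F^{\ge1}$, $H\in\mathcal F$ one sets $e^{\{G,\cdot\}}H=\sum_{k\ge0}\frac1{k!}\mathrm{ad}_G^kH$ with $\mathrm{ad}_G=\{G,\cdot\}$; all coefficients of these series are finite sums. The series $H\in\mathcal F$ is called $M$-regular, $H\in\mathcal H_{r,s}$, if its majorant $\underline H=\sum|H_{\alpha,\beta}|u^\alpha\bar u^\beta$ converges absolutely at every point of $B_r(h_s)$ and its Hamiltonian vector field $X_{\underline H}$, with components $i\,\partial\underline H/\partial\bar u_j$, satisfies $\sup_{|u|_s\le r}|X_{\underline H}(u)|_s<\infty$. \textbf{Theorem.} Let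 $p\ge\frac12$, $0<\theta<1$, $\gamma,r,s_0>0$, let $\omega\in\mathtt D_\gamma$ and $D_\omega=\sum_j\omega_j|u_j|^2$, and let $H=D_\omega+P_0$ with $P_0\in\mathcal H_{r,s_0}\cap\mathcal F^{\ge1}$. Assume that $H$ is formally symplectically conjugate to $D_\omega$, i.e. that there is $G\in\mathcal F^{\ge1}$ with $e^{\{G,\cdot\}}H=D_\omega$. Then for every $\varepsilon>0$ there are $0<r_1<r$, $s_1>s_0$ and a map $$\Psi:B_{r_1}(h_{s_1})\to h_{s_1}$$ which is a real-analytic diffeomorphism onto an open set (with real-analytic inverse), is symplectic, i.e. $\Omega(D\Psi(u)v,D\Psi(u)w)=\Omega(v,w)$ for all $u\in B_{r_1}(h_{s_1})$ and $v,w\in h_{s_1}$, is close to the identity in the sense that, for some constant $C$ with $C\,r_1\le\varepsilon$, $|\Psi(u)-u|_{s_1}\le C|u|_{s_1}^2$ on $B_{r_1}(h_{s_1})$, and satisfies $$H\circ\Psi(u)=\sum_{j}\omega_j|u_j|^2\qquad\text{for all }u\in B_{r_1}(h_{s_1}),$$ where the series $H(\Psi(u))$ and the series on the right converge absolutely. 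-/

import Mathlib

noncomputable section

namespace GevreyBirkhoff

/-! ### The Gevrey sequence spaces -/

/-- `⟨j⟩ = max(|j|, 1)`. -/
def bracket (j : ℤ) : ℝ := max |(j : ℝ)| 1

theorem bracket_pos (j : ℤ) : 0 < bracket j :=
  lt_of_lt_of_le one_pos (le_max_right _ _)

/-- The weight `⟨j⟩ ^ p * exp (s * ⟨j⟩ ^ θ)`. -/
def weight (s p θ : ℝ) (j : ℤ) : ℝ := bracket j ^ p * Real.exp (s * bracket j ^ θ)

theorem weight_pos (s p θ : ℝ) (j : ℤ) : 0 < weight s p θ j :=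
  mul_pos (Real.rpow_pos_of_pos (bracket_pos j) p) (Real.exp_pos _)

/-- Multiplication of a sequence by the weight. -/
def weightMul (s p θ : ℝ) : (ℤ → ℂ) →ₗ[ℂ] (ℤ → ℂ) where
  toFun u j := (weight s p θ j : ℂ) * u j
  map_add' u v := by funext j; simp [mul_add]
  map_smul' c u := by funext j; simp [mul_left_comm]

/-- The sequences `u` with `∑ j, ⟨j⟩ ^ (2 p) * exp (2 s ⟨j⟩ ^ θ) * |u j| ^ 2 < ∞`. For `s, p ≥ 0` the
weight is at least one, so these sequences are automatically in `ℓ²`. -/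
def gevreySubmodule (s p θ : ℝ) : Submodule ℂ (ℤ → ℂ) where
  carrier := {u | Memℓp (fun j => weightMul s p θ u j) 2}
  zero_mem' := by
    have h : (fun j => weightMul s p θ 0 j) = (0 : ℤ → ℂ) := by funext j; simp
    simp only [Set.mem_ofPred_eq, h]
    exact zero_memℓp
  add_mem' {u v} hu hv := by
    have h : (fun j => weightMul s p θ (u + v) j)
        = (fun j => weightMul s p θ u j) + (fun j => weightMul s p θ v j) := by
      funext j; simp
    simp only [Set.mem_ofPred_eq, h] at *
    exact hu.add hv
  smul_mem' c u hu := by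
    have h : (fun j => weightMul s p θ (c • u) j) = c • (fun j => weightMul s p θ u j) := by
      funext j; simp
    simp only [Set.mem_ofPred_eq, h] at *
    exact hu.const_smul c

/-- The phase space `h_{s,p,θ}`. -/
def GevreySpace (s p θ : ℝ) : Type := gevreySubmodule s p θ

instance (s p θ : ℝ) : AddCommGroup (GevreySpace s p θ) :=
  inferInstanceAs (AddCommGroup (gevreySubmodule s p θ))

instance (s p θ : ℝ) : Module ℂ (GevreySpace s p θ) :=
  inferInstanceAs (Module ℂ (gevreySubmodule s p θ))

instance (s p θ : ℝ) : CoeFun (GevreySpace s p θ) (fun _ => ℤ → ℂ) := ⟨fun u => u.1⟩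

/-- The embedding `u ↦ (weight j * u j)_j` into `ℓ²`, which induces the norm of `h_{s,p,θ}`. -/
def toEll2 (s p θ : ℝ) : GevreySpace s p θ →ₗ[ℂ] lp (fun _ : ℤ => ℂ) 2 where
  toFun u := ⟨fun j => weightMul s p θ u j, u.2⟩
  map_add' u v := by
    ext j; exact congrFun ((weightMul s p θ).map_add u.1 v.1) j
  map_smul' c u := by
    ext j; exact congrFun ((weightMul s p θ).map_smul c u.1) j

theorem toEll2_apply {s p θ : ℝ} (u : GevreySpace s p θ) (j : ℤ) :
    toEll2 s p θ u j = (weight s p θ j : ℂ) * u j := rfl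

theorem toEll2_injective (s p θ : ℝ) : Function.Injective (toEll2 s p θ) := by
  intro u v h
  apply Subtype.ext
  funext j
  have hj : toEll2 s p θ u j = toEll2 s p θ v j := by rw [h]
  rw [toEll2_apply, toEll2_apply] at hj
  exact mul_left_cancel₀ (by exact_mod_cast (weight_pos s p θ j).ne') hj

instance (s p θ : ℝ) : NormedAddCommGroup (GevreySpace s p θ) :=
  NormedAddCommGroup.induced _ _ (toEll2 s p θ) (toEll2_injective s p θ)

instance (s p θ : ℝ) : NormedSpace ℂ (GevreySpace s p θ) :=
  NormedSpace.induced ℂ _ _ (toEll2 s p θ)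

theorem norm_sq_eq {s p θ : ℝ} (u : GevreySpace s p θ) :
    ‖u‖ ^ 2 = ∑' j, bracket j ^ (2 * p) * Real.exp (2 * s * bracket j ^ θ) * ‖u j‖ ^ 2 := by
  have h1 : ‖u‖ = ‖toEll2 s p θ u‖ := rfl
  have h2 := lp.norm_rpow_eq_tsum (p := 2) (by norm_num) (toEll2 s p θ u)
  simp only [ENNReal.toReal_ofNat, Real.rpow_two] at h2
  rw [h1, h2]
  refine tsum_congr fun j => ?_
  have hw : weight s p θ j ^ 2 = bracket j ^ (2 * p) * Real.exp (2 * s * bracket j ^ θ) := by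
    rw [weight, mul_pow, ← Real.rpow_natCast, ← Real.rpow_mul (bracket_pos j).le,
      ← Real.exp_nat_mul]
    push_cast
    ring_nf
  rw [toEll2_apply, norm_mul, mul_pow, Complex.norm_real, Real.norm_of_nonneg (weight_pos s p θ j).le,
    hw]

/-- The symplectic form inherited from `ℓ²`: with `u_j = (x_j + i y_j) / √2` it is
`∑ j, (y_j(u) x_j(v) - x_j(u) y_j(v)) = 2 Im ∑ j, u_j * conj (v_j)`. -/
def symplecticForm {s p θ : ℝ} (u v : GevreySpace s p θ) : ℝ :=
  ∑' j, 2 * (u j * (starRingEnd ℂ) (v j)).im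

/-! ### Diophantine frequencies -/

/-- The frequencies `ω` with `sup_j |ω_j - j²| < 1/2`. -/
def frequencies : Set (ℤ → ℝ) :=
  {ω | ∃ c < (1 / 2 : ℝ), ∀ j : ℤ, |ω j - (j : ℝ) ^ 2| ≤ c}

/-- The Diophantine set `D_γ`. -/
def diophantine (γ : ℝ) : Set (ℤ → ℝ) :=
  {ω | ω ∈ frequencies ∧ ∀ l : ℤ →₀ ℤ, l ≠ 0 →
    γ * l.prod (fun n k => 1 / (1 + |(k : ℝ)| ^ 2 * bracket n ^ 2))
      < |l.sum fun n k => ω n * (k : ℝ)|}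

/-! ### Formal Hamiltonians -/

/-- A pair of exponents `(α, β)`, standing for the monomial `u ^ α * conj u ^ β`. -/
abbrev Exponent : Type := (ℤ →₀ ℕ) × (ℤ →₀ ℕ)

/-- A formal power series `∑ H (α, β) u ^ α * conj u ^ β`, given by its coefficients. -/
abbrev FormalSeries : Type := Exponent → ℂ

/-- The total degree `|α| + |β|`. -/
def totalDegree (m : Exponent) : ℕ := m.1.degree + m.2.degree

/-- The momentum `π(α, β) = ∑ j, j (α_j - β_j)`. -/
def momentum (m : Exponent) : ℤ :=
  (m.1.sum fun j n => j * (n : ℤ)) - (m.2.sum fun j n => j * (n : ℤ))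

/-- The exponent `e_j`. -/
abbrev unitVec (j : ℤ) : ℤ →₀ ℕ := Finsupp.single j 1

/-- The space `F` of formal Hamiltonians: no constant term, no terms `u_0` and `conj u_0`, real
and momentum preserving. -/
structure IsHamiltonian (H : FormalSeries) : Prop where
  const : H (0, 0) = 0
  lin : H (unitVec 0, 0) = 0
  lin_conj : H (0, unitVec 0) = 0
  real : ∀ α β, H (α, β) = (starRingEnd ℂ) (H (β, α))
  momentum : ∀ m, momentum m ≠ 0 → H m = 0

/-- The space `F^{≥ d}` of formal Hamiltonians all of whose monomials have total degree at least
`d + 2`. -/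
def hamiltoniansGE (d : ℕ) : Set FormalSeries :=
  {H | IsHamiltonian H ∧ ∀ m, totalDegree m < d + 2 → H m = 0}

/-- The contribution of the index `j` to the coefficient of `{F, G}` at `m = (α, β)`: the sum over
all `(α', β')`, `(α'', β'')` with `α' + α'' - e_j = α` and `β' + β'' - e_j = β`. -/
def poissonTerm (F G : FormalSeries) (m : Exponent) (j : ℤ) : ℂ :=
  ∑ a ∈ Finset.HasAntidiagonal.antidiagonal (m.1 + unitVec j), ∑ b ∈ Finset.HasAntidiagonal.antidiagonal (m.2 + unitVec j),
    F (a.1, b.1) * G (a.2, b.2) * ((a.1 j : ℂ) * (b.2 j : ℂ) - (b.1 j : ℂ) * (a.2 j : ℂ))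

/-- The Poisson bracket `{F, G}`. For momentum-preserving series only finitely many indices `j`
contribute, see `finite_support_poissonTerm`. -/
def poisson (F G : FormalSeries) : FormalSeries := fun m =>
  Complex.I * ∑ᶠ j, poissonTerm F G m j

/-- `exp({G, ·}) H = ∑ k, ad_G ^ k H / k!`, coefficient by coefficient. For `G ∈ F^{≥ 1}` and `H ∈ F`
each coefficient is a finite sum, see `finite_support_adPow`. -/
def expAd (G H : FormalSeries) : FormalSeries := fun m =>
  ∑ᶠ k : ℕ, ((poisson G)^[k] H) m / (k.factorial : ℂ)

/-- The quadratic Hamiltonian `D_ω = ∑ j, ω_j |u_j|²`. -/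
def quadratic (ω : ℤ → ℝ) : FormalSeries := fun m =>
  ∑ᶠ j : ℤ, if m = (unitVec j, unitVec j) then (ω j : ℂ) else 0

/-! #### The formal operations are well defined -/

theorem momentum_add (m n : Exponent) : momentum (m + n) = momentum m + momentum n := by
  simp only [momentum, Prod.fst_add, Prod.snd_add]
  rw [Finsupp.sum_add_index' (by simp) (by intros; push_cast; ring),
    Finsupp.sum_add_index' (by simp) (by intros; push_cast; ring)]
  ring

theorem momentum_unitVec (j : ℤ) : momentum (unitVec j, unitVec j) = 0 := by
  simp [momentum]

theorem exists_of_poissonTerm_ne_zero {F G : FormalSeries} {m : Exponent} {j : ℤ}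
    (h : poissonTerm F G m j ≠ 0) :
    ∃ x y : Exponent, x + y = m + (unitVec j, unitVec j) ∧ F x ≠ 0 ∧ G y ≠ 0 ∧
      (x.1 j : ℂ) * (y.2 j : ℂ) - (x.2 j : ℂ) * (y.1 j : ℂ) ≠ 0 := by
  obtain ⟨a, ha, h⟩ := Finset.exists_ne_zero_of_sum_ne_zero h
  obtain ⟨b, hb, h⟩ := Finset.exists_ne_zero_of_sum_ne_zero h
  rw [Finset.HasAntidiagonal.mem_antidiagonal] at ha hb
  refine ⟨(a.1, b.1), (a.2, b.2), Prod.ext ha hb, ?_, ?_, ?_⟩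
  · exact left_ne_zero_of_mul (left_ne_zero_of_mul h)
  · exact right_ne_zero_of_mul (left_ne_zero_of_mul h)
  · exact right_ne_zero_of_mul h

theorem finite_support_poissonTerm {F G : FormalSeries} (hF : IsHamiltonian F)
    (m : Exponent) : (Function.support (poissonTerm F G m)).Finite := by
  classical
  -- candidates: the indices that occur in `m`, and the momenta of the divisors of `m`
  let A : Finset Exponent := (Finset.HasAntidiagonal.antidiagonal m.1 ×ˢ Finset.HasAntidiagonal.antidiagonal m.2).image
    fun q => (q.1.1, q.2.1)
  refine Set.Finite.subset ((m.1.support ∪ m.2.support ∪ A.image (fun q => momentum q) ∪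
    A.image (fun q => - momentum q)).finite_toSet) ?_
  intro j hj
  obtain ⟨x, y, hxy, hx, -, hc⟩ := exists_of_poissonTerm_ne_zero hj
  have e1 : x.1 + y.1 = m.1 + unitVec j := congrArg Prod.fst hxy
  have e2 : x.2 + y.2 = m.2 + unitVec j := congrArg Prod.snd hxy
  by_contra hn
  simp only [Finset.coe_union, Set.mem_union, Finset.mem_coe, Finsupp.mem_support_iff,
    not_or, not_not] at hn
  obtain ⟨⟨⟨hm1, hm2⟩, hA⟩, hA'⟩ := hn
  have f1 : x.1 j + y.1 j = 1 := by simpa [hm1] using DFunLike.congr_fun e1 j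
  have f2 : x.2 j + y.2 j = 1 := by simpa [hm2] using DFunLike.congr_fun e2 j
  have hxm : momentum x = 0 := by
    by_contra h; exact hx (hF.momentum x h)
  have g1 : ∀ i, i ≠ j → x.1 i ≤ m.1 i := fun i hi => by
    have := DFunLike.congr_fun e1 i
    simp [Ne.symm hi] at this; omega
  have g2 : ∀ i, i ≠ j → x.2 i ≤ m.2 i := fun i hi => by
    have := DFunLike.congr_fun e2 i
    simp [Ne.symm hi] at this; omega
  have memA : ∀ q : Exponent, q.1 ≤ m.1 → q.2 ≤ m.2 → q ∈ A := by
    intro q h1 h2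
    refine Finset.mem_image.2 ⟨((q.1, m.1 - q.1), (q.2, m.2 - q.2)), ?_, rfl⟩
    simp [Finset.mem_product, Finset.HasAntidiagonal.mem_antidiagonal, add_tsub_cancel_of_le h1,
      add_tsub_cancel_of_le h2]
  have hcase : (x.1 j = 1 ∧ x.2 j = 0) ∨ (x.1 j = 0 ∧ x.2 j = 1) := by
    rcases Nat.eq_zero_or_pos (x.1 j) with h | h <;> rcases Nat.eq_zero_or_pos (x.2 j) with h' | h'
    · exact absurd (by simp [h, h']) hc
    · right; omega
    · left; omega
    · exact absurd (by simp [show y.1 j = 0 by omega, show y.2 j = 0 by omega]) hc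
  rcases hcase with ⟨h1, h2⟩ | ⟨h1, h2⟩
  · have hq : x = (x.1.erase j, x.2) + (unitVec j, 0) := by
      refine Prod.ext ?_ (by simp)
      have := Finsupp.erase_add_single j x.1
      rw [h1] at this; exact this.symm
    have : momentum (x.1.erase j, x.2) = - j := by
      have h := momentum_add (x.1.erase j, x.2) (unitVec j, 0)
      rw [← hq, hxm] at h
      simp [momentum] at h ⊢; omega
    refine hA' (Finset.mem_image.2 ⟨_, memA (x.1.erase j, x.2) ?_ ?_, by rw [this, neg_neg]⟩)
    · intro i
      rcases eq_or_ne i j with rfl | hi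
      · simp
      · simpa [Finsupp.erase_ne hi] using g1 i hi
    · intro i
      rcases eq_or_ne i j with rfl | hi
      · simp [h2]
      · exact g2 i hi
  · have hq : x = (x.1, x.2.erase j) + (0, unitVec j) := by
      refine Prod.ext (by simp) ?_
      have := Finsupp.erase_add_single j x.2
      rw [h2] at this; exact this.symm
    have : momentum (x.1, x.2.erase j) = j := by
      have h := momentum_add (x.1, x.2.erase j) (0, unitVec j)
      rw [← hq, hxm] at h
      simp [momentum] at h ⊢; omega
    refine hA (Finset.mem_image.2 ⟨_, memA (x.1, x.2.erase j) ?_ ?_, this⟩)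
    · intro i
      rcases eq_or_ne i j with rfl | hi
      · simp [h1]
      · exact g1 i hi
    · intro i
      rcases eq_or_ne i j with rfl | hi
      · simp
      · simpa [Finsupp.erase_ne hi] using g2 i hi

theorem totalDegree_add (m n : Exponent) : totalDegree (m + n) = totalDegree m + totalDegree n := by
  simp [totalDegree, map_add]; ring

theorem conj_poissonTerm {F G : FormalSeries} (hF : IsHamiltonian F) (hG : IsHamiltonian G)
    (α β : ℤ →₀ ℕ) (j : ℤ) :
    (starRingEnd ℂ) (poissonTerm F G (β, α) j) = - poissonTerm F G (α, β) j := by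
  simp only [poissonTerm, map_sum, ← Finset.sum_neg_distrib]
  rw [Finset.sum_comm]
  refine Finset.sum_congr rfl fun a _ => Finset.sum_congr rfl fun b _ => ?_
  simp only [map_mul, map_sub, map_natCast]
  rw [← hF.real a.1 b.1, ← hG.real a.2 b.2]
  ring

/-- The Poisson bracket is a filtered operation on formal Hamiltonians. -/
theorem poisson_mem {F G : FormalSeries} {a b : ℕ} (hF : F ∈ hamiltoniansGE a)
    (hG : G ∈ hamiltoniansGE b) : poisson F G ∈ hamiltoniansGE (a + b) := by
  have key : ∀ m, (totalDegree m < a + b + 2 ∨ momentum m ≠ 0) → poisson F G m = 0 := by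
    intro m hm
    have : ∀ j, poissonTerm F G m j = 0 := by
      intro j
      by_contra h
      obtain ⟨x, y, hxy, hx, hy, -⟩ := exists_of_poissonTerm_ne_zero h
      rcases hm with hm | hm
      · have h1 := congrArg totalDegree hxy
        rw [totalDegree_add, totalDegree_add] at h1
        have h2 : a + 2 ≤ totalDegree x := not_lt.1 fun h => hx (hF.2 x h)
        have h3 : b + 2 ≤ totalDegree y := not_lt.1 fun h => hy (hG.2 y h)
        have h4 : totalDegree (unitVec j, unitVec j) = 2 := by simp [totalDegree]
        omega
      · have h1 := congrArg momentum hxy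
        rw [momentum_add, momentum_add, momentum_unitVec] at h1
        have h2 : momentum x = 0 := by by_contra h; exact hx (hF.1.momentum x h)
        have h3 : momentum y = 0 := by by_contra h; exact hy (hG.1.momentum y h)
        exact hm (by linarith)
    simp [poisson, this]
  refine ⟨⟨key _ (Or.inl (by simp [totalDegree])), key _ (Or.inl (by simp [totalDegree])),
    key _ (Or.inl (by simp [totalDegree])), ?_, fun m hm => key m (Or.inr hm)⟩,
    fun m hm => key m (Or.inl hm)⟩
  intro α β
  have h := AddMonoidHom.map_finsum (starRingEnd ℂ).toAddMonoidHom
    (finite_support_poissonTerm (G := G) hF.1 (β, α))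
  simp only [RingHom.toAddMonoidHom_eq_coe, AddMonoidHom.coe_coe] at h
  simp only [poisson, map_mul, Complex.conj_I, h, conj_poissonTerm hF.1 hG.1, finsum_neg_distrib]
  ring

theorem quadratic_unitVec (ω : ℤ → ℝ) (j : ℤ) : quadratic ω (unitVec j, unitVec j) = ω j := by
  rw [quadratic, finsum_eq_single _ j]
  · simp
  · intro i hi
    rw [if_neg]
    intro h
    have h := Finsupp.single_left_injective one_ne_zero (congrArg Prod.fst h)
    exact hi h.symm

theorem quadratic_eq_zero (ω : ℤ → ℝ) {m : Exponent} (h : ∀ j, m ≠ (unitVec j, unitVec j)) :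
    quadratic ω m = 0 := by
  simp [quadratic, h]

theorem quadratic_mem (ω : ℤ → ℝ) : quadratic ω ∈ hamiltoniansGE 0 := by
  have key : ∀ m, (totalDegree m ≠ 2 ∨ momentum m ≠ 0) → quadratic ω m = 0 := by
    intro m hm
    refine quadratic_eq_zero ω fun j hj => ?_
    subst hj
    simp [totalDegree, momentum] at hm
  refine ⟨⟨key _ (by simp [totalDegree]), key _ (by simp [totalDegree]),
    key _ (by simp [totalDegree]), ?_, fun m hm => key m (Or.inr hm)⟩,
    fun m hm => key m (Or.inl (by omega))⟩
  intro α β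
  by_cases h : ∃ j, (α, β) = (unitVec j, unitVec j)
  · obtain ⟨j, hj⟩ := h
    obtain ⟨rfl, rfl⟩ := Prod.mk.inj hj
    rw [quadratic_unitVec, Complex.conj_ofReal]
  · push Not at h
    rw [quadratic_eq_zero ω h, quadratic_eq_zero ω, map_zero]
    intro j hj
    obtain ⟨rfl, rfl⟩ := Prod.mk.inj hj
    exact h j rfl

theorem adPow_mem {G H : FormalSeries} {d : ℕ} (hG : G ∈ hamiltoniansGE 1)
    (hH : H ∈ hamiltoniansGE d) (k : ℕ) : (poisson G)^[k] H ∈ hamiltoniansGE (k + d) := by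
  induction k with
  | zero => simpa using hH
  | succ k ih =>
    rw [Function.iterate_succ_apply', show k + 1 + d = 1 + (k + d) by omega]
    exact poisson_mem hG ih

theorem finite_support_adPow {G H : FormalSeries} {d : ℕ} (hG : G ∈ hamiltoniansGE 1)
    (hH : H ∈ hamiltoniansGE d) (m : Exponent) :
    (Function.support fun k : ℕ => ((poisson G)^[k] H) m / (k.factorial : ℂ)).Finite := by
  refine (Set.finite_lt_nat (totalDegree m)).subset fun k hk => ?_
  by_contra hn
  have hn : totalDegree m ≤ k := not_lt.1 hn
  exact hk (by simp [(adPow_mem hG hH k).2 m (by omega)])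

/-! ### Regular Hamiltonians -/

/-- The monomial `u ^ α * conj u ^ β`. -/
def monomial (m : Exponent) (u : ℤ → ℂ) : ℂ :=
  (m.1.prod fun j n => u j ^ n) * m.2.prod fun j n => (starRingEnd ℂ) (u j) ^ n

/-- The Cauchy majorant `∑ |H (α, β)| u ^ α * conj u ^ β`. -/
def majorant (H : FormalSeries) : FormalSeries := fun m => (‖H m‖ : ℂ)

/-- The terms of the `j`-th component `i ∂H/∂(conj u_j)` of the Hamiltonian vector field `X_H`. -/
def vectorFieldTerm (H : FormalSeries) (u : ℤ → ℂ) (j : ℤ) (m : Exponent) : ℂ :=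
  Complex.I * (H m * (m.2 j : ℂ) * monomial (m.1, m.2 - unitVec j) u)

/-- The space `H_{r,s}` of `M`-regular Hamiltonians: the majorant converges absolutely on the ball
of radius `r`, and its Hamiltonian vector field is defined and bounded from the closed ball of
radius `r` of `h_{s,p,θ}` into `h_{s,p,θ}`. -/
structure IsMRegular (r s p θ : ℝ) (H : FormalSeries) : Prop where
  hamiltonian : IsHamiltonian H
  summable : ∀ u : GevreySpace s p θ, ‖u‖ < r → Summable fun m => majorant H m * monomial m u
  bounded : ∃ C : ℝ, ∀ u : GevreySpace s p θ, ‖u‖ ≤ r →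
    ∃ X : GevreySpace s p θ, (∀ j, HasSum (vectorFieldTerm (majorant H) u j) (X j)) ∧ ‖X‖ ≤ C

/-- `Ψ` preserves the symplectic form on the set `U`. -/
def IsSymplecticOn {s p θ : ℝ} (Ψ : GevreySpace s p θ → GevreySpace s p θ)
    (U : Set (GevreySpace s p θ)) : Prop :=
  ∀ u ∈ U, ∀ v w : GevreySpace s p θ,
    symplecticForm (fderiv ℝ Ψ u v) (fderiv ℝ Ψ u w) = symplecticForm v w

end GevreyBirkhoff

end

/-!
The transformation is built by a Newton scheme whose steps are Lie series. It is the formal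
conjugation to `D_ω` that removes the obstruction to each step, and momentum conservation that makes
the small divisors harmless.

*No resonances.* In place of the formal conjugation itself, the scheme carries along a weaker
property, `Linearizable`: there are formal coordinates `x_j = u_j + O(2)` with
`{H, x_j} = -i ω_j x_j`. It is invariant under the formal symplectic maps `exp {S, ·}`, because these
are automorphisms of the Poisson algebra (`expPb_mul`, `expPb_pb`). If it holds for `D_ω + P` with
`P` of order `d + 2`, then the resonant part of `P`, which is what the homological equation cannot
remove, has order `2 d + 2` (`vanishBelow_resonantPart`). A step that solves
`{S, D_ω} = P^res - P` and replaces `D_ω + P` by `exp {S, ·} (D_ω + P)` therefore turns `d` into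
`2 d` (`vanishBelow_newton`, `Perturbation.newtonSeq`). The generators of the scheme are unrelated
to the given formal one, whose convergence is not assumed.

*Small divisors.* A formal Hamiltonian is measured by the majorant of its vector field on a ball of
a weighted `ℓ²` space (`HamBound`, `FamBound`). When `s` is replaced by `s + σ`, a monomial of the
vector field gains `exp (-σ (∑ ⟨i⟩ ^ θ - 2 ⟨j⟩ ^ θ))`, where the sum runs over all its variables and
`j` is any one of them. Because the momentum is zero and `⟨j⟩ ^ θ` is concave, the exponent is at
least `(1 - θ) σ` times the sum of `⟨i⟩ ^ θ` over all variables but the two largest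
(`LeadingPair.gain`). The two largest indices either cancel in the divisor or, since
`ω_j - j²` is bounded, are polynomially bounded by the others when the divisor is small. Hence the
lower bound for the divisor, up to polynomial factors, involves only the other variables, and
dividing by it is compensated by the gain at the price of a constant `exp (C σ ^ (-a))`
(`exists_smallDivisor_bound`).

*Convergence.* After `k` steps the perturbation has order `2 ^ k + 2`, so reducing the ball by the
factor `1 - δ` reduces its size by `(1 - δ) ^ 2 ^ k` at least (`HamBound.shrink`). With `δ` of order
`(3 / 4) ^ k` and losses `σ = τ ^ k` such that `σ ^ (-a) ≤ (5 / 4) ^ k`, all losses are summable and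
`exp (-(3 / 2) ^ k / 16)` beats `exp (C (5 / 4) ^ k)` (`exists_growth_bound`,
`exists_newton_bounds`). One ball in one space `h_{s₁}` thus serves all steps.

*From series to maps.* A Lie series acts on functions by substitution of the time-one map
(`ev_expPb_vars`), so no differential equation has to be solved. Its symplecticity comes from the
group law: `[0, 1]` is divided into `N` steps, each of which preserves the form up to `O(N⁻²)`, since
the derivative of a Hamiltonian vector field is skew
(`Generator.symplecticForm_fderiv_flow`, `HamBound.symplecticForm_fderiv_add`). The infinite
composition `limitFlow` is itself a family of power series, to which the coefficients of the partial
compositions stabilize. Bounds on its majorants make it analytic, quadratically close to the identity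
and symplectic, and it is injective with an analytic inverse because its derivative is close to the
identity (`GeneratorSeq.approximatesLinearOn`). The energy identity passes to the limit by dominated
convergence (`GeneratorSeq.ev_limitFlow`, `Perturbation.exists_energy`).
-/

noncomputable section

open MvPowerSeries
open scoped ENNReal

namespace GevreyBirkhoff

/-! ### Poisson brackets of power series in the variables `u_j` and `conj u_j` -/

/-- The variables: `Sum.inl j` stands for `u_j` and `Sum.inr j` for `conj u_j`. -/
abbrev Var : Type := ℤ ⊕ ℤ

/-- Formal power series in `u` and `conj u`; unlike `FormalSeries` they form a ring. -/
abbrev PS : Type := MvPowerSeries Var ℂ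

/-- The exponents of the monomials in `u` and `conj u`. -/
abbrev MultiIndex : Type := Var →₀ ℕ

/-- The constants in Hamilton's equations `{F, u_j} = -i ∂F/∂(conj u_j)` and
`{F, conj u_j} = i ∂F/∂u_j`. -/
def hamSign : Var → ℂ := Sum.elim (fun _ => -Complex.I) (fun _ => Complex.I)

theorem hamSign_swap (w : Var) : hamSign w.swap = -hamSign w := by
  rcases w with w | w <;> simp [hamSign]

theorem hamSign_ne_zero (w : Var) : hamSign w ≠ 0 := by
  rcases w with w | w <;> simp [hamSign]

/-- The momentum carried by a variable: `j` for `u_j`, and `-j` for `conj u_j`. -/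
def varMomentum : Var → ℤ := Sum.elim id (fun j => -j)

theorem varMomentum_swap (w : Var) : varMomentum w.swap = -varMomentum w := by
  rcases w with w | w <;> simp [varMomentum]

/-- The momentum of a monomial. -/
def mom : MultiIndex →+ ℤ := Finsupp.weight varMomentum

theorem mom_single (w : Var) : mom (Finsupp.single w 1) = varMomentum w := by
  simp [mom, Finsupp.weight_single]

/-- Only monomials of momentum zero occur. -/
def MomentumFree (F : PS) : Prop := ∀ n, mom n ≠ 0 → coeff n F = 0

/-- The component `{F, z_w}` of the Hamiltonian vector field of `F` along the variable `w`. -/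
def hamField (F : PS) (w : Var) : PS := hamSign w • pderiv ℂ w.swap F

/-- The Poisson bracket `{F, G}`. For momentum-preserving `F` every coefficient is a finite sum. -/
def pb (F G : PS) : PS := fun n => ∑' w, coeff n (hamField F w * pderiv ℂ w G)

theorem pderiv_smul (w : Var) (c : ℂ) (F : PS) : pderiv ℂ w (c • F) = c • pderiv ℂ w F :=
  (pderiv ℂ w).map_smul c F

theorem coeff_hamField (F : PS) (w : Var) (n : MultiIndex) :
    coeff n (hamField F w) =
      hamSign w * (coeff (n + Finsupp.single w.swap 1) F * ((n w.swap : ℂ) + 1)) := by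
  rw [hamField, coeff_smul, coeff_pderiv]

/-- The variables that can contribute to the coefficient at `n` of a Poisson bracket. -/
def pbSupport (n : MultiIndex) : Finset Var :=
  (Finset.HasAntidiagonal.antidiagonal n).biUnion fun x => {Sum.inl (mom x.1), Sum.inr (-mom x.1)}

theorem coeff_hamField_mul_eq_zero {F : PS} (hF : MomentumFree F) {n : MultiIndex} {w : Var}
    (hw : w ∉ pbSupport n) (G : PS) : coeff n (hamField F w * G) = 0 := by
  classical
  rw [coeff_mul]
  refine Finset.sum_eq_zero fun x hx => ?_
  rw [coeff_hamField, hF, zero_mul, mul_zero, zero_mul]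
  rw [map_add, mom_single, varMomentum_swap]
  intro h
  apply hw
  refine Finset.mem_biUnion.2 ⟨x, hx, ?_⟩
  rcases w with j | j
  · have : j = mom x.1 := by simp [varMomentum] at h; omega
    simp [this]
  · have : j = -mom x.1 := by simp [varMomentum] at h; omega
    simp [this]

theorem coeff_pb {F : PS} (hF : MomentumFree F) (G : PS) (n : MultiIndex) :
    coeff n (pb F G) = ∑ w ∈ pbSupport n, coeff n (hamField F w * pderiv ℂ w G) :=
  tsum_eq_sum fun _ hw => coeff_hamField_mul_eq_zero hF hw _

open scoped MvPowerSeries.WithPiTopology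

theorem hasSum_pb {F : PS} (hF : MomentumFree F) (G : PS) :
    HasSum (fun w => hamField F w * pderiv ℂ w G) (pb F G) := by
  rw [WithPiTopology.hasSum_iff_hasSum_coeff]
  intro n
  rw [coeff_pb hF]
  exact hasSum_sum_of_ne_finset_zero fun _ hw => coeff_hamField_mul_eq_zero hF hw _

theorem pb_add {F : PS} (hF : MomentumFree F) (G H : PS) : pb F (G + H) = pb F G + pb F H := by
  refine (hasSum_pb hF _).unique ?_
  simpa [mul_add] using (hasSum_pb hF G).add (hasSum_pb hF H)

theorem pb_smul {F : PS} (hF : MomentumFree F) (c : ℂ) (G : PS) : pb F (c • G) = c • pb F G := by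
  ext n
  rw [coeff_pb hF, coeff_smul, coeff_pb hF, Finset.mul_sum]
  exact Finset.sum_congr rfl fun w _ => by rw [pderiv_smul, mul_smul_comm, coeff_smul]

theorem pb_mul {F : PS} (hF : MomentumFree F) (G H : PS) :
    pb F (G * H) = G * pb F H + H * pb F G := by
  refine (hasSum_pb hF _).unique ?_
  refine (((hasSum_pb hF H).mul_left G).add ((hasSum_pb hF G).mul_left H)).congr_fun ?_
  intro w
  simp only [Derivation.leibniz, smul_eq_mul]
  ring

/-- `{F, ·}` as a derivation. -/
def poissonDer (F : PS) (hF : MomentumFree F) : Derivation ℂ PS PS :=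
  Derivation.mk' { toFun := pb F, map_add' := pb_add hF, map_smul' := pb_smul hF } (pb_mul hF)

@[simp] theorem poissonDer_apply (F : PS) (hF : MomentumFree F) (G : PS) :
    poissonDer F hF G = pb F G := rfl

theorem continuous_pderiv (w : Var) : Continuous (pderiv ℂ w : PS → PS) := by
  refine continuous_pi fun n => ?_
  change Continuous fun G : PS => coeff n (pderiv ℂ w G)
  simp only [coeff_pderiv]
  exact (WithPiTopology.continuous_coeff ℂ _).mul continuous_const

theorem continuous_pb {F : PS} (hF : MomentumFree F) : Continuous (pb F) := by
  refine continuous_pi fun n => ?_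
  change Continuous fun G : PS => coeff n (pb F G)
  simp only [coeff_pb hF]
  exact continuous_finsetSum _ fun w _ =>
    (WithPiTopology.continuous_coeff ℂ n).comp (continuous_const.mul (continuous_pderiv w))

theorem pb_X {F : PS} (hF : MomentumFree F) (w : Var) : pb F (X w) = hamField F w := by
  refine (hasSum_pb hF _).unique ?_
  have := hasSum_single (f := fun v => hamField F v * pderiv ℂ v (X w : PS)) w fun v hv => by
    rw [pderiv_X_of_ne hv.symm, mul_zero]
  simpa using this

/-- Two continuous derivations that agree on the variables are equal. -/
theorem derivation_ext {D₁ D₂ : Derivation ℂ PS PS} (h₁ : Continuous D₁) (h₂ : Continuous D₂)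
    (h : ∀ w, D₁ (X w) = D₂ (X w)) (F : PS) : D₁ F = D₂ F := by
  refine congrFun (WithPiTopology.denseRange_toMvPowerSeries.equalizer h₁ h₂ ?_) F
  funext p
  simp only [Function.comp_apply]
  induction p using MvPolynomial.induction_on with
  | C a =>
    have : ((MvPolynomial.C a : MvPolynomial Var ℂ) : PS) = algebraMap ℂ PS a := by
      simp [MvPowerSeries.algebraMap_apply]
    rw [this]; simp only [Derivation.map_algebraMap]
  | add p q hp hq => rw [MvPolynomial.coe_add, map_add, map_add, hp, hq]
  | mul_X p w hp =>
    rw [MvPolynomial.coe_mul, MvPolynomial.coe_X, Derivation.leibniz, Derivation.leibniz, hp, h]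

theorem pderiv_comm (v w : Var) (F : PS) :
    pderiv ℂ v (pderiv ℂ w F) = pderiv ℂ w (pderiv ℂ v F) := by
  classical
  ext n
  simp only [coeff_pderiv, Finsupp.add_apply]
  rw [add_right_comm]
  rcases eq_or_ne v w with rfl | h
  · rfl
  · simp [h, h.symm]; ring

theorem pderiv_hamField (v w : Var) (F : PS) :
    pderiv ℂ v (hamField F w) = hamField (pderiv ℂ v F) w := by
  simp only [hamField]
  rw [pderiv_smul, pderiv_comm]

theorem pderiv_pb {F G : PS} (hF : MomentumFree F) (hG : MomentumFree G) (v : Var) :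
    pderiv ℂ v (pb F G) = pb F (pderiv ℂ v G) - pb G (pderiv ℂ v F) := by
  have h0 := (hasSum_pb hF G).map (pderiv ℂ v : PS →+ PS) (continuous_pderiv v)
  have h1 := hasSum_pb hF (pderiv ℂ v G)
  have h2 := (Equiv.sumComm ℤ ℤ).hasSum_iff.2 (hasSum_pb hG (pderiv ℂ v F))
  refine h0.unique ((h1.sub h2).congr_fun fun w => ?_)
  simp only [Function.comp_apply, AddMonoidHom.coe_coe, Derivation.leibniz, smul_eq_mul,
    Equiv.sumComm_apply, pderiv_hamField]
  rw [pderiv_comm v w G]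
  simp only [hamField, hamSign_swap, Sum.swap_swap]
  rw [neg_smul, smul_mul_assoc, neg_mul, sub_neg_eq_add, smul_mul_assoc, mul_smul_comm,
    mul_comm (pderiv ℂ w G)]

theorem coeff_pb_ne_zero {F G : PS} {n : MultiIndex} (h : coeff n (pb F G) ≠ 0) :
    ∃ w x y, x + y = n + Finsupp.single w.swap 1 + Finsupp.single w 1 ∧
      coeff x F ≠ 0 ∧ coeff y G ≠ 0 ∧ 0 < x w.swap ∧ 0 < y w := by
  classical
  have h' : ∃ w, coeff n (hamField F w * pderiv ℂ w G) ≠ 0 := by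
    by_contra! hc
    exact h ((tsum_congr hc).trans tsum_zero)
  obtain ⟨w, hw⟩ := h'
  rw [coeff_mul] at hw
  obtain ⟨x, hx, hne⟩ := Finset.exists_ne_zero_of_sum_ne_zero hw
  rw [coeff_hamField, coeff_pderiv] at hne
  refine ⟨w, x.1 + Finsupp.single w.swap 1, x.2 + Finsupp.single w 1, ?_, ?_, ?_, ?_, ?_⟩
  · rw [← Finset.HasAntidiagonal.mem_antidiagonal.1 hx]; abel
  · exact left_ne_zero_of_mul (right_ne_zero_of_mul (left_ne_zero_of_mul hne))
  · exact left_ne_zero_of_mul (right_ne_zero_of_mul hne)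
  · simp
  · simp

theorem MomentumFree.pb {F G : PS} (hF : MomentumFree F) (hG : MomentumFree G) :
    MomentumFree (pb F G) := by
  intro n hn
  by_contra h
  obtain ⟨w, x, y, hxy, hx, hy, -, -⟩ := coeff_pb_ne_zero h
  have h1 : mom x = 0 := by by_contra h; exact hx (hF x h)
  have h2 : mom y = 0 := by by_contra h; exact hy (hG y h)
  have := congrArg mom hxy
  simp only [map_add, mom_single, varMomentum_swap, h1, h2] at this
  exact hn (by omega)

theorem hamField_pb {F G : PS} (hF : MomentumFree F) (hG : MomentumFree G) (w : Var) :
    hamField (pb F G) w = pb F (hamField G w) - pb G (hamField F w) := by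
  simp only [hamField]
  rw [pderiv_pb hF hG, smul_sub, pb_smul hF, pb_smul hG]

/-- The Jacobi identity: both sides are continuous derivations of `H`, and they agree on the
variables. -/
theorem pb_pb {F G : PS} (hF : MomentumFree F) (hG : MomentumFree G) (H : PS) :
    pb (pb F G) H = pb F (pb G H) - pb G (pb F H) := by
  refine derivation_ext (D₁ := poissonDer _ (hF.pb hG))
    (D₂ := ⁅poissonDer F hF, poissonDer G hG⁆) (continuous_pb (hF.pb hG)) ?_ ?_ H
  · have : ⇑⁅poissonDer F hF, poissonDer G hG⁆
        = fun H => pb F (pb G H) - pb G (pb F H) := by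
      funext H; simp [Derivation.commutator_apply]
    rw [this]
    exact ((continuous_pb hF).comp (continuous_pb hG)).sub
      ((continuous_pb hG).comp (continuous_pb hF))
  · intro w
    rw [Derivation.commutator_apply]
    simp only [poissonDer_apply]
    rw [pb_X (hF.pb hG), pb_X hF, pb_X hG, hamField_pb hF hG]

theorem MomentumFree.zero : MomentumFree 0 := fun _ _ => map_zero _

theorem MomentumFree.add {F G : PS} (hF : MomentumFree F) (hG : MomentumFree G) :
    MomentumFree (F + G) := fun n hn => by rw [map_add, hF n hn, hG n hn, add_zero]

theorem MomentumFree.smul {F : PS} (c : ℂ) (hF : MomentumFree F) : MomentumFree (c • F) :=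
  fun n hn => by rw [coeff_smul, hF n hn, mul_zero]

theorem MomentumFree.neg {F : PS} (hF : MomentumFree F) : MomentumFree (-F) :=
  fun n hn => by rw [map_neg, hF n hn, neg_zero]

theorem MomentumFree.sub {F G : PS} (hF : MomentumFree F) (hG : MomentumFree G) :
    MomentumFree (F - G) := fun n hn => by rw [map_sub, hF n hn, hG n hn, sub_zero]

theorem MomentumFree.sum {ι : Type*} (s : Finset ι) {F : ι → PS}
    (hF : ∀ i ∈ s, MomentumFree (F i)) : MomentumFree (∑ i ∈ s, F i) := fun n hn => by
  rw [map_sum]; exact Finset.sum_eq_zero fun i hi => hF i hi n hn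

theorem add_pb {F G : PS} (hF : MomentumFree F) (hG : MomentumFree G) (H : PS) :
    pb (F + G) H = pb F H + pb G H := by
  refine (hasSum_pb (hF.add hG) H).unique (((hasSum_pb hF H).add (hasSum_pb hG H)).congr_fun ?_)
  intro w
  simp only [hamField, map_add, smul_add, add_mul]

theorem smul_pb {F : PS} (c : ℂ) (hF : MomentumFree F) (H : PS) : pb (c • F) H = c • pb F H := by
  ext n
  rw [coeff_pb (hF.smul c), coeff_smul, coeff_pb hF, Finset.mul_sum]
  refine Finset.sum_congr rfl fun w _ => ?_
  rw [← coeff_smul, ← smul_mul_assoc]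
  simp only [hamField]
  rw [pderiv_smul, smul_comm]

theorem zero_pb (H : PS) : pb 0 H = 0 := by
  have := smul_pb (F := 0) 0 MomentumFree.zero H
  simpa using this

theorem pb_zero {F : PS} (hF : MomentumFree F) : pb F 0 = 0 := (poissonDer F hF).map_zero

theorem pb_sub {F : PS} (hF : MomentumFree F) (G H : PS) : pb F (G - H) = pb F G - pb F H :=
  (poissonDer F hF).map_sub G H

theorem neg_pb {F : PS} (hF : MomentumFree F) (H : PS) : pb (-F) H = -pb F H := by
  have := smul_pb (-1) hF H
  simpa using this

theorem sub_pb {F G : PS} (hF : MomentumFree F) (hG : MomentumFree G) (H : PS) :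
    pb (F - G) H = pb F H - pb G H := by
  rw [sub_eq_add_neg, add_pb hF hG.neg, neg_pb hG, sub_eq_add_neg]

theorem pb_sum {F : PS} (hF : MomentumFree F) {ι : Type*} (s : Finset ι) (G : ι → PS) :
    pb F (∑ i ∈ s, G i) = ∑ i ∈ s, pb F (G i) := map_sum (poissonDer F hF) _ _

theorem sum_pb {ι : Type*} (s : Finset ι) {F : ι → PS} (hF : ∀ i, MomentumFree (F i)) (G : PS) :
    pb (∑ i ∈ s, F i) G = ∑ i ∈ s, pb (F i) G := by
  classical
  induction s using Finset.induction_on with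
  | empty => simp [zero_pb]
  | insert i s hi ih =>
    rw [Finset.sum_insert hi, Finset.sum_insert hi, add_pb (hF i) (.sum s fun i _ => hF i), ih]

/-- `{G, F} = -{F, G}`. -/
theorem pb_antisymm {F G : PS} (hF : MomentumFree F) (hG : MomentumFree G) :
    pb G F = -pb F G := by
  have h2 := (Equiv.sumComm ℤ ℤ).hasSum_iff.2 (hasSum_pb hG F)
  refine h2.unique ((hasSum_pb hF G).neg.congr_fun fun w => ?_)
  simp only [Function.comp_apply, Equiv.sumComm_apply, hamField, hamSign_swap, Sum.swap_swap]
  rw [neg_smul, neg_mul, smul_mul_assoc, smul_mul_assoc, mul_comm]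

/-! ### Exponentials of Poisson brackets -/

/-- Every monomial of `F` has degree at least `d`. -/
def VanishBelow (d : ℕ) (F : PS) : Prop := ∀ n : MultiIndex, n.degree < d → coeff n F = 0

namespace VanishBelow

theorem mono {d e : ℕ} {F : PS} (h : VanishBelow d F) (hde : e ≤ d) : VanishBelow e F :=
  fun n hn => h n (hn.trans_le hde)

theorem zero (F : PS) : VanishBelow 0 F := fun _ hn => absurd hn (Nat.not_lt_zero _)

theorem add {d : ℕ} {F G : PS} (hF : VanishBelow d F) (hG : VanishBelow d G) :
    VanishBelow d (F + G) := fun n hn => by rw [map_add, hF n hn, hG n hn, add_zero]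

theorem sub {d : ℕ} {F G : PS} (hF : VanishBelow d F) (hG : VanishBelow d G) :
    VanishBelow d (F - G) := fun n hn => by rw [map_sub, hF n hn, hG n hn, sub_zero]

theorem neg {d : ℕ} {F : PS} (hF : VanishBelow d F) : VanishBelow d (-F) :=
  fun n hn => by rw [map_neg, hF n hn, neg_zero]

theorem smul {d : ℕ} {F : PS} (c : ℂ) (hF : VanishBelow d F) : VanishBelow d (c • F) :=
  fun n hn => by rw [coeff_smul, hF n hn, mul_zero]

theorem sum {ι : Type*} (s : Finset ι) {d : ℕ} {F : ι → PS} (h : ∀ i ∈ s, VanishBelow d (F i)) :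
    VanishBelow d (∑ i ∈ s, F i) := fun n hn => by
  rw [map_sum]; exact Finset.sum_eq_zero fun i hi => h i hi n hn

theorem pb {a b c : ℕ} {F G : PS} (hF : VanishBelow a F) (hG : VanishBelow b G)
    (h : c + 2 ≤ a + b) : VanishBelow c (pb F G) := by
  intro n hn
  by_contra hne
  obtain ⟨w, x, y, hxy, hx, hy, -, -⟩ := coeff_pb_ne_zero hne
  have h1 : a ≤ x.degree := not_lt.1 fun h => hx (hF x h)
  have h2 : b ≤ y.degree := not_lt.1 fun h => hy (hG y h)
  have := congrArg Finsupp.degree hxy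
  simp only [map_add, Finsupp.degree_single] at this
  omega

/-- A constant term of `G` does not contribute to `{F, G}`. -/
theorem pb_const {a c : ℕ} {F : PS} (hF : VanishBelow a F) (G : PS) (h : c + 1 ≤ a) :
    VanishBelow c (GevreyBirkhoff.pb F G) := by
  intro n hn
  by_contra hne
  obtain ⟨w, x, y, hxy, hx, -, -, hy⟩ := coeff_pb_ne_zero hne
  have h1 : a ≤ x.degree := not_lt.1 fun h => hx (hF x h)
  have h2 : 1 ≤ y.degree := hy.trans_le (Finsupp.le_degree w y)
  have := congrArg Finsupp.degree hxy
  simp only [map_add, Finsupp.degree_single] at this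
  omega

theorem pb_const_left {b c : ℕ} {G : PS} (F : PS) (hG : VanishBelow b G) (h : c + 1 ≤ b) :
    VanishBelow c (GevreyBirkhoff.pb F G) := by
  intro n hn
  by_contra hne
  obtain ⟨w, x, y, hxy, -, hy, hx, -⟩ := coeff_pb_ne_zero hne
  have h1 : b ≤ y.degree := not_lt.1 fun h => hy (hG y h)
  have h2 : 1 ≤ x.degree := hx.trans_le (Finsupp.le_degree w.swap x)
  have := congrArg Finsupp.degree hxy
  simp only [map_add, Finsupp.degree_single] at this
  omega

theorem iterate {d : ℕ} {S F : PS} (hS : VanishBelow 3 S) (hF : VanishBelow d F) (k : ℕ) :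
    VanishBelow (k + d) ((GevreyBirkhoff.pb S)^[k] F) := by
  induction k with
  | zero => simpa using hF
  | succ k ih =>
    rw [Function.iterate_succ_apply']
    exact hS.pb ih (by omega)

end VanishBelow

theorem vanishBelow_X (w : Var) : VanishBelow 1 (X w : PS) := by
  classical
  intro n hn
  rw [coeff_X, if_neg]
  rintro rfl
  simp at hn

theorem MomentumFree.iterate {S F : PS} (hS : MomentumFree S) (hF : MomentumFree F) (k : ℕ) :
    MomentumFree ((GevreyBirkhoff.pb S)^[k] F) := by
  induction k with
  | zero => exact hF
  | succ k ih => rw [Function.iterate_succ_apply']; exact hS.pb ih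

theorem pb_iterate_sub {S : PS} (hS : MomentumFree S) (F G : PS) (k : ℕ) :
    (pb S)^[k] (F - G) = (pb S)^[k] F - (pb S)^[k] G := by
  induction k generalizing F G with
  | zero => rfl
  | succ k ih => simp only [Function.iterate_succ_apply, pb_sub hS, ih]

theorem pb_iterate_add {S : PS} (hS : MomentumFree S) (F G : PS) (k : ℕ) :
    (pb S)^[k] (F + G) = (pb S)^[k] F + (pb S)^[k] G := by
  induction k generalizing F G with
  | zero => rfl
  | succ k ih => simp only [Function.iterate_succ_apply, pb_add hS, ih]

theorem pb_iterate_smul {S : PS} (hS : MomentumFree S) (c : ℂ) (F : PS) (k : ℕ) :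
    (pb S)^[k] (c • F) = c • (pb S)^[k] F := by
  induction k generalizing F with
  | zero => rfl
  | succ k ih => simp only [Function.iterate_succ_apply, pb_smul hS, ih]

theorem pb_iterate_sum {S : PS} (hS : MomentumFree S) {ι : Type*} (s : Finset ι) (F : ι → PS)
    (k : ℕ) : (pb S)^[k] (∑ i ∈ s, F i) = ∑ i ∈ s, (pb S)^[k] (F i) := by
  induction k generalizing F with
  | zero => rfl
  | succ k ih => simp only [Function.iterate_succ_apply, pb_sum hS, ih]

/-- The partial sums of `exp {S, ·}`. -/
def expPartial (S : PS) (N : ℕ) (F : PS) : PS :=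
  ∑ k ∈ Finset.range N, ((k.factorial : ℂ)⁻¹) • (pb S)^[k] F

/-- `exp {S, ·} F`. The bracket with `S` is assumed to raise the degree, so that the sum over
`k` may be cut off at the degree of the monomial. -/
def expPb (S F : PS) : PS := fun n => coeff n (expPartial S (n.degree + 1) F)

section

variable {S : PS}

theorem coeff_expPb (hS : VanishBelow 3 S) (F : PS) {n : MultiIndex} {N : ℕ} (hN : n.degree < N) :
    coeff n (expPb S F) = coeff n (expPartial S N F) := by
  change coeff n (expPartial S (n.degree + 1) F) = _
  simp only [expPartial, map_sum]
  refine Finset.sum_subset (Finset.range_mono hN) fun k _ hk => ?_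
  exact ((VanishBelow.iterate hS (.zero F) k).smul _) n
    (by rw [Finset.mem_range] at hk; omega)

theorem vanishBelow_expPb_sub (hS : VanishBelow 3 S) (F : PS) (N : ℕ) :
    VanishBelow N (expPb S F - expPartial S N F) := fun n hn => by
  rw [map_sub, coeff_expPb hS F hn, sub_self]

theorem MomentumFree.expPartial (hS : MomentumFree S) {F : PS} (hF : MomentumFree F) (N : ℕ) :
    MomentumFree (expPartial S N F) := .sum _ fun k _ => (hS.iterate hF k).smul _

theorem MomentumFree.expPb (hS : MomentumFree S) {F : PS} (hF : MomentumFree F) :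
    MomentumFree (expPb S F) := fun n hn => hS.expPartial hF _ n hn

theorem expPb_add (hS : MomentumFree S) (F G : PS) : expPb S (F + G) = expPb S F + expPb S G := by
  ext n
  change coeff n (expPartial S _ (F + G))
    = coeff n (expPartial S _ F) + coeff n (expPartial S _ G)
  rw [← map_add]
  simp only [expPartial, pb_iterate_add hS, smul_add, Finset.sum_add_distrib]

theorem expPb_smul (hS : MomentumFree S) (c : ℂ) (F : PS) : expPb S (c • F) = c • expPb S F := by
  ext n
  change coeff n (expPartial S _ (c • F)) = c * coeff n (expPartial S _ F)
  rw [← coeff_smul]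
  simp only [expPartial, pb_iterate_smul hS, Finset.smul_sum, smul_comm c]

theorem VanishBelow.expPb {d : ℕ} {F : PS} (hS : VanishBelow 3 S) (hF : VanishBelow d F) :
    VanishBelow d (expPb S F) := by
  intro n hn
  change coeff n (expPartial S (n.degree + 1) F) = 0
  exact (VanishBelow.sum _ fun k _ =>
    ((VanishBelow.iterate hS hF k).mono (by omega)).smul _) n hn

/-- `exp {S, ·}` is the identity to leading order. -/
theorem VanishBelow.expPb_sub_self {d : ℕ} {F : PS} (hS : VanishBelow 3 S) (hF : VanishBelow d F) :
    VanishBelow (d + 1) (GevreyBirkhoff.expPb S F - F) := by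
  intro n hn
  rw [map_sub]
  change coeff n (expPartial S (n.degree + 1) F) - _ = 0
  rw [expPartial, Finset.sum_range_succ', map_add]
  simp only [Nat.factorial_zero, Nat.cast_one, inv_one, one_smul, Function.iterate_zero, id,
    add_sub_cancel_right]
  exact (VanishBelow.sum _ fun k _ =>
    ((VanishBelow.iterate hS hF (k + 1)).mono (by omega)).smul _) n hn

theorem sum_range_range_eq_sum_antidiagonal {M : Type*} [AddCommMonoid M] (N : ℕ)
    (f : ℕ → ℕ → M) (hf : ∀ k l, N ≤ k + l → f k l = 0) :
    ∑ k ∈ Finset.range N, ∑ l ∈ Finset.range N, f k l =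
      ∑ m ∈ Finset.range N, ∑ x ∈ Finset.HasAntidiagonal.antidiagonal m, f x.1 x.2 := by
  classical
  rw [← Finset.sum_product', ← Finset.sum_filter_of_ne (p := fun x : ℕ × ℕ => x.1 + x.2 < N)
    (fun x _ hx => not_le.1 fun h => hx (hf _ _ h)),
    ← Finset.sum_fiberwise_of_maps_to (t := Finset.range N) (g := fun x : ℕ × ℕ => x.1 + x.2)
      (fun x hx => Finset.mem_range.2 (Finset.mem_filter.1 hx).2)]
  refine Finset.sum_congr rfl fun m hm => Finset.sum_congr ?_ fun _ _ => rfl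
  ext x
  simp only [Finset.mem_filter, Finset.mem_product, Finset.mem_range,
    Finset.HasAntidiagonal.mem_antidiagonal] at hm ⊢
  omega

theorem pb_iterate_smul_left (hS : MomentumFree S) (x : ℂ) (F : PS) (k : ℕ) :
    (pb (x • S))^[k] F = x ^ k • (pb S)^[k] F := by
  induction k with
  | zero => simp
  | succ k ih =>
    rw [Function.iterate_succ_apply', ih, Function.iterate_succ_apply', pb_smul (hS.smul x),
      smul_pb x hS, smul_smul, pow_succ]

theorem inv_factorial_mul_choose (a b : ℕ) :
    ((a + b).factorial : ℂ)⁻¹ * ((a + b).choose a : ℂ) =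
      (a.factorial : ℂ)⁻¹ * (b.factorial : ℂ)⁻¹ := by
  rw [Nat.choose_symm_add, Nat.add_choose,
    Nat.cast_div (Nat.factorial_mul_factorial_dvd_factorial_add a b)
      (by exact_mod_cast mul_ne_zero a.factorial_ne_zero b.factorial_ne_zero)]
  have h1 : (a.factorial : ℂ) ≠ 0 := by exact_mod_cast a.factorial_ne_zero
  have h2 : (b.factorial : ℂ) ≠ 0 := by exact_mod_cast b.factorial_ne_zero
  have h3 : ((a + b).factorial : ℂ) ≠ 0 := by exact_mod_cast (a + b).factorial_ne_zero
  push_cast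
  field_simp

theorem sum_antidiagonal_pow_div_factorial (x y : ℂ) (m : ℕ) :
    ∑ i ∈ Finset.HasAntidiagonal.antidiagonal m,
      ((i.1.factorial : ℂ)⁻¹ * x ^ i.1) * ((i.2.factorial : ℂ)⁻¹ * y ^ i.2) =
        (m.factorial : ℂ)⁻¹ * (x + y) ^ m := by
  rw [(Commute.all x y).add_pow', Finset.mul_sum]
  refine Finset.sum_congr rfl fun i hi => ?_
  obtain ⟨a, b⟩ := i
  obtain rfl := Finset.HasAntidiagonal.mem_antidiagonal.1 hi
  have h := inv_factorial_mul_choose a b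
  simp only [nsmul_eq_mul]
  linear_combination (-(x ^ a * y ^ b)) * h

/-- The group law for the flow of `S`. -/
theorem expPb_smul_expPb_smul (hS : MomentumFree S) (hS3 : VanishBelow 3 S) (x y : ℂ) (F : PS) :
    expPb (x • S) (expPb (y • S) F) = expPb ((x + y) • S) F := by
  ext n
  have hx : MomentumFree (x • S) := hS.smul x
  have key : coeff n (expPb (x • S) (expPb (y • S) F)) =
      coeff n (expPartial (x • S) (n.degree + 1) (expPartial (y • S) (n.degree + 1) F)) := by
    change coeff n (expPartial (x • S) (n.degree + 1) (expPb (y • S) F)) = _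
    rw [← sub_eq_zero, ← map_sub]
    simp only [expPartial, ← Finset.sum_sub_distrib, ← smul_sub, ← pb_iterate_sub hx]
    refine VanishBelow.sum (d := n.degree + 1) _ (fun k _ => VanishBelow.smul _ ?_) n (by omega)
    exact (VanishBelow.iterate (hS3.smul x)
      (vanishBelow_expPb_sub (hS3.smul y) F (n.degree + 1)) k).mono (by omega)
  rw [key]
  change _ = coeff n (expPartial ((x + y) • S) (n.degree + 1) F)
  simp only [expPartial, pb_iterate_sum hx, pb_iterate_smul hx, pb_iterate_smul_left hS,
    Finset.smul_sum, smul_smul, ← Function.iterate_add_apply, map_sum,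
    coeff_smul]
  rw [sum_range_range_eq_sum_antidiagonal]
  · refine Finset.sum_congr rfl fun m _ => ?_
    rw [← sum_antidiagonal_pow_div_factorial, Finset.sum_mul]
    refine Finset.sum_congr rfl fun i hi => ?_
    rw [Finset.HasAntidiagonal.mem_antidiagonal.1 hi]; ring
  · intro k l hkl
    rw [VanishBelow.iterate hS3 (.zero F) (k + l) n (by omega), mul_zero]

theorem expPb_zero_smul (hS : MomentumFree S) (F : PS) : expPb ((0 : ℂ) • S) F = F := by
  ext n
  change coeff n (expPartial _ (n.degree + 1) F) = _
  rw [expPartial, Finset.sum_range_succ', map_add, map_sum, Finset.sum_eq_zero, zero_add]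
  · simp
  · intro k _
    rw [pb_iterate_smul_left hS, zero_pow k.succ_ne_zero, zero_smul, smul_zero, map_zero]

theorem expPb_neg_expPb (hS : MomentumFree S) (hS3 : VanishBelow 3 S) (F : PS) :
    expPb (-S) (expPb S F) = F := by
  have := expPb_smul_expPb_smul hS hS3 (-1) 1 F
  rwa [neg_add_cancel, expPb_zero_smul hS, one_smul, neg_one_smul] at this

/-- The iterated Leibniz rule for `{S, ·}` acting on a bracket. -/
theorem pb_iterate_pb (hS : MomentumFree S) {F : PS} (hF : MomentumFree F) (G : PS) (m : ℕ) :
    (pb S)^[m] (pb F G) = ∑ x ∈ Finset.HasAntidiagonal.antidiagonal m,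
      m.choose x.1 • pb ((pb S)^[x.1] F) ((pb S)^[x.2] G) := by
  induction m with
  | zero => simp
  | succ m ih =>
    rw [Finset.sum_antidiagonal_choose_succ_nsmul
      (fun i j => pb ((pb S)^[i] F) ((pb S)^[j] G)) m, Function.iterate_succ_apply', ih, pb_sum hS]
    have hstep : ∀ i j, pb S (pb ((pb S)^[i] F) ((pb S)^[j] G)) =
        pb ((pb S)^[i] F) ((pb S)^[j + 1] G) + pb ((pb S)^[i + 1] F) ((pb S)^[j] G) := by
      intro i j
      have := pb_pb hS (hS.iterate hF i) ((pb S)^[j] G)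
      simp only [Function.iterate_succ_apply']
      rw [this]; abel
    rw [← Finset.sum_add_distrib]
    refine Finset.sum_congr rfl fun x hx => ?_
    rw [Nat.choose_symm_of_eq_add (Finset.HasAntidiagonal.mem_antidiagonal.1 hx).symm, ← smul_add,
      ← hstep]
    exact map_nsmul (poissonDer S hS) _ _

/-- `exp {S, ·}` preserves Poisson brackets. -/
theorem expPb_pb (hS : MomentumFree S) (hS3 : VanishBelow 3 S) {F : PS} (hF : MomentumFree F)
    (G : PS) : expPb S (pb F G) = pb (expPb S F) (expPb S G) := by
  ext n
  set N := n.degree + 3 with hN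
  have h1 : coeff n (pb (expPb S F) (expPb S G)) =
      coeff n (pb (expPartial S N F) (expPartial S N G)) := by
    have e : pb (expPb S F) (expPb S G) - pb (expPartial S N F) (expPartial S N G) =
        pb (expPb S F - expPartial S N F) (expPb S G) +
          pb (expPartial S N F) (expPb S G - expPartial S N G) := by
      rw [sub_pb (hS.expPb hF) (hS.expPartial hF N), pb_sub (hS.expPartial hF N)]; abel
    rw [← sub_eq_zero, ← map_sub, e]
    exact (((vanishBelow_expPb_sub hS3 F N).pb_const _ (c := n.degree + 1) (by omega)).add
      (VanishBelow.pb_const_left _ (vanishBelow_expPb_sub hS3 G N) (by omega))) n (by omega)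
  rw [h1, coeff_expPb hS3 _ (show n.degree < N by omega)]
  have hM : ∀ k, MomentumFree (((k.factorial : ℂ)⁻¹) • (pb S)^[k] F) :=
    fun k => (hS.iterate hF k).smul _
  simp only [expPartial]
  rw [sum_pb _ hM]
  simp only [pb_sum (hM _), pb_smul (hM _), smul_pb _ (hS.iterate hF _), map_sum]
  rw [sum_range_range_eq_sum_antidiagonal]
  · refine Finset.sum_congr rfl fun m _ => ?_
    rw [pb_iterate_pb hS hF, Finset.smul_sum, map_sum]
    refine Finset.sum_congr rfl fun x hx => ?_
    obtain ⟨a, b⟩ := x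
    obtain rfl := Finset.HasAntidiagonal.mem_antidiagonal.1 hx
    rw [← Nat.cast_smul_eq_nsmul ℂ]
    simp only [coeff_smul]
    rw [← mul_assoc, inv_factorial_mul_choose]
    ring
  · intro k l hkl
    have := (VanishBelow.iterate hS3 (.zero F) k).pb (c := k + l - 2)
      (VanishBelow.iterate hS3 (.zero G) l)
    by_cases h2 : 2 ≤ k + l
    · simp only [coeff_smul]
      rw [this (by omega) n (by omega), mul_zero, mul_zero]
    · omega

theorem VanishBelow.mul {a b : ℕ} {F G : PS} (hF : VanishBelow a F) (hG : VanishBelow b G) :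
    VanishBelow (a + b) (F * G) := fun n hn => by
  classical
  rw [coeff_mul]
  refine Finset.sum_eq_zero fun x hx => ?_
  have h := congrArg Finsupp.degree (Finset.HasAntidiagonal.mem_antidiagonal.1 hx)
  rw [map_add] at h
  rcases lt_or_ge x.1.degree a with h1 | h1
  · rw [hF _ h1, zero_mul]
  · rw [hG _ (by omega), mul_zero]

/-- The iterated Leibniz rule for `{S, ·}` acting on a product. -/
theorem pb_iterate_mul (hS : MomentumFree S) (F G : PS) (m : ℕ) :
    (pb S)^[m] (F * G) = ∑ x ∈ Finset.HasAntidiagonal.antidiagonal m,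
      m.choose x.1 • ((pb S)^[x.1] F * (pb S)^[x.2] G) := by
  induction m with
  | zero => simp
  | succ m ih =>
    rw [Finset.sum_antidiagonal_choose_succ_nsmul
      (fun i j => (pb S)^[i] F * (pb S)^[j] G) m, Function.iterate_succ_apply', ih, pb_sum hS]
    have hstep : ∀ i j, pb S ((pb S)^[i] F * (pb S)^[j] G) =
        (pb S)^[i] F * (pb S)^[j + 1] G + (pb S)^[i + 1] F * (pb S)^[j] G := by
      intro i j
      simp only [Function.iterate_succ_apply']
      rw [pb_mul hS]; ring
    rw [← Finset.sum_add_distrib]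
    refine Finset.sum_congr rfl fun x hx => ?_
    rw [Nat.choose_symm_of_eq_add (Finset.HasAntidiagonal.mem_antidiagonal.1 hx).symm, ← smul_add,
      ← hstep]
    exact map_nsmul (poissonDer S hS) _ _

/-- `exp {S, ·}` is multiplicative. -/
theorem expPb_mul (hS : MomentumFree S) (hS3 : VanishBelow 3 S) (F G : PS) :
    expPb S (F * G) = expPb S F * expPb S G := by
  ext n
  set N := n.degree + 1 with hN
  have h1 : coeff n (expPb S F * expPb S G) = coeff n (expPartial S N F * expPartial S N G) := by
    have e : expPb S F * expPb S G - expPartial S N F * expPartial S N G =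
        (expPb S F - expPartial S N F) * expPb S G +
          expPartial S N F * (expPb S G - expPartial S N G) := by ring
    rw [← sub_eq_zero, ← map_sub, e]
    exact ((((vanishBelow_expPb_sub hS3 F N).mul (.zero _)).mono (by omega)).add
      ((VanishBelow.mul (.zero _) (vanishBelow_expPb_sub hS3 G N)).mono (e := N) (by omega))) n
      (by omega)
  rw [h1]
  change coeff n (expPartial S N (F * G)) = _
  simp only [expPartial, Finset.sum_mul_sum, map_sum]
  rw [sum_range_range_eq_sum_antidiagonal]
  · refine Finset.sum_congr rfl fun m _ => ?_
    rw [pb_iterate_mul hS, Finset.smul_sum, map_sum]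
    refine Finset.sum_congr rfl fun x hx => ?_
    obtain ⟨a, b⟩ := x
    obtain rfl := Finset.HasAntidiagonal.mem_antidiagonal.1 hx
    rw [← Nat.cast_smul_eq_nsmul ℂ, smul_mul_smul_comm]
    simp only [coeff_smul]
    rw [← mul_assoc, inv_factorial_mul_choose]
  · intro k l hkl
    rw [smul_mul_smul_comm, coeff_smul, ((VanishBelow.iterate hS3 (.zero F) k).mul
      (VanishBelow.iterate hS3 (.zero G) l)) n (by omega), mul_zero]

end

/-! ### Formal Hamiltonians as power series -/

/-- The exponent `(α, β)` of a multi-index. -/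
abbrev toExponent : MultiIndex ≃+ Exponent := Finsupp.sumFinsuppAddEquivProdFinsupp

/-- A formal Hamiltonian as an element of the ring of power series. -/
def toPS (F : FormalSeries) : PS := fun n => F (toExponent n)

theorem coeff_toPS (F : FormalSeries) (n : MultiIndex) : coeff n (toPS F) = F (toExponent n) := rfl

theorem toPS_add (F G : FormalSeries) : toPS (F + G) = toPS F + toPS G := rfl

theorem toExponent_single_inl (j : ℤ) (k : ℕ) :
    toExponent (Finsupp.single (Sum.inl j) k) = (Finsupp.single j k, 0) := by
  refine Prod.ext ?_ ?_ <;> ext i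
  · simp [Finsupp.single_apply]
  · simp

theorem toExponent_single_inr (j : ℤ) (k : ℕ) :
    toExponent (Finsupp.single (Sum.inr j) k) = (0, Finsupp.single j k) := by
  refine Prod.ext ?_ ?_ <;> ext i
  · simp
  · simp [Finsupp.single_apply]

theorem totalDegree_toExponent (n : MultiIndex) : totalDegree (toExponent n) = n.degree := by
  induction n using Finsupp.induction_linear with
  | zero => simp [totalDegree]
  | add x y hx hy => rw [map_add, totalDegree_add, hx, hy, map_add]
  | single w k =>
    rcases w with j | j
    · rw [toExponent_single_inl]; simp [totalDegree]
    · rw [toExponent_single_inr]; simp [totalDegree]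

theorem momentum_toExponent (n : MultiIndex) : momentum (toExponent n) = mom n := by
  induction n using Finsupp.induction_linear with
  | zero => simp [momentum]
  | add x y hx hy => rw [map_add, momentum_add, hx, hy, map_add]
  | single w k =>
    rcases w with j | j
    · rw [toExponent_single_inl]
      simp [momentum, mom, Finsupp.weight_single, varMomentum, mul_comm]
    · rw [toExponent_single_inr]
      simp [momentum, mom, Finsupp.weight_single, varMomentum, mul_comm]

/-- Exchanging the exponents of `u` and `conj u`. -/
def swapIndex : MultiIndex ≃+ MultiIndex := Finsupp.domCongr (Equiv.sumComm ℤ ℤ)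

theorem swapIndex_apply (n : MultiIndex) (w : Var) : swapIndex n w = n w.swap := by
  rcases w with w | w <;> rfl

theorem swapIndex_single (w : Var) (k : ℕ) :
    swapIndex (Finsupp.single w k) = Finsupp.single w.swap k := by
  ext v
  rw [swapIndex_apply]
  rcases w with w | w <;> rcases v with v | v <;> simp [Finsupp.single_apply]

theorem swapIndex_swapIndex (n : MultiIndex) : swapIndex (swapIndex n) = n := by
  ext w; simp [swapIndex_apply]

theorem degree_swapIndex (n : MultiIndex) : (swapIndex n).degree = n.degree := by
  induction n using Finsupp.induction_linear with
  | zero => simp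
  | add x y hx hy => rw [map_add, map_add, hx, hy, map_add]
  | single w k => rw [swapIndex_single]; simp

/-- The series takes real values. -/
def IsReal (F : PS) : Prop := ∀ n, coeff (swapIndex n) F = (starRingEnd ℂ) (coeff n F)

theorem momentumFree_toPS {F : FormalSeries} (hF : IsHamiltonian F) : MomentumFree (toPS F) :=
  fun n hn => hF.momentum _ (by rwa [momentum_toExponent])

theorem toExponent_swapIndex (n : MultiIndex) :
    toExponent (swapIndex n) = ((toExponent n).2, (toExponent n).1) := by
  refine Prod.ext ?_ ?_ <;> ext i <;> exact swapIndex_apply n _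

theorem isReal_toPS {F : FormalSeries} (hF : IsHamiltonian F) : IsReal (toPS F) :=
  fun n => by
  rw [coeff_toPS, toExponent_swapIndex]
  exact hF.real (toExponent n).2 (toExponent n).1

theorem vanishBelow_toPS {d : ℕ} {F : FormalSeries} (hF : F ∈ hamiltoniansGE d) :
    VanishBelow (d + 2) (toPS F) :=
  fun n hn => hF.2 _ (by rwa [totalDegree_toExponent])

theorem coeff_X_mul_pderiv (w : Var) (F : PS) (n : MultiIndex) :
    coeff n (X w * pderiv ℂ w F) = n w * coeff n F := by
  rw [X_def, coeff_monomial_mul]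
  split_ifs with h
  · have h1 : 1 ≤ n w := by simpa using h w
    rw [coeff_pderiv, tsub_add_cancel_of_le h, one_mul, Finsupp.tsub_apply, Finsupp.single_eq_same,
      Nat.cast_sub h1]
    push_cast; ring
  · have h1 : n w = 0 := by
      by_contra h0
      exact h (Finsupp.single_le_iff.2 (Nat.one_le_iff_ne_zero.2 h0))
    simp [h1]

/-- The coefficients of `∂F/∂z_v * ∂G/∂z_w`, without derivatives. -/
theorem coeff_pderiv_mul_pderiv (v w : Var) (F G : PS) (n : MultiIndex) :
    coeff n (pderiv ℂ v F * pderiv ℂ w G) =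
      ∑ x ∈ (Finset.HasAntidiagonal.antidiagonal (n + Finsupp.single v 1 + Finsupp.single w 1) :
          Finset (MultiIndex × MultiIndex)),
        ((x.1 v : ℂ) * coeff x.1 F) * ((x.2 w : ℂ) * coeff x.2 G) := by
  classical
  simp only [← coeff_X_mul_pderiv]
  rw [← coeff_mul]
  have : X v * pderiv ℂ v F * (X w * pderiv ℂ w G) =
      pderiv ℂ v F * pderiv ℂ w G * MvPowerSeries.monomial (Finsupp.single v 1 + Finsupp.single w 1) (1 : ℂ) := by
    rw [show (1 : ℂ) = 1 * 1 by ring, ← monomial_mul_monomial, ← X_def, ← X_def]; ring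
  rw [this, add_assoc, coeff_add_mul_monomial, mul_one]

theorem poissonTerm_toExponent (F G : FormalSeries) (n : MultiIndex) (j : ℤ) :
    Complex.I * poissonTerm F G (toExponent n) j =
      coeff n (hamField (toPS F) (Sum.inl j) * pderiv ℂ (Sum.inl j) (toPS G)) +
      coeff n (hamField (toPS F) (Sum.inr j) * pderiv ℂ (Sum.inr j) (toPS G)) := by
  classical
  simp only [hamField, smul_mul_assoc, coeff_smul, coeff_pderiv_mul_pderiv, Sum.swap_inl,
    Sum.swap_inr]
  rw [add_right_comm n (Finsupp.single (Sum.inr j) 1)]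
  set N := n + Finsupp.single (Sum.inl j) 1 + Finsupp.single (Sum.inr j) 1 with hN
  have e : toExponent N = ((toExponent n).1 + unitVec j, (toExponent n).2 + unitVec j) := by
    rw [hN, map_add, map_add, toExponent_single_inl, toExponent_single_inr]
    simp
  have h : poissonTerm F G (toExponent n) j =
      ∑ x ∈ Finset.HasAntidiagonal.antidiagonal N,
        F (toExponent x.1) * G (toExponent x.2) * ((x.1 (Sum.inl j) : ℂ) * (x.2 (Sum.inr j) : ℂ) -
          (x.1 (Sum.inr j) : ℂ) * (x.2 (Sum.inl j) : ℂ)) := by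
    rw [poissonTerm, ← Finset.sum_product']
    symm
    refine Finset.sum_bij' (fun x _ => (((toExponent x.1).1, (toExponent x.2).1),
        ((toExponent x.1).2, (toExponent x.2).2)))
      (fun q _ => (toExponent.symm (q.1.1, q.2.1), toExponent.symm (q.1.2, q.2.2))) ?_ ?_ ?_ ?_ ?_
    · intro x hx
      have := congrArg toExponent (Finset.HasAntidiagonal.mem_antidiagonal.1 hx)
      rw [map_add, e] at this
      simp only [Finset.mem_product, Finset.HasAntidiagonal.mem_antidiagonal]
      exact ⟨congrArg Prod.fst this, congrArg Prod.snd this⟩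
    · intro q hq
      simp only [Finset.mem_product, Finset.HasAntidiagonal.mem_antidiagonal] at hq ⊢
      rw [← map_add]
      apply toExponent.injective
      rw [AddEquiv.apply_symm_apply, e]
      exact Prod.ext hq.1 hq.2
    · intro x _
      exact Prod.ext (toExponent.symm_apply_apply x.1) (toExponent.symm_apply_apply x.2)
    · intro q _
      simp only [AddEquiv.apply_symm_apply]
    · intro x _
      rfl
  rw [h, Finset.mul_sum, Finset.mul_sum, Finset.mul_sum, ← Finset.sum_add_distrib]
  refine Finset.sum_congr rfl fun x _ => ?_
  simp only [coeff_toPS, hamSign, Sum.elim_inl, Sum.elim_inr]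
  ring

theorem toPS_poisson {F : FormalSeries} (hF : IsHamiltonian F) (G : FormalSeries) :
    toPS (poisson F G) = pb (toPS F) (toPS G) := by
  ext n
  rw [coeff_toPS, poisson]
  have hM := momentumFree_toPS hF
  have hs : HasSum (fun w => coeff n (hamField (toPS F) w * pderiv ℂ w (toPS G)))
      (coeff n (pb (toPS F) (toPS G))) := by
    rw [coeff_pb hM]
    exact hasSum_sum_of_ne_finset_zero fun _ hw => coeff_hamField_mul_eq_zero hM hw _
  have h1 := (hs.summable.comp_injective Sum.inl_injective).hasSum
  have h2 := (hs.summable.comp_injective Sum.inr_injective).hasSum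
  have h3 := (h1.add h2).tsum_eq
  rw [hs.unique (h1.sum h2), ← h3, ← tsum_eq_finsum (L := .unconditional ℤ)
    (finite_support_poissonTerm (G := G) hF (toExponent n)), ← tsum_mul_left]
  exact tsum_congr fun j => poissonTerm_toExponent F G n j

theorem toPS_adPow {G : FormalSeries} (hG : IsHamiltonian G) (H : FormalSeries) (k : ℕ) :
    toPS ((poisson G)^[k] H) = (pb (toPS G))^[k] (toPS H) := by
  induction k with
  | zero => rfl
  | succ k ih =>
    rw [Function.iterate_succ_apply', Function.iterate_succ_apply', toPS_poisson hG, ih]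

theorem toPS_expAd {G H : FormalSeries} {d : ℕ} (hG : G ∈ hamiltoniansGE 1)
    (hH : H ∈ hamiltoniansGE d) : toPS (expAd G H) = expPb (toPS G) (toPS H) := by
  ext n
  have h3 : VanishBelow 3 (toPS G) := vanishBelow_toPS hG
  change ∑ᶠ k : ℕ, ((poisson G)^[k] H) (toExponent n) / (k.factorial : ℂ)
    = coeff n (expPartial (toPS G) (n.degree + 1) (toPS H))
  rw [finsum_eq_sum_of_support_subset (s := Finset.range (n.degree + 1))]
  · rw [expPartial, map_sum]
    refine Finset.sum_congr rfl fun k _ => ?_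
    rw [coeff_smul, ← toPS_adPow hG.1, coeff_toPS, div_eq_inv_mul]
  · intro k hk
    simp only [Finset.coe_range, Set.mem_Iio]
    by_contra hlt
    refine hk ?_
    dsimp only
    rw [← coeff_toPS ((poisson G)^[k] H), toPS_adPow hG.1,
      VanishBelow.iterate h3 (vanishBelow_toPS hH) k n (by omega), zero_div]

/-! ### The quadratic Hamiltonian and resonances -/

/-- `D_ω = ∑ j, ω_j u_j conj u_j` as a power series. -/
def quadPS (ω : ℤ → ℝ) : PS := toPS (quadratic ω)

/-- The frequency carried by a variable. -/
def varFrequency (ω : ℤ → ℝ) : Var → ℝ := Sum.elim ω (fun j => -ω j)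

/-- The divisor `ω · (α - β)` of a monomial. -/
def divisor (ω : ℤ → ℝ) : MultiIndex →+ ℝ := Finsupp.weight (varFrequency ω)

theorem divisor_single (ω : ℤ → ℝ) (w : Var) :
    divisor ω (Finsupp.single w 1) = varFrequency ω w := by
  simp [divisor, Finsupp.weight_single]

theorem varFrequency_swap (ω : ℤ → ℝ) (w : Var) :
    varFrequency ω w.swap = -varFrequency ω w := by
  rcases w with w | w <;> simp [varFrequency]

theorem divisor_swapIndex (ω : ℤ → ℝ) (n : MultiIndex) :
    divisor ω (swapIndex n) = -divisor ω n := by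
  induction n using Finsupp.induction_linear with
  | zero => simp
  | add x y hx hy => rw [map_add, map_add, hx, hy, map_add]; ring
  | single w k =>
    rw [swapIndex_single]; simp [divisor, Finsupp.weight_single, varFrequency_swap]

theorem momentumFree_quadPS (ω : ℤ → ℝ) : MomentumFree (quadPS ω) :=
  momentumFree_toPS (quadratic_mem ω).1

theorem coeff_quadPS (ω : ℤ → ℝ) (w : Var) :
    coeff (Finsupp.single w 1 + Finsupp.single w.swap 1) (quadPS ω) = ω (Sum.elim id id w) := by
  rw [quadPS, coeff_toPS, map_add]
  rcases w with j | j
  · rw [Sum.swap_inl, toExponent_single_inl, toExponent_single_inr]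
    simpa using quadratic_unitVec ω j
  · rw [Sum.swap_inr, toExponent_single_inl, toExponent_single_inr]
    simpa using quadratic_unitVec ω j

theorem coeff_quadPS_eq_zero (ω : ℤ → ℝ) {n : MultiIndex}
    (h : ∀ j : ℤ, n ≠ Finsupp.single (Sum.inl j) 1 + Finsupp.single (Sum.inr j) 1) :
    coeff n (quadPS ω) = 0 := by
  rw [quadPS, coeff_toPS]
  refine quadratic_eq_zero ω fun j hj => h j (toExponent.injective ?_)
  rw [hj, map_add, toExponent_single_inl, toExponent_single_inr]
  simp

theorem hamField_quadPS (ω : ℤ → ℝ) (w : Var) :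
    hamField (quadPS ω) w = (-Complex.I * varFrequency ω w) • X w := by
  classical
  ext n
  rw [coeff_hamField, coeff_smul, coeff_X]
  split_ifs with hn
  · subst hn
    rw [coeff_quadPS]
    have h0 : (Finsupp.single w 1 : MultiIndex) w.swap = 0 := by
      rcases w with j | j <;> simp
    rw [h0]
    rcases w with j | j <;> simp [hamSign, varFrequency]
  · rw [coeff_quadPS_eq_zero, zero_mul, mul_zero, mul_zero]
    intro j hj
    apply hn
    have h1 : w.swap = Sum.inl j ∨ w.swap = Sum.inr j := by
      by_contra! hc
      have := DFunLike.congr_fun hj w.swap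
      simp only [Finsupp.add_apply, Finsupp.single_eq_same, Finsupp.single_apply, hc.1.symm,
        hc.2.symm, if_false] at this
      omega
    rcases h1 with h1 | h1
    · rw [h1, add_comm] at hj
      have : w = Sum.inr j := by rw [← Sum.swap_swap w, h1]; rfl
      rw [this]; exact add_left_cancel hj
    · rw [h1] at hj
      have : w = Sum.inl j := by rw [← Sum.swap_swap w, h1]; rfl
      rw [this]; exact add_right_cancel hj

/-- The monomials are eigenvectors of `{D_ω, ·}`. -/
theorem coeff_pb_quadPS (ω : ℤ → ℝ) (F : PS) (n : MultiIndex) :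
    coeff n (pb (quadPS ω) F) = -Complex.I * divisor ω n * coeff n F := by
  have h : ∀ w, coeff n (hamField (quadPS ω) w * pderiv ℂ w F) =
      -Complex.I * (n w * varFrequency ω w) * coeff n F := by
    intro w
    rw [hamField_quadPS, smul_mul_assoc, coeff_smul, coeff_X_mul_pderiv]; ring
  change ∑' w, coeff n (hamField (quadPS ω) w * pderiv ℂ w F) = _
  simp only [h]
  rw [tsum_mul_right, tsum_mul_left, tsum_eq_sum (s := n.support)]
  · rw [divisor, Finsupp.weight_apply, Finsupp.sum]
    push_cast
    simp
  · intro w hw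
    rw [Finsupp.notMem_support_iff.1 hw]; simp

/-- `H` can be linearized formally: in suitable formal coordinates `x_j = u_j + O(2)` its
equations of motion are those of `D_ω`. -/
def Linearizable (ω : ℤ → ℝ) (H : PS) : Prop :=
  ∀ j : ℤ, ∃ x : PS, VanishBelow 2 (x - X (Sum.inl j)) ∧ pb H x = (-Complex.I * ω j) • x

/-- Formal linearizability is invariant under formal symplectic changes of coordinates. -/
theorem Linearizable.expPb {ω : ℤ → ℝ} {H S : PS} (hH : MomentumFree H) (hS : MomentumFree S)
    (hS3 : VanishBelow 3 S) (h : Linearizable ω H) : Linearizable ω (expPb S H) := by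
  intro j
  obtain ⟨x, hx, hHx⟩ := h j
  have hx1 : VanishBelow 1 x := by
    have := (hx.mono (show 1 ≤ 2 by norm_num)).add (vanishBelow_X (Sum.inl j))
    rwa [sub_add_cancel] at this
  refine ⟨GevreyBirkhoff.expPb S x, ?_, ?_⟩
  · have := (hS3.expPb_sub_self hx1).add hx
    rwa [sub_add_sub_cancel] at this
  · rw [← expPb_pb hS hS3 hH, hHx, expPb_smul hS]

/-- The linearizing coordinates are the images of the variables under `exp {-G, ·}`. -/
theorem linearizable_of_expPb_eq {ω : ℤ → ℝ} {H G : PS}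
    (hG : MomentumFree G) (hG3 : VanishBelow 3 G) (h : expPb G H = quadPS ω) :
    Linearizable ω H := by
  have h1 : Linearizable ω (quadPS ω) := by
    intro j
    refine ⟨X (Sum.inl j), ?_, ?_⟩
    · rw [sub_self]; exact fun n _ => map_zero _
    · rw [pb_X (momentumFree_quadPS ω), hamField_quadPS]; rfl
  have h2 := h1.expPb (momentumFree_quadPS ω) hG.neg hG3.neg
  rwa [← h, expPb_neg_expPb hG hG3] at h2

/-- The resonant part of a series. -/
def resonantPart (ω : ℤ → ℝ) (P : PS) : PS :=
  fun n => open scoped Classical in if divisor ω n = 0 then coeff n P else 0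

theorem coeff_resonantPart_of_eq {ω : ℤ → ℝ} (P : PS) {n : MultiIndex} (h : divisor ω n = 0) :
    coeff n (resonantPart ω P) = coeff n P := if_pos h

theorem coeff_resonantPart_of_ne {ω : ℤ → ℝ} (P : PS) {n : MultiIndex} (h : divisor ω n ≠ 0) :
    coeff n (resonantPart ω P) = 0 := if_neg h

theorem MomentumFree.resonantPart (ω : ℤ → ℝ) {P : PS} (hP : MomentumFree P) :
    MomentumFree (resonantPart ω P) := by
  intro n hn
  by_cases h : divisor ω n = 0
  · rw [coeff_resonantPart_of_eq P h, hP n hn]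
  · exact coeff_resonantPart_of_ne P h

/-- If `D_ω + P` is formally linearizable and `P` has order `d + 2`, then the resonant part of `P`
has order `2 d + 2`. To lowest order the equation for the linearizing coordinate `x`, restricted
to the monomials with the frequency `ω_j` of `u_j`, says that the resonant part commutes with
`u_j`. -/
theorem vanishBelow_resonantPart {ω : ℤ → ℝ} {P : PS} {d : ℕ} (hP : MomentumFree P)
    (hreal : IsReal P) (hPd : VanishBelow (d + 2) P) (hlin : Linearizable ω (quadPS ω + P)) :
    VanishBelow (2 * d + 2) (resonantPart ω P) := by
  suffices H : ∀ q, ∀ n : MultiIndex, n.degree = q → q < 2 * d + 2 → divisor ω n = 0 →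
      coeff n P = 0 by
    intro n hn
    by_cases h : divisor ω n = 0
    · rw [coeff_resonantPart_of_eq P h, H _ n rfl hn h]
    · exact coeff_resonantPart_of_ne P h
  intro q
  induction q using Nat.strong_induction_on with
  | _ q ih =>
  intro ν hνq hq hν
  by_cases hlow : q < d + 2
  · exact hPd ν (by omega)
  -- by reality it suffices to treat a monomial that contains some `conj u_j`
  have main : ∀ ν : MultiIndex, ν.degree = q → divisor ω ν = 0 → ∀ j, ν (Sum.inr j) ≠ 0 →
      coeff ν P = 0 := by
    clear hνq hν ν
    intro ν hνq hν j hj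
    obtain ⟨n, rfl⟩ : ∃ n, ν = n + Finsupp.single (Sum.inr j) 1 :=
      ⟨ν - Finsupp.single (Sum.inr j) 1, (tsub_add_cancel_of_le
        (Finsupp.single_le_iff.2 (Nat.one_le_iff_ne_zero.2 hj))).symm⟩
    have hnq : n.degree + 1 = q := by simpa using hνq
    have hn : divisor ω n = ω j := by
      rw [map_add, divisor_single] at hν
      simp only [varFrequency, Sum.elim_inr] at hν
      linarith
    obtain ⟨x, hx, hHx⟩ := hlin j
    have hx1 : VanishBelow 1 x := by
      have := (hx.mono (show 1 ≤ 2 by norm_num)).add (vanishBelow_X (Sum.inl j))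
      rwa [sub_add_cancel] at this
    have hcoeff : ∀ m, coeff m (pb P x) = Complex.I * (divisor ω m - ω j) * coeff m x := by
      intro m
      have := congrArg (coeff m) hHx
      rw [add_pb (momentumFree_quadPS ω) hP, map_add, coeff_pb_quadPS, coeff_smul] at this
      linear_combination this
    -- as `{P, x}` has order `d + 1`, the monomials of `x` below that order have frequency `ω_j`
    have hA : ∀ y, y.degree ≤ d → coeff y x ≠ 0 → divisor ω y = ω j := by
      intro y hy hne
      have h0 : coeff y (pb P x) = 0 := hPd.pb hx1 (c := d + 1) (by omega) y (by omega)
      rw [hcoeff y] at h0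
      have h1 := (mul_eq_zero.1 h0).resolve_right hne
      have h2 := (mul_eq_zero.1 h1).resolve_left Complex.I_ne_zero
      exact_mod_cast sub_eq_zero.1 h2
    set Z := resonantPart ω P with hZ
    have hZM : MomentumFree Z := hP.resonantPart ω
    have hZq : VanishBelow q Z := by
      intro m hm
      by_cases h : divisor ω m = 0
      · rw [hZ, coeff_resonantPart_of_eq P h, ih _ hm m rfl (by omega) h]
      · exact coeff_resonantPart_of_ne P h
    have h0 : coeff n (pb P x) = 0 := by rw [hcoeff, hn]; simp
    -- the nonresonant part of `P` changes the frequency of these monomials, and the others have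
    -- too high a degree, so it contributes nothing at `n`
    have hN : coeff n (pb (P - Z) x) = 0 := by
      by_contra hne
      obtain ⟨w, a, b, hab, ha, hb, -, -⟩ := coeff_pb_ne_zero hne
      have ha0 : divisor ω a ≠ 0 := by
        intro h
        apply ha
        rw [map_sub, hZ, coeff_resonantPart_of_eq P h, sub_self]
      have haP : coeff a P ≠ 0 := by
        intro h
        apply ha
        rw [map_sub, hZ, coeff_resonantPart_of_ne P ha0, h, sub_zero]
      have had : d + 2 ≤ a.degree := not_lt.1 fun h => haP (hPd a h)
      have hdeg := congrArg Finsupp.degree hab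
      simp only [map_add, Finsupp.degree_single] at hdeg
      have hbj := hA b (by omega) hb
      have hdiv := congrArg (divisor ω) hab
      simp only [map_add, divisor_single, varFrequency_swap, hbj, hn] at hdiv
      exact ha0 (by linarith)
    -- by induction `Z` has order `q`, so only the linear part of `x` matters in `{Z, x}`
    have hZx : coeff n (pb Z (x - X (Sum.inl j))) = 0 :=
      hZq.pb hx (c := q) (by omega) n (by omega)
    have hfinal : coeff n (hamField Z (Sum.inl j)) = 0 := by
      have e : pb P x = pb (P - Z) x + (pb Z (x - X (Sum.inl j)) + pb Z (X (Sum.inl j))) := by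
        rw [sub_pb hP hZM, pb_sub hZM]; abel
      rw [e, map_add, map_add, hN, hZx, zero_add, zero_add, pb_X hZM] at h0
      exact h0
    rw [coeff_hamField, hZ, Sum.swap_inl, coeff_resonantPart_of_eq P hν] at hfinal
    have h1 := (mul_eq_zero.1 hfinal).resolve_left (hamSign_ne_zero _)
    exact (mul_eq_zero.1 h1).resolve_right (by exact_mod_cast Nat.succ_ne_zero (n (Sum.inr j)))
  have hne : ν ≠ 0 := by
    rintro rfl
    simp at hνq; omega
  obtain ⟨w, hw⟩ := Finsupp.ne_iff.1 hne
  rcases w with j | j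
  · have h1 := main (swapIndex ν) (by rw [degree_swapIndex, hνq])
      (by rw [divisor_swapIndex, hν, neg_zero]) j (by rw [swapIndex_apply]; exact hw)
    rw [hreal ν] at h1
    simpa using h1
  · exact main ν hνq hν j hw

/-! ### Monomials and their derivatives -/

section Monomials

variable {A : Type*} [CommSemiring A]

/-- The monomial `z ^ n`. -/
def mon (n : MultiIndex) (z : Var → A) : A := n.prod fun w k => z w ^ k

/-- The derivative of the monomial `z ^ n` in the direction `v`. -/
def dmon (n : MultiIndex) (z v : Var → A) : A :=
  n.sum fun w k => k * mon (n - Finsupp.single w 1) z * v w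

@[simp] theorem mon_zero (z : Var → A) : mon 0 z = 1 := Finsupp.prod_zero_index

theorem mon_add (m n : MultiIndex) (z : Var → A) : mon (m + n) z = mon m z * mon n z :=
  Finsupp.prod_add_index' (fun _ => pow_zero _) fun _ _ _ => pow_add _ _ _

@[simp] theorem mon_single (w : Var) (z : Var → A) : mon (Finsupp.single w 1) z = z w := by
  simp [mon, Finsupp.prod_single_index]

theorem mon_smul (n : MultiIndex) (c : A) (z : Var → A) :
    mon n (fun w => c * z w) = c ^ n.degree * mon n z := by
  simp only [mon, mul_pow, Finsupp.prod_mul]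
  congr 1
  rw [Finsupp.degree_apply, ← Finset.prod_pow_eq_pow_sum]
  rfl

theorem dmon_eq_sum (n : MultiIndex) (z v : Var → A) {s : Finset Var} (hs : n.support ⊆ s) :
    dmon n z v = ∑ w ∈ s, (n w : A) * mon (n - Finsupp.single w 1) z * v w :=
  Finset.sum_subset hs fun w _ hw => by
    rw [Finsupp.notMem_support_iff.1 hw]; simp

@[simp] theorem dmon_zero (z v : Var → A) : dmon 0 z v = 0 := Finsupp.sum_zero_index

theorem dmon_add_single (n : MultiIndex) (w : Var) (z v : Var → A) :
    dmon (n + Finsupp.single w 1) z v = dmon n z v * z w + mon n z * v w := by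
  classical
  have h1 : (n + Finsupp.single w 1).support ⊆ insert w n.support := by
    intro x hx
    rw [Finset.mem_insert, Finsupp.mem_support_iff]
    by_contra! hc
    simp [hc.1.symm, hc.2] at hx
  rw [dmon_eq_sum _ z v h1, dmon_eq_sum n z v (Finset.subset_insert w _), Finset.sum_mul]
  have h2 : mon n z * v w = ∑ x ∈ insert w n.support, if x = w then mon n z * v w else 0 := by
    rw [Finset.sum_ite_eq' _ w, if_pos (Finset.mem_insert_self _ _)]
  rw [h2, ← Finset.sum_add_distrib]
  refine Finset.sum_congr rfl fun x _ => ?_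
  rcases Nat.eq_zero_or_pos (n x) with hx | hx
  · by_cases hxw : x = w
    · subst hxw; simp [hx]
    · simp [hx, hxw]
  · have e : n + Finsupp.single w 1 - Finsupp.single x 1 =
        n - Finsupp.single x 1 + Finsupp.single w 1 :=
      tsub_add_eq_add_tsub (Finsupp.single_le_iff.2 hx) |>.symm
    rw [e, mon_add, mon_single]
    by_cases hxw : x = w
    · subst hxw
      have e2 : mon n z = mon (n - Finsupp.single x 1) z * z x := by
        conv_lhs => rw [← tsub_add_cancel_of_le (Finsupp.single_le_iff.2 hx : _ ≤ n), mon_add,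
          mon_single]
      simp only [if_true, Finsupp.add_apply, Finsupp.single_eq_same, Nat.cast_add, Nat.cast_one]
      rw [e2]; ring
    · simp only [hxw, if_false, Finsupp.add_apply, Finsupp.single_apply, Ne.symm hxw, add_zero]
      ring

end Monomials

theorem multiIndex_induction {P : MultiIndex → Prop} (h0 : P 0)
    (h1 : ∀ n w, P n → P (n + Finsupp.single w 1)) (n : MultiIndex) : P n := by
  induction hd : n.degree generalizing n with
  | zero => rw [(Finsupp.degree_eq_zero_iff n).1 hd]; exact h0
  | succ d ih =>
    have hne : n ≠ 0 := by rintro rfl; simp at hd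
    obtain ⟨w, hw⟩ := Finsupp.ne_iff.1 hne
    have hle : Finsupp.single w 1 ≤ n := Finsupp.single_le_iff.2 (Nat.one_le_iff_ne_zero.2 hw)
    rw [← tsub_add_cancel_of_le hle]
    refine h1 _ w (ih _ ?_)
    have := congrArg Finsupp.degree (tsub_add_cancel_of_le hle)
    rw [map_add, Finsupp.degree_single, hd] at this
    omega

theorem mon_mono (n : MultiIndex) {z z' : Var → ℝ≥0∞} (h : ∀ w, z w ≤ z' w) :
    mon n z ≤ mon n z' :=
  Finset.prod_le_prod' fun w _ => pow_le_pow_left' (h w) _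

theorem dmon_mono (n : MultiIndex) {z z' v v' : Var → ℝ≥0∞} (h : ∀ w, z w ≤ z' w)
    (hv : ∀ w, v w ≤ v' w) : dmon n z v ≤ dmon n z' v' :=
  Finset.sum_le_sum fun w _ => mul_le_mul' (mul_le_mul' le_rfl (mon_mono _ h)) (hv w)

/-- The first two terms of the binomial expansion of `(z + v) ^ n`. -/
theorem mon_add_dmon_le (n : MultiIndex) (z v : Var → ℝ≥0∞) :
    mon n z + dmon n z v ≤ mon n (fun w => z w + v w) := by
  induction n using multiIndex_induction with
  | h0 => simp
  | h1 n w ih =>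
    rw [mon_add, mon_single, dmon_add_single, mon_add, mon_single]
    calc mon n z * z w + (dmon n z v * z w + mon n z * v w)
        ≤ (mon n z + dmon n z v) * (z w + v w) := by
          rw [add_mul, mul_add, mul_add]
          have : mon n z * z w + (dmon n z v * z w + mon n z * v w) + dmon n z v * v w =
            mon n z * z w + mon n z * v w + (dmon n z v * z w + dmon n z v * v w) := by ring
          rw [← this]; exact le_self_add
      _ ≤ _ := mul_le_mul' ih le_rfl

theorem enorm_natCast (k : ℕ) : ‖(k : ℂ)‖ₑ = k := by
  simp [enorm_eq_nnnorm]

theorem enorm_mon (n : MultiIndex) (z : Var → ℂ) : ‖mon n z‖ₑ = mon n (fun w => ‖z w‖ₑ) := by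
  induction n using multiIndex_induction with
  | h0 => simp
  | h1 n w ih => rw [mon_add, mon_single, mon_add, mon_single, enorm_mul, ih]

theorem enorm_dmon_le (n : MultiIndex) (z v : Var → ℂ) :
    ‖dmon n z v‖ₑ ≤ dmon n (fun w => ‖z w‖ₑ) (fun w => ‖v w‖ₑ) := by
  induction n using multiIndex_induction with
  | h0 => simp
  | h1 n w ih =>
    rw [dmon_add_single, dmon_add_single]
    refine (enorm_add_le _ _).trans ?_
    rw [enorm_mul, enorm_mul, enorm_mon]
    gcongr

theorem hasDerivAt_mon (n : MultiIndex) {z v : ℝ → Var → ℂ} {t : ℝ}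
    (h : ∀ w, HasDerivAt (fun t => z t w) (v t w) t) :
    HasDerivAt (fun t => mon n (z t)) (dmon n (z t) (v t)) t := by
  induction n using multiIndex_induction with
  | h0 => simpa using hasDerivAt_const t (1 : ℂ)
  | h1 n w ih =>
    simp only [mon_add, mon_single, dmon_add_single]
    exact ih.mul (h w)

/-! ### Majorants -/

/-- The index of a variable. -/
def site : Var → ℤ := Sum.elim id id

@[simp] theorem site_swap (w : Var) : site w.swap = site w := by rcases w with w | w <;> rfl

/-- The value of the Cauchy majorant `∑ |F_n| z ^ n` at the nonnegative sequence
`z_j = conj z_j = a_j`. -/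
def maj (F : PS) (a : ℤ → ℝ≥0∞) : ℝ≥0∞ := ∑' n, ‖coeff n F‖ₑ * mon n (a ∘ site)

/-- The derivative of the Cauchy majorant in the direction `b`. -/
def dmaj (F : PS) (a : ℤ → ℝ≥0∞) (b : Var → ℝ≥0∞) : ℝ≥0∞ :=
  ∑' n, ‖coeff n F‖ₑ * dmon n (a ∘ site) b

theorem maj_add_dmaj_le (F : PS) (a b : ℤ → ℝ≥0∞) :
    maj F a + dmaj F a (b ∘ site) ≤ maj F (fun j => a j + b j) := by
  rw [maj, dmaj, ← ENNReal.tsum_add]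
  refine ENNReal.tsum_le_tsum fun n => ?_
  rw [← mul_add]
  exact mul_le_mul' le_rfl (mon_add_dmon_le n _ _)

theorem dmaj_smul (F : PS) (a : ℤ → ℝ≥0∞) (c : ℝ≥0∞) (b : Var → ℝ≥0∞) :
    dmaj F a (fun w => c * b w) = c * dmaj F a b := by
  rw [dmaj, dmaj, ← ENNReal.tsum_mul_left]
  refine tsum_congr fun n => ?_
  rw [mul_left_comm]
  congr 1
  rw [dmon, dmon, Finsupp.mul_sum]
  exact Finsupp.sum_congr fun w _ => by ring

theorem maj_pderiv (F : PS) (a : ℤ → ℝ≥0∞) (v : Var) :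
    maj (pderiv ℂ v F) a =
      ∑' n, ‖coeff n F‖ₑ * ((n v : ℝ≥0∞) * mon (n - Finsupp.single v 1) (a ∘ site)) := by
  have hinj : Function.Injective fun n : MultiIndex => n + Finsupp.single v 1 :=
    fun _ _ h => add_right_cancel h
  rw [← hinj.tsum_eq (f := fun n => ‖coeff n F‖ₑ *
    ((n v : ℝ≥0∞) * mon (n - Finsupp.single v 1) (a ∘ site)))]
  · refine tsum_congr fun n => ?_
    rw [coeff_pderiv, enorm_mul, mul_assoc]
    simp only [Finsupp.add_apply, Finsupp.single_eq_same, add_tsub_cancel_right]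
    congr 2
    rw [← Nat.cast_succ]
    exact enorm_natCast _
  · intro n hn
    have hv : n v ≠ 0 := by
      intro h; exact hn (by simp [h])
    exact ⟨n - Finsupp.single v 1, tsub_add_cancel_of_le
      (Finsupp.single_le_iff.2 (Nat.one_le_iff_ne_zero.2 hv))⟩

theorem dmaj_eq_tsum (F : PS) (a : ℤ → ℝ≥0∞) (b : Var → ℝ≥0∞) :
    dmaj F a b = ∑' v, b v * maj (pderiv ℂ v F) a := by
  simp only [maj_pderiv, ← ENNReal.tsum_mul_left]
  rw [ENNReal.tsum_comm]
  refine tsum_congr fun n => ?_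
  rw [tsum_eq_sum (s := n.support), dmon, Finsupp.sum, Finset.mul_sum]
  · exact Finset.sum_congr rfl fun v _ => by ring
  · intro v hv
    rw [Finsupp.notMem_support_iff.1 hv]; simp

theorem maj_mul_le (F G : PS) (a : ℤ → ℝ≥0∞) : maj (F * G) a ≤ maj F a * maj G a := by
  classical
  calc maj (F * G) a ≤ ∑' n, ∑' x : Finset.HasAntidiagonal.antidiagonal n,
        (‖coeff x.1.1 F‖ₑ * mon x.1.1 (a ∘ site)) * (‖coeff x.1.2 G‖ₑ * mon x.1.2 (a ∘ site)) := by
        refine ENNReal.tsum_le_tsum fun n => ?_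
        rw [coeff_mul, tsum_fintype,
          Finset.sum_coe_sort (Finset.HasAntidiagonal.antidiagonal n) (fun x : MultiIndex × MultiIndex =>
            (‖coeff x.1 F‖ₑ * mon x.1 (a ∘ site)) * (‖coeff x.2 G‖ₑ * mon x.2 (a ∘ site)))]
        refine (mul_le_mul' (enorm_sum_le _ _) le_rfl).trans_eq ?_
        rw [Finset.sum_mul]
        refine Finset.sum_congr rfl fun x hx => ?_
        rw [← Finset.HasAntidiagonal.mem_antidiagonal.1 hx, mon_add, enorm_mul]
        ring
    _ = ∑' x : MultiIndex × MultiIndex,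
        (‖coeff x.1 F‖ₑ * mon x.1 (a ∘ site)) * (‖coeff x.2 G‖ₑ * mon x.2 (a ∘ site)) := by
        rw [← ENNReal.tsum_sigma
          (f := fun (n : MultiIndex) (x : Finset.HasAntidiagonal.antidiagonal n) =>
          (‖coeff x.1.1 F‖ₑ * mon x.1.1 (a ∘ site)) * (‖coeff x.1.2 G‖ₑ * mon x.1.2 (a ∘ site))),
          ← Finset.HasAntidiagonal.sigmaAntidiagonalEquivProd.tsum_eq]
        rfl
    _ = _ := by
        rw [ENNReal.tsum_prod (f := fun x y : MultiIndex =>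
          (‖coeff x F‖ₑ * mon x (a ∘ site)) * (‖coeff y G‖ₑ * mon y (a ∘ site)))]
        simp only [ENNReal.tsum_mul_left, ENNReal.tsum_mul_right]
        rfl

theorem maj_smul (c : ℂ) (F : PS) (a : ℤ → ℝ≥0∞) : maj (c • F) a = ‖c‖ₑ * maj F a := by
  rw [maj, maj, ← ENNReal.tsum_mul_left]
  exact tsum_congr fun n => by rw [coeff_smul, enorm_mul, mul_assoc]

theorem maj_add_le (F G : PS) (a : ℤ → ℝ≥0∞) : maj (F + G) a ≤ maj F a + maj G a := by
  rw [maj, maj, maj, ← ENNReal.tsum_add]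
  refine ENNReal.tsum_le_tsum fun n => ?_
  rw [← add_mul, map_add]
  exact mul_le_mul' (enorm_add_le _ _) le_rfl

theorem maj_neg (F : PS) (a : ℤ → ℝ≥0∞) : maj (-F) a = maj F a := by
  simp [maj]

theorem maj_sub_le (F G : PS) (a : ℤ → ℝ≥0∞) : maj (F - G) a ≤ maj F a + maj G a := by
  rw [sub_eq_add_neg, ← maj_neg G]; exact maj_add_le _ _ _

theorem maj_le_of_enorm_le {F G : PS} (h : ∀ n, ‖coeff n F‖ₑ ≤ ‖coeff n G‖ₑ) (a : ℤ → ℝ≥0∞) :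
    maj F a ≤ maj G a := ENNReal.tsum_le_tsum fun n => mul_le_mul' (h n) le_rfl

/-- If the coefficients of `F` are sums of those of the `G k`, its majorant is at most the sum of
their majorants. -/
theorem maj_le_tsum {ι : Type*} {F : PS} {G : ι → PS}
    (h : ∀ n, ‖coeff n F‖ₑ ≤ ∑' k, ‖coeff n (G k)‖ₑ) (a : ℤ → ℝ≥0∞) :
    maj F a ≤ ∑' k, maj (G k) a := by
  simp only [maj]
  rw [ENNReal.tsum_comm]
  refine ENNReal.tsum_le_tsum fun n => ?_
  rw [ENNReal.tsum_mul_right]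
  exact mul_le_mul' (h n) le_rfl

theorem enorm_hamSign (w : Var) : ‖hamSign w‖ₑ = 1 := by
  rcases w with w | w <;> simp [hamSign, enorm_eq_nnnorm]

theorem maj_hamField (F : PS) (w : Var) (a : ℤ → ℝ≥0∞) :
    maj (hamField F w) a = maj (pderiv ℂ w.swap F) a := by
  rw [hamField, maj_smul, enorm_hamSign, one_mul]

theorem maj_pb_le (F G : PS) (a : ℤ → ℝ≥0∞) :
    maj (pb F G) a ≤ dmaj G a (fun w => maj (pderiv ℂ w.swap F) a) := by
  rw [dmaj_eq_tsum]
  calc maj (pb F G) a ≤ ∑' w, maj (hamField F w * pderiv ℂ w G) a :=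
        maj_le_tsum (fun n => enorm_tsum_le_tsum_enorm) a
    _ ≤ _ := ENNReal.tsum_le_tsum fun w => by
        rw [← maj_hamField]; exact maj_mul_le _ _ _

theorem IsReal.maj_pderiv_swap {F : PS} (hF : IsReal F) (a : ℤ → ℝ≥0∞) (w : Var) :
    maj (pderiv ℂ w.swap F) a = maj (pderiv ℂ w F) a := by
  have key : ∀ m : MultiIndex, mon (swapIndex m) (a ∘ site) = mon m (a ∘ site) := by
    intro m
    induction m using multiIndex_induction with
    | h0 => simp
    | h1 n w ih =>
      rw [map_add, swapIndex_single, mon_add, mon_add, ih, mon_single, mon_single]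
      simp
  rw [maj, maj, ← swapIndex.toEquiv.tsum_eq]
  refine tsum_congr fun n => ?_
  simp only [AddEquiv.toEquiv_eq_coe, AddEquiv.coe_toEquiv]
  rw [key, coeff_pderiv, coeff_pderiv, swapIndex_apply, Sum.swap_swap, ← swapIndex_single,
    ← map_add, hF, enorm_mul, enorm_mul]
  congr 2
  simp [enorm_eq_nnnorm]

/-! ### Weighted `ℓ²` norms of sequences -/

/-- The `ℓ²` norm of the sequence `w_j a_j`. -/
def wnorm (w a : ℤ → ℝ≥0∞) : ℝ≥0∞ := (∑' j, (w j * a j) ^ (2 : ℝ)) ^ (1 / 2 : ℝ)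

theorem wnorm_mono (w : ℤ → ℝ≥0∞) {a b : ℤ → ℝ≥0∞} (h : ∀ j, a j ≤ b j) :
    wnorm w a ≤ wnorm w b :=
  ENNReal.rpow_le_rpow (ENNReal.tsum_le_tsum fun j =>
    ENNReal.rpow_le_rpow (mul_le_mul' le_rfl (h j)) (by norm_num)) (by norm_num)

theorem wnorm_congr_mul {w w' a a' : ℤ → ℝ≥0∞} (h : ∀ j, w j * a j = w' j * a' j) :
    wnorm w a = wnorm w' a' := by simp only [wnorm, h]

theorem wnorm_le_of_mul_le {w w' a a' : ℤ → ℝ≥0∞} (h : ∀ j, w j * a j ≤ w' j * a' j) :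
    wnorm w a ≤ wnorm w' a' :=
  ENNReal.rpow_le_rpow (ENNReal.tsum_le_tsum fun j =>
    ENNReal.rpow_le_rpow (h j) (by norm_num)) (by norm_num)

theorem wnorm_smul (w : ℤ → ℝ≥0∞) (c : ℝ≥0∞) (a : ℤ → ℝ≥0∞) :
    wnorm w (fun j => c * a j) = c * wnorm w a := by
  have h : ∀ j, (w j * (c * a j)) ^ (2 : ℝ) = c ^ (2 : ℝ) * (w j * a j) ^ (2 : ℝ) := fun j => by
    rw [mul_left_comm, ENNReal.mul_rpow_of_nonneg _ _ (by norm_num)]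
  simp only [wnorm, h, ENNReal.tsum_mul_left]
  rw [ENNReal.mul_rpow_of_nonneg _ _ (by norm_num), ← ENNReal.rpow_mul]
  norm_num

theorem le_wnorm (w a : ℤ → ℝ≥0∞) (j : ℤ) : w j * a j ≤ wnorm w a := by
  have h := ENNReal.le_tsum (f := fun j => (w j * a j) ^ (2 : ℝ)) j
  have h2 := ENNReal.rpow_le_rpow h (z := 1 / 2) (by norm_num)
  rwa [← ENNReal.rpow_mul, show (2 : ℝ) * (1 / 2) = 1 by norm_num, ENNReal.rpow_one] at h2

theorem wnorm_le_iff {w a : ℤ → ℝ≥0∞} {C : ℝ≥0∞} :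
    wnorm w a ≤ C ↔ ∀ s : Finset ℤ, (∑ j ∈ s, (w j * a j) ^ (2 : ℝ)) ^ (1 / 2 : ℝ) ≤ C := by
  have h : ∀ x : ℝ≥0∞, x ^ (1 / 2 : ℝ) ≤ C ↔ x ≤ C ^ (2 : ℝ) := fun x => by
    rw [one_div, ENNReal.rpow_inv_le_iff (by norm_num)]
  simp only [wnorm, h]
  rw [ENNReal.tsum_eq_iSup_sum, iSup_le_iff]

/-- The countable triangle inequality. -/
theorem wnorm_tsum_le {w : ℤ → ℝ≥0∞} (hw : ∀ j, w j ≠ ⊤) {ι : Type*} (a : ι → ℤ → ℝ≥0∞) :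
    wnorm w (fun j => ∑' k, a k j) ≤ ∑' k, wnorm w (a k) := by
  classical
  rw [wnorm_le_iff]
  intro s
  have hfin : ∀ K : Finset ι, (∑ j ∈ s, (w j * ∑ k ∈ K, a k j) ^ (2 : ℝ)) ^ (1 / 2 : ℝ) ≤
      ∑ k ∈ K, wnorm w (a k) := by
    intro K
    induction K using Finset.induction_on with
    | empty => simp
    | insert k K hk ih =>
      simp only [Finset.sum_insert hk, mul_add]
      refine (ENNReal.Lp_add_le s _ _ (by norm_num)).trans (add_le_add ?_ ih)
      exact wnorm_le_iff.1 le_rfl s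
  have hlim : Filter.Tendsto
      (fun K : Finset ι => (∑ j ∈ s, (w j * ∑ k ∈ K, a k j) ^ (2 : ℝ)) ^ (1 / 2 : ℝ)) Filter.atTop
      (nhds ((∑ j ∈ s, (w j * ∑' k, a k j) ^ (2 : ℝ)) ^ (1 / 2 : ℝ))) := by
    refine (ENNReal.continuous_rpow_const.tendsto _).comp (tendsto_finsetSum s fun j _ => ?_)
    refine (ENNReal.continuous_rpow_const.tendsto _).comp ?_
    exact ENNReal.Tendsto.const_mul ENNReal.summable.hasSum (Or.inr (hw j))
  exact le_of_tendsto' hlim fun K => (hfin K).trans (ENNReal.sum_le_tsum K)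

theorem wnorm_add_le {w : ℤ → ℝ≥0∞} (hw : ∀ j, w j ≠ ⊤) (a b : ℤ → ℝ≥0∞) :
    wnorm w (fun j => a j + b j) ≤ wnorm w a + wnorm w b := by
  have h := wnorm_tsum_le hw (fun k : Bool => if k then a else b)
  simpa [tsum_fintype] using h

/-! ### Reality -/

/-- The complex conjugate of the function represented by a series. -/
def conjPS (F : PS) : PS := fun n => (starRingEnd ℂ) (coeff (swapIndex n) F)

theorem coeff_conjPS (F : PS) (n : MultiIndex) :
    coeff n (conjPS F) = (starRingEnd ℂ) (coeff (swapIndex n) F) := rfl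

theorem isReal_iff {F : PS} : IsReal F ↔ conjPS F = F := by
  constructor
  · intro h
    ext n
    rw [coeff_conjPS, h, Complex.conj_conj]
  · intro h n
    conv_rhs => rw [← h, coeff_conjPS, Complex.conj_conj]

theorem conjPS_mul (F G : PS) : conjPS (F * G) = conjPS F * conjPS G := by
  classical
  ext n
  rw [coeff_conjPS, coeff_mul, coeff_mul, map_sum]
  refine Finset.sum_bij' (fun x _ => (swapIndex x.1, swapIndex x.2))
    (fun x _ => (swapIndex x.1, swapIndex x.2)) ?_ ?_ ?_ ?_ ?_
  · intro x hx
    have := Finset.HasAntidiagonal.mem_antidiagonal.1 hx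
    rw [Finset.HasAntidiagonal.mem_antidiagonal, ← map_add, this, swapIndex_swapIndex]
  · intro x hx
    have := Finset.HasAntidiagonal.mem_antidiagonal.1 hx
    rw [Finset.HasAntidiagonal.mem_antidiagonal, ← map_add, this]
  · intro x _; simp [swapIndex_swapIndex]
  · intro x _; simp [swapIndex_swapIndex]
  · intro x _
    simp only [coeff_conjPS, swapIndex_swapIndex, map_mul]

theorem conjPS_pderiv (w : Var) (F : PS) :
    conjPS (pderiv ℂ w F) = pderiv ℂ w.swap (conjPS F) := by
  ext n
  rw [coeff_conjPS, coeff_pderiv, coeff_pderiv, coeff_conjPS, map_add, swapIndex_single,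
    Sum.swap_swap, swapIndex_apply]
  simp

theorem conjPS_smul (c : ℂ) (F : PS) : conjPS (c • F) = (starRingEnd ℂ) c • conjPS F := by
  ext n
  rw [coeff_conjPS, coeff_smul, coeff_smul, coeff_conjPS, map_mul]

theorem conjPS_hamField (F : PS) (w : Var) :
    conjPS (hamField F w) = hamField (conjPS F) w.swap := by
  rw [hamField, conjPS_smul, conjPS_pderiv, hamField]
  congr 1
  rcases w with w | w <;> simp [hamSign]

theorem conjPS_add (F G : PS) : conjPS (F + G) = conjPS F + conjPS G := by
  ext n
  rw [coeff_conjPS, map_add, map_add, map_add, coeff_conjPS, coeff_conjPS]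

theorem conjPS_sum {ι : Type*} (s : Finset ι) (F : ι → PS) :
    conjPS (∑ i ∈ s, F i) = ∑ i ∈ s, conjPS (F i) := by
  ext n
  rw [coeff_conjPS, map_sum, map_sum, map_sum]
  rfl

theorem conjPS_pb (F G : PS) : conjPS (pb F G) = pb (conjPS F) (conjPS G) := by
  ext n
  have h : ∀ w, (starRingEnd ℂ) (coeff (swapIndex n) (hamField F w * pderiv ℂ w G)) =
      coeff n (hamField (conjPS F) w.swap * pderiv ℂ w.swap (conjPS G)) := by
    intro w
    rw [← conjPS_hamField, ← conjPS_pderiv, ← conjPS_mul, coeff_conjPS]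
  rw [coeff_conjPS]
  change (starRingEnd ℂ) (∑' w, coeff (swapIndex n) (hamField F w * pderiv ℂ w G)) = ∑' w, _
  rw [Complex.conj_tsum]
  simp only [h]
  exact (Equiv.sumComm ℤ ℤ).tsum_eq
    (fun w => coeff n (hamField (conjPS F) w * pderiv ℂ w (conjPS G)))

theorem conjPS_iterate (S F : PS) (k : ℕ) :
    conjPS ((pb S)^[k] F) = (pb (conjPS S))^[k] (conjPS F) := by
  induction k with
  | zero => rfl
  | succ k ih => rw [Function.iterate_succ_apply', Function.iterate_succ_apply', conjPS_pb, ih]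

theorem conjPS_expPb (S F : PS) : conjPS (expPb S F) = expPb (conjPS S) (conjPS F) := by
  ext n
  have h : conjPS (expPartial S (n.degree + 1) F) =
      expPartial (conjPS S) (n.degree + 1) (conjPS F) := by
    simp only [expPartial, conjPS_sum, conjPS_smul, conjPS_iterate, map_inv₀, map_natCast]
  change _ = coeff n (expPartial (conjPS S) (n.degree + 1) (conjPS F))
  rw [← h, coeff_conjPS, coeff_conjPS]
  change (starRingEnd ℂ) (coeff (swapIndex n) (expPartial S ((swapIndex n).degree + 1) F)) = _
  rw [degree_swapIndex]

theorem conjPS_X (w : Var) : conjPS (X w) = X w.swap := by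
  classical
  ext n
  rw [coeff_conjPS, coeff_X, coeff_X, ← swapIndex_single]
  have : swapIndex n = Finsupp.single w 1 ↔ n = swapIndex (Finsupp.single w 1) :=
    ⟨fun h => by rw [← h, swapIndex_swapIndex], fun h => by rw [h, swapIndex_swapIndex]⟩
  by_cases h : swapIndex n = Finsupp.single w 1
  · rw [if_pos h, if_pos (this.1 h), map_one]
  · rw [if_neg h, if_neg (fun h' => h (this.2 h')), map_zero]

theorem IsReal.add {F G : PS} (hF : IsReal F) (hG : IsReal G) : IsReal (F + G) := by
  rw [isReal_iff, conjPS_add, isReal_iff.1 hF, isReal_iff.1 hG]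

theorem IsReal.sub {F G : PS} (hF : IsReal F) (hG : IsReal G) : IsReal (F - G) := fun n => by
  rw [map_sub, map_sub, map_sub, hF, hG]

theorem IsReal.smul {F : PS} (c : ℝ) (hF : IsReal F) : IsReal ((c : ℂ) • F) := by
  rw [isReal_iff, conjPS_smul, isReal_iff.1 hF, Complex.conj_ofReal]

theorem IsReal.iterate {S F : PS} (hS : IsReal S) (hF : IsReal F) (k : ℕ) :
    IsReal ((GevreyBirkhoff.pb S)^[k] F) := by
  rw [isReal_iff, conjPS_iterate, isReal_iff.1 hS, isReal_iff.1 hF]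

theorem IsReal.expPb {S F : PS} (hS : IsReal S) (hF : IsReal F) : IsReal (expPb S F) := by
  rw [isReal_iff, conjPS_expPb, isReal_iff.1 hS, isReal_iff.1 hF]

theorem IsReal.resonantPart (ω : ℤ → ℝ) {P : PS} (hP : IsReal P) : IsReal (resonantPart ω P) := by
  intro n
  by_cases h : divisor ω n = 0
  · rw [coeff_resonantPart_of_eq P h, coeff_resonantPart_of_eq P
      (by rw [divisor_swapIndex, h, neg_zero]), hP]
  · rw [coeff_resonantPart_of_ne P h, coeff_resonantPart_of_ne P
      (by rw [divisor_swapIndex]; exact neg_ne_zero.2 h), map_zero]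

/-! ### Bounds for Lie derivatives and Lie series -/

/-- The majorants of the family `Y` map the ball of radius `R` of the weighted `ℓ²` space into the
ball of radius `c`. -/
def FamBound (w : ℤ → ℝ≥0∞) (R : ℝ) (Y : ℤ → PS) (c : ℝ) : Prop :=
  ∀ a, wnorm w a ≤ ENNReal.ofReal R → wnorm w (fun j => maj (Y j) a) ≤ ENNReal.ofReal c

/-- The majorant of the Hamiltonian vector field of `S` is bounded by `c` on the ball of
radius `R`. -/
def HamBound (w : ℤ → ℝ≥0∞) (R : ℝ) (S : PS) (c : ℝ) : Prop :=
  FamBound w R (fun j => pderiv ℂ (Sum.inr j) S) c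

variable {w : ℤ → ℝ≥0∞}

theorem FamBound.mono {R R' c c' : ℝ} {Y : ℤ → PS} (h : FamBound w R Y c) (hR : R' ≤ R)
    (hc : c ≤ c') : FamBound w R' Y c' := fun a ha =>
  (h a (ha.trans (ENNReal.ofReal_le_ofReal hR))).trans (ENNReal.ofReal_le_ofReal hc)

theorem HamBound.mono {R R' c c' : ℝ} {S : PS} (h : HamBound w R S c) (hR : R' ≤ R)
    (hc : c ≤ c') : HamBound w R' S c' := FamBound.mono h hR hc

theorem FamBound.of_enorm_le {R c : ℝ} {Y Z : ℤ → PS} (h : FamBound w R Y c)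
    (hZ : ∀ j n, ‖coeff n (Z j)‖ₑ ≤ ‖coeff n (Y j)‖ₑ) : FamBound w R Z c := fun a ha =>
  (wnorm_mono w fun j => maj_le_of_enorm_le (hZ j) a).trans (h a ha)

theorem HamBound.of_enorm_le {R c : ℝ} {S T : PS} (h : HamBound w R S c)
    (hT : ∀ n, ‖coeff n T‖ₑ ≤ ‖coeff n S‖ₑ) : HamBound w R T c :=
  FamBound.of_enorm_le h fun j n => by
    rw [coeff_pderiv, coeff_pderiv, enorm_mul, enorm_mul]
    exact mul_le_mul' (hT _) le_rfl

theorem FamBound.add (hw : ∀ j, w j ≠ ⊤) {R c d : ℝ} {Y Z : ℤ → PS} (hY : FamBound w R Y c)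
    (hZ : FamBound w R Z d) (hc : 0 ≤ c) (hd : 0 ≤ d) :
    FamBound w R (fun j => Y j + Z j) (c + d) := fun a ha => by
  rw [ENNReal.ofReal_add hc hd]
  exact ((wnorm_mono w fun j => maj_add_le _ _ a).trans (wnorm_add_le hw _ _)).trans
    (add_le_add (hY a ha) (hZ a ha))

theorem FamBound.sub (hw : ∀ j, w j ≠ ⊤) {R c d : ℝ} {Y Z : ℤ → PS} (hY : FamBound w R Y c)
    (hZ : FamBound w R Z d) (hc : 0 ≤ c) (hd : 0 ≤ d) :
    FamBound w R (fun j => Y j - Z j) (c + d) := fun a ha => by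
  rw [ENNReal.ofReal_add hc hd]
  exact ((wnorm_mono w fun j => maj_sub_le _ _ a).trans (wnorm_add_le hw _ _)).trans
    (add_le_add (hY a ha) (hZ a ha))

theorem HamBound.add (hw : ∀ j, w j ≠ ⊤) {R c d : ℝ} {S T : PS} (hS : HamBound w R S c)
    (hT : HamBound w R T d) (hc : 0 ≤ c) (hd : 0 ≤ d) : HamBound w R (S + T) (c + d) := by
  have := FamBound.add hw hS hT hc hd
  simpa only [HamBound, map_add] using this

/-- Countable sums of bounded families. -/
theorem FamBound.of_tsum (hw : ∀ j, w j ≠ ⊤) {R : ℝ} {Z : ℤ → PS} {G : ℕ → ℤ → PS} {c : ℕ → ℝ}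
    (hG : ∀ k, FamBound w R (G k) (c k)) (hc0 : ∀ k, 0 ≤ c k) (hc : Summable c)
    (hZ : ∀ j n, ‖coeff n (Z j)‖ₑ ≤ ∑' k, ‖coeff n (G k j)‖ₑ) :
    FamBound w R Z (∑' k, c k) := fun a ha => by
  rw [ENNReal.ofReal_tsum_of_nonneg hc0 hc]
  refine ((wnorm_mono w fun j => maj_le_tsum (hZ j) a).trans (wnorm_tsum_le hw _)).trans ?_
  exact ENNReal.tsum_le_tsum fun k => hG k a ha

theorem FamBound.smul {R c : ℝ} {Y : ℤ → PS} (h : FamBound w R Y c) (x : ℂ) :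
    FamBound w R (fun j => x • Y j) (‖x‖ * c) := fun a ha => by
  simp only [maj_smul]
  rw [wnorm_smul, ENNReal.ofReal_mul (norm_nonneg x), ofReal_norm]
  exact mul_le_mul' le_rfl (h a ha)

/-- The Cauchy estimate for Lie derivatives. -/
theorem FamBound.pb (hw : ∀ j, w j ≠ ⊤) {R ρ η c : ℝ} {S : PS} {Y : ℤ → PS} (hR : 0 ≤ R)
    (hρ : 0 < ρ) (hη : 0 < η) (hSr : IsReal S) (hS : HamBound w R S η)
    (hY : FamBound w (R + ρ) Y c) : FamBound w R (fun j => pb S (Y j)) (η / ρ * c) := by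
  intro a ha
  set b : ℤ → ℝ≥0∞ := fun j => maj (pderiv ℂ (Sum.inr j) S) a with hb
  have hbn : wnorm w b ≤ ENNReal.ofReal η := hS a ha
  -- the largest time for which the flow of the majorant stays in the larger ball
  set t : ℝ := ρ / η with ht
  have ht0 : 0 < t := div_pos hρ hη
  have hswap : (fun v : Var => maj (pderiv ℂ v.swap S) a) = b ∘ site := by
    funext v
    rcases v with j | j
    · rfl
    · exact hSr.maj_pderiv_swap a (Sum.inr j)
  have h1 : ∀ j, ENNReal.ofReal t * maj (GevreyBirkhoff.pb S (Y j)) a ≤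
      maj (Y j) (fun i => a i + ENNReal.ofReal t * b i) := by
    intro j
    calc ENNReal.ofReal t * maj (GevreyBirkhoff.pb S (Y j)) a
        ≤ ENNReal.ofReal t * dmaj (Y j) a (b ∘ site) := by
          rw [← hswap]; exact mul_le_mul' le_rfl (maj_pb_le S (Y j) a)
      _ = dmaj (Y j) a ((fun i => ENNReal.ofReal t * b i) ∘ site) := by
          rw [← dmaj_smul]; rfl
      _ ≤ _ := le_add_self.trans (maj_add_dmaj_le (Y j) a _)
  have h2 : wnorm w (fun i => a i + ENNReal.ofReal t * b i) ≤ ENNReal.ofReal (R + ρ) := by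
    refine (wnorm_add_le hw _ _).trans ?_
    rw [wnorm_smul, ENNReal.ofReal_add hR hρ.le]
    refine add_le_add ha ?_
    calc ENNReal.ofReal t * wnorm w b ≤ ENNReal.ofReal t * ENNReal.ofReal η :=
          mul_le_mul' le_rfl hbn
      _ = ENNReal.ofReal ρ := by
          rw [← ENNReal.ofReal_mul ht0.le, ht, div_mul_cancel₀ _ hη.ne']
  have h3 : ENNReal.ofReal t * wnorm w (fun j => maj (GevreyBirkhoff.pb S (Y j)) a) ≤
      ENNReal.ofReal c := by
    rw [← wnorm_smul]
    exact (wnorm_mono w h1).trans (hY _ h2)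
  calc wnorm w (fun j => maj (GevreyBirkhoff.pb S (Y j)) a)
      = ENNReal.ofReal (η / ρ) * (ENNReal.ofReal t *
          wnorm w (fun j => maj (GevreyBirkhoff.pb S (Y j)) a)) := by
        rw [← mul_assoc, ← ENNReal.ofReal_mul (div_pos hη hρ).le, ht,
          div_mul_div_cancel₀ hρ.ne', div_self hη.ne', ENNReal.ofReal_one, one_mul]
    _ ≤ ENNReal.ofReal (η / ρ) * ENNReal.ofReal c := mul_le_mul' le_rfl h3
    _ = _ := (ENNReal.ofReal_mul (div_pos hη hρ).le).symm

theorem HamBound.pb (hw : ∀ j, w j ≠ ⊤) {R ρ η c : ℝ} {S F : PS} (hR : 0 ≤ R)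
    (hρ : 0 < ρ) (hη : 0 < η) (hc : 0 < c) (hSr : IsReal S) (hFr : IsReal F)
    (hSm : MomentumFree S) (hFm : MomentumFree F) (hS : HamBound w (R + ρ) S η)
    (hF : HamBound w (R + ρ) F c) : HamBound w R (pb S F) (2 * η / ρ * c) := by
  have h1 := FamBound.pb hw hR hρ hη hSr (hS.mono (by linarith) le_rfl) hF
  have h2 := FamBound.pb hw hR hρ hc hFr (hF.mono (by linarith) le_rfl) hS
  have h3 := h1.sub hw h2 (by positivity) (by positivity)
  have e : η / ρ * c + c / ρ * η = 2 * η / ρ * c := by ring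
  rw [e] at h3
  simpa only [HamBound, pderiv_pb hSm hFm] using h3

theorem FamBound.iterate (hw : ∀ j, w j ≠ ⊤) {ρ η c : ℝ} {S : PS} {Y : ℤ → PS} (hρ : 0 < ρ)
    (hη : 0 < η) (hSr : IsReal S) (k : ℕ) {R : ℝ} (hR : 0 ≤ R)
    (hS : HamBound w (R + k * ρ) S η) (hY : FamBound w (R + k * ρ) Y c) :
    FamBound w R (fun j => (GevreyBirkhoff.pb S)^[k] (Y j)) ((η / ρ) ^ k * c) := by
  induction k generalizing R with
  | zero => simpa using hY
  | succ k ih =>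
    have e : R + ((k + 1 : ℕ) : ℝ) * ρ = R + ρ + k * ρ := by push_cast; ring
    rw [e] at hS hY
    have h1 := ih (R := R + ρ) (by positivity) hS hY
    have h2 := FamBound.pb hw hR hρ hη hSr
      (hS.mono (by nlinarith [(Nat.cast_nonneg k : (0 : ℝ) ≤ k)]) le_rfl) h1
    simp only [Function.iterate_succ_apply']
    rwa [pow_succ', mul_assoc]

theorem HamBound.iterate (hw : ∀ j, w j ≠ ⊤) {ρ η c : ℝ} {S F : PS} (hρ : 0 < ρ)
    (hη : 0 < η) (hc : 0 < c) (hSr : IsReal S) (hFr : IsReal F)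
    (hSm : MomentumFree S) (hFm : MomentumFree F) (k : ℕ) {R : ℝ} (hR : 0 ≤ R)
    (hS : HamBound w (R + k * ρ) S η) (hF : HamBound w (R + k * ρ) F c) :
    HamBound w R ((GevreyBirkhoff.pb S)^[k] F) ((2 * η / ρ) ^ k * c) := by
  induction k generalizing R with
  | zero => simpa using hF
  | succ k ih =>
    have e : R + ((k + 1 : ℕ) : ℝ) * ρ = R + ρ + k * ρ := by push_cast; ring
    rw [e] at hS hF
    have h1 := ih (R := R + ρ) (by positivity) hS hF
    have h2 := HamBound.pb hw hR hρ hη (by positivity) hSr (hSr.iterate hFr k) hSm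
      (hSm.iterate hFm k)
      (hS.mono (by nlinarith [(Nat.cast_nonneg k : (0 : ℝ) ≤ k)]) le_rfl) h1
    rw [Function.iterate_succ_apply']
    rwa [pow_succ', mul_assoc]

/-- `k ^ k / k! ≤ 3 ^ k`. -/
theorem mul_pow_div_factorial_le {x : ℝ} (hx : 0 ≤ x) (k : ℕ) :
    (k * x) ^ k / k.factorial ≤ (3 * x) ^ k := by
  have h1 : (k : ℝ) ^ k / k.factorial ≤ Real.exp k := Real.pow_div_factorial_le_exp k (by positivity) k
  have h2 : Real.exp k ≤ 3 ^ k := by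
    rw [← mul_one (k : ℝ), Real.exp_nat_mul]
    exact pow_le_pow_left₀ (Real.exp_pos _).le (by linarith [Real.exp_one_lt_d9]) k
  rw [mul_pow, mul_pow, mul_div_right_comm]
  exact mul_le_mul_of_nonneg_right (h1.trans h2) (by positivity)

theorem norm_inv_factorial (k : ℕ) : ‖((k.factorial : ℂ)⁻¹)‖ = (k.factorial : ℝ)⁻¹ := by
  rw [norm_inv, Complex.norm_natCast]

theorem FamBound.iterate_div_factorial (hw : ∀ j, w j ≠ ⊤) {R ρ η c : ℝ} {S : PS} {Y : ℤ → PS}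
    (hR : 0 ≤ R) (hρ : 0 < ρ) (hη : 0 < η) (hc : 0 ≤ c) (hSr : IsReal S)
    (hS : HamBound w (R + ρ) S η) (hY : FamBound w (R + ρ) Y c) (k : ℕ) :
    FamBound w R (fun j => ((k.factorial : ℂ)⁻¹) • (GevreyBirkhoff.pb S)^[k] (Y j))
      ((3 * (η / ρ)) ^ k * c) := by
  rcases Nat.eq_zero_or_pos k with rfl | hk
  · simpa using hY.mono (by linarith) le_rfl
  · have hk0 : (0 : ℝ) < k := by exact_mod_cast hk
    have e : R + k * (ρ / k) = R + ρ := by field_simp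
    have h := FamBound.iterate hw (ρ := ρ / k) (by positivity) hη hSr k hR (by rwa [e]) (by rwa [e])
    refine (h.smul _).mono le_rfl ?_
    rw [norm_inv_factorial, ← mul_assoc]
    refine mul_le_mul_of_nonneg_right ?_ hc
    have := mul_pow_div_factorial_le (x := η / ρ) (by positivity) k
    rwa [inv_mul_eq_div, show η / (ρ / k) = k * (η / ρ) by field_simp]

theorem HamBound.iterate_div_factorial (hw : ∀ j, w j ≠ ⊤) {R ρ η c : ℝ} {S F : PS}
    (hR : 0 ≤ R) (hρ : 0 < ρ) (hη : 0 < η) (hc : 0 < c) (hSr : IsReal S) (hFr : IsReal F)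
    (hSm : MomentumFree S) (hFm : MomentumFree F) (hS : HamBound w (R + ρ) S η)
    (hF : HamBound w (R + ρ) F c) (k : ℕ) :
    HamBound w R (((k.factorial : ℂ)⁻¹) • (GevreyBirkhoff.pb S)^[k] F)
      ((6 * (η / ρ)) ^ k * c) := by
  rcases Nat.eq_zero_or_pos k with rfl | hk
  · simpa using hF.mono (by linarith) le_rfl
  · have hk0 : (0 : ℝ) < k := by exact_mod_cast hk
    have e : R + k * (ρ / k) = R + ρ := by field_simp
    have h := HamBound.iterate hw (ρ := ρ / k) (by positivity) hη hc hSr hFr hSm hFm k hR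
      (by rwa [e]) (by rwa [e])
    have h2 := (FamBound.smul h ((k.factorial : ℂ)⁻¹)).mono le_rfl
      (c' := (6 * (η / ρ)) ^ k * c) ?_
    · simpa only [HamBound, pderiv_smul] using h2
    rw [norm_inv_factorial, ← mul_assoc]
    refine mul_le_mul_of_nonneg_right ?_ hc.le
    have := mul_pow_div_factorial_le (x := 2 * (η / ρ)) (by positivity) k
    rw [inv_mul_eq_div, show 2 * η / (ρ / k) = k * (2 * (η / ρ)) by field_simp]
    exact this.trans_eq (by ring)

theorem summable_geometric_tail {x c : ℝ} (hx : 0 ≤ x) (hx2 : x ≤ 1 / 2) (hc : 0 ≤ c) :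
    Summable (fun k : ℕ => x ^ (k + 1) * c) ∧ ∑' k : ℕ, x ^ (k + 1) * c ≤ 2 * x * c := by
  have hs : Summable (fun k : ℕ => x ^ k) := summable_geometric_of_lt_one hx (by linarith)
  have e : (fun k : ℕ => x ^ (k + 1) * c) = fun k => x * c * x ^ k := by funext k; ring
  rw [e]
  refine ⟨hs.mul_left _, ?_⟩
  rw [tsum_mul_left, tsum_geometric_of_lt_one hx (by linarith)]
  have : (1 - x)⁻¹ ≤ 2 := by
    rw [inv_le_comm₀ (by linarith) (by norm_num)]; linarith
  nlinarith [mul_nonneg hx hc]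

theorem coeff_expPb_sub_self (S F : PS) (n : MultiIndex) :
    coeff n (expPb S F - F) = ∑ k ∈ Finset.range n.degree,
      coeff n ((((k + 1).factorial : ℂ)⁻¹) • (pb S)^[k + 1] F) := by
  rw [map_sub]
  change coeff n (expPartial S (n.degree + 1) F) - _ = _
  rw [expPartial, Finset.sum_range_succ', map_add, map_sum]
  simp

theorem enorm_sum_le_tsum (f : ℕ → ℂ) (s : Finset ℕ) : ‖∑ k ∈ s, f k‖ₑ ≤ ∑' k, ‖f k‖ₑ :=
  (enorm_sum_le s f).trans (ENNReal.sum_le_tsum s)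

/-- The Lie series of a bounded family is close to the family. -/
theorem FamBound.expPb_sub_self (hw : ∀ j, w j ≠ ⊤) {R ρ η c : ℝ} {S : PS} {Y : ℤ → PS}
    (hR : 0 ≤ R) (hρ : 0 < ρ) (hη : 0 < η) (hc : 0 ≤ c) (hSr : IsReal S)
    (hS : HamBound w (R + ρ) S η) (hY : FamBound w (R + ρ) Y c) (hsmall : 6 * η ≤ ρ) :
    FamBound w R (fun j => expPb S (Y j) - Y j) (6 * (η / ρ) * c) := by
  have hx2 : 3 * (η / ρ) ≤ 1 / 2 := by rw [← mul_div_assoc, div_le_iff₀ hρ]; linarith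
  obtain ⟨hs, hle⟩ := summable_geometric_tail (x := 3 * (η / ρ)) (by positivity) hx2 hc
  refine (FamBound.of_tsum hw (fun k => hY.iterate_div_factorial hw hR hρ hη hc hSr hS (k + 1))
    (fun k => by positivity) hs fun j n => ?_).mono le_rfl (hle.trans_eq (by ring))
  rw [coeff_expPb_sub_self]
  exact enorm_sum_le_tsum _ _

/-- A series dominated by the terms of positive order of a Lie series. -/
theorem HamBound.of_le_expPb (hw : ∀ j, w j ≠ ⊤) {R ρ η c : ℝ} {S F Z : PS}
    (hR : 0 ≤ R) (hρ : 0 < ρ) (hη : 0 < η) (hc : 0 < c) (hSr : IsReal S) (hFr : IsReal F)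
    (hSm : MomentumFree S) (hFm : MomentumFree F) (hS : HamBound w (R + ρ) S η)
    (hF : HamBound w (R + ρ) F c) (hsmall : 12 * η ≤ ρ)
    (hZ : ∀ n, ‖coeff n Z‖ₑ ≤
      ∑' k : ℕ, ‖coeff n ((((k + 1).factorial : ℂ)⁻¹) • (GevreyBirkhoff.pb S)^[k + 1] F)‖ₑ) :
    HamBound w R Z (12 * (η / ρ) * c) := by
  have hx2 : 6 * (η / ρ) ≤ 1 / 2 := by rw [← mul_div_assoc, div_le_iff₀ hρ]; linarith
  obtain ⟨hs, hle⟩ := summable_geometric_tail (x := 6 * (η / ρ)) (by positivity) hx2 hc.le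
  refine (FamBound.of_tsum hw (fun k => HamBound.iterate_div_factorial hw hR hρ hη hc hSr hFr hSm
    hFm hS hF (k + 1)) (fun k => by positivity) hs fun j n => ?_).mono le_rfl
      (hle.trans_eq (by ring))
  simp only [coeff_pderiv, enorm_mul]
  rw [ENNReal.tsum_mul_right]
  exact mul_le_mul' (hZ _) le_rfl

/-- One step of the Newton iteration: if `{S, D_ω} = P^res - P` then `exp {S, ·}` conjugates
`D_ω + P` to `D_ω + P⁺` with `P⁺` not much larger than `P`. -/
theorem HamBound.newton (hw : ∀ j, w j ≠ ⊤) {R ρ η c : ℝ} {S P : PS} {ω : ℤ → ℝ}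
    (hR : 0 ≤ R) (hρ : 0 < ρ) (hη : 0 < η) (hc : 0 < c) (hSr : IsReal S) (hPr : IsReal P)
    (hSm : MomentumFree S) (hPm : MomentumFree P) (hP3 : VanishBelow 3 P)
    (hS : HamBound w (R + ρ) S η)
    (hP : HamBound w (R + ρ) P c) (hsmall : 12 * η ≤ ρ / 2)
    (hhom : GevreyBirkhoff.pb S (quadPS ω) = resonantPart ω P - P) :
    HamBound w R (expPb S (quadPS ω + P) - quadPS ω) (2 * c) := by
  set Q : PS := P - resonantPart ω P with hQ
  have hQle : ∀ n, ‖coeff n Q‖ₑ ≤ ‖coeff n P‖ₑ := by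
    intro n
    rw [hQ, map_sub]
    by_cases h : divisor ω n = 0
    · rw [coeff_resonantPart_of_eq P h]; simp
    · rw [coeff_resonantPart_of_ne P h]; simp
  have hZle : ∀ n, ‖coeff n (resonantPart ω P)‖ₑ ≤ ‖coeff n P‖ₑ := by
    intro n
    by_cases h : divisor ω n = 0
    · rw [coeff_resonantPart_of_eq P h]
    · rw [coeff_resonantPart_of_ne P h]; simp
  have hQP : HamBound w (R + ρ) Q c := hP.of_enorm_le hQle
  have h1 : HamBound w R (expPb S P - P) (12 * (η / ρ) * c) :=
    HamBound.of_le_expPb hw hR hρ hη hc hSr hPr hSm hPm hS hP (by linarith) fun n => by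
      rw [coeff_expPb_sub_self]; exact enorm_sum_le_tsum _ _
  have h2 : HamBound w R (expPb S (quadPS ω) - quadPS ω + Q) (12 * (η / ρ) * c) := by
    refine HamBound.of_le_expPb hw hR hρ hη hc hSr (hPr.sub (hPr.resonantPart ω)) hSm
      (hPm.sub (hPm.resonantPart ω)) hS hQP (by linarith) fun n => ?_
    rw [map_add, coeff_expPb_sub_self]
    have hD : ∀ k, (GevreyBirkhoff.pb S)^[k + 1] (quadPS ω) = -((GevreyBirkhoff.pb S)^[k] Q) := by
      intro k
      rw [Function.iterate_succ_apply, hhom, ← neg_sub, ← hQ]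
      have := pb_iterate_smul hSm (-1) Q k
      simpa using this
    simp only [hD]
    rcases Nat.eq_zero_or_pos n.degree with h0 | h0
    · have hQ0 : coeff n Q = 0 := by
        have := hQle n
        rw [hP3 n (by omega)] at this
        simpa using this
      rw [h0, hQ0]; simp
    · obtain ⟨d, hd⟩ : ∃ d, n.degree = d + 1 := ⟨n.degree - 1, by omega⟩
      rw [hd, Finset.sum_range_succ']
      simp only [zero_add, Nat.factorial_one, Nat.cast_one, inv_one, one_smul,
        Function.iterate_zero, id, map_neg, neg_add_cancel_right]
      refine (enorm_sum_le_tsum _ _).trans (ENNReal.tsum_le_tsum fun k => ?_)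
      rw [smul_neg, map_neg, enorm_neg, coeff_smul, coeff_smul, enorm_mul, enorm_mul]
      refine mul_le_mul' ?_ le_rfl
      rw [← ofReal_norm, ← ofReal_norm, norm_inv_factorial, norm_inv_factorial]
      refine ENNReal.ofReal_le_ofReal (inv_anti₀ (by positivity) ?_)
      exact_mod_cast Nat.factorial_le (by omega)
  have h3 : HamBound w R (resonantPart ω P) c :=
    (hP.mono (by linarith) le_rfl).of_enorm_le hZle
  have e : expPb S (quadPS ω + P) - quadPS ω =
      (expPb S P - P) + (expPb S (quadPS ω) - quadPS ω + Q) + resonantPart ω P := by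
    rw [expPb_add hSm, hQ]; abel
  rw [e]
  have hx : 12 * (η / ρ) ≤ 1 / 2 := by rw [← mul_div_assoc, div_le_iff₀ hρ]; linarith
  refine (((h1.add hw h2 (by positivity) (by positivity)).add hw h3 (by positivity) hc.le).mono
    le_rfl ?_)
  nlinarith

/-- Bounds improve on smaller balls, in proportion to the order of the family. -/
theorem FamBound.shrink {R c l : ℝ} {Y : ℤ → PS} {d : ℕ} (hl : 0 < l) (hl1 : l ≤ 1)
    (hY : ∀ j, VanishBelow d (Y j)) (h : FamBound w R Y c) : FamBound w (l * R) Y (l ^ d * c) := by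
  intro a ha
  set a' : ℤ → ℝ≥0∞ := fun j => ENNReal.ofReal l⁻¹ * a j with ha'
  have hinv : ENNReal.ofReal l * ENNReal.ofReal l⁻¹ = 1 := by
    rw [← ENNReal.ofReal_mul hl.le, mul_inv_cancel₀ hl.ne', ENNReal.ofReal_one]
  have h1 : wnorm w a' ≤ ENNReal.ofReal R := by
    rw [ha', wnorm_smul]
    calc ENNReal.ofReal l⁻¹ * wnorm w a ≤ ENNReal.ofReal l⁻¹ * ENNReal.ofReal (l * R) :=
          mul_le_mul' le_rfl ha
      _ = ENNReal.ofReal R := by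
          rw [← ENNReal.ofReal_mul (by positivity), inv_mul_cancel_left₀ hl.ne']
  have h2 : ∀ j, maj (Y j) a ≤ ENNReal.ofReal (l ^ d) * maj (Y j) a' := by
    intro j
    rw [maj, maj, ← ENNReal.tsum_mul_left]
    refine ENNReal.tsum_le_tsum fun n => ?_
    by_cases hn : n.degree < d
    · rw [hY j n hn]; simp
    · have e : mon n (a ∘ site) = ENNReal.ofReal l ^ n.degree * mon n (a' ∘ site) := by
        rw [← mon_smul]
        congr 1
        funext v
        simp only [ha', Function.comp_apply]
        rw [← mul_assoc, hinv, one_mul]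
      rw [e, mul_left_comm, ← ENNReal.ofReal_pow hl.le]
      exact mul_le_mul' (ENNReal.ofReal_le_ofReal
        (pow_le_pow_of_le_one hl.le hl1 (not_lt.1 hn))) le_rfl
  calc wnorm w (fun j => maj (Y j) a)
      ≤ wnorm w (fun j => ENNReal.ofReal (l ^ d) * maj (Y j) a') := wnorm_mono w h2
    _ ≤ ENNReal.ofReal (l ^ d) * ENNReal.ofReal c := by
        rw [wnorm_smul]; exact mul_le_mul' le_rfl (h a' h1)
    _ = _ := (ENNReal.ofReal_mul (by positivity)).symm

theorem VanishBelow.pderiv {d : ℕ} {F : PS} (h : VanishBelow (d + 1) F) (v : Var) :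
    VanishBelow d (MvPowerSeries.pderiv ℂ v F) := fun n hn => by
  rw [coeff_pderiv, h _ (by rw [map_add, Finsupp.degree_single]; omega), zero_mul]

theorem HamBound.shrink {R c l : ℝ} {S : PS} {d : ℕ} (hl : 0 < l) (hl1 : l ≤ 1)
    (hS : VanishBelow (d + 1) S) (h : HamBound w R S c) : HamBound w (l * R) S (l ^ d * c) :=
  FamBound.shrink hl hl1 (fun _ => hS.pderiv _) h

theorem maj_X (v : Var) (a : ℤ → ℝ≥0∞) : maj (X v) a = a (site v) := by
  classical
  rw [maj, tsum_eq_single (Finsupp.single v 1)]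
  · simp [coeff_X]
  · intro n hn
    rw [coeff_X, if_neg hn]; simp

theorem famBound_X (w : ℤ → ℝ≥0∞) (R : ℝ) : FamBound w R (fun j => X (Sum.inl j)) R := by
  intro a ha
  simpa only [maj_X, site, Sum.elim_inl, id] using ha

/-! ### Small divisors -/

theorem one_le_bracket (j : ℤ) : 1 ≤ bracket j := le_max_right _ _

theorem abs_le_bracket (j : ℤ) : |(j : ℝ)| ≤ bracket j := le_max_left _ _

theorem bracket_sq_le (j : ℤ) : bracket j ^ 2 ≤ (j : ℝ) ^ 2 + 1 := by
  rcases max_cases |(j : ℝ)| 1 with ⟨h, -⟩ | ⟨h, -⟩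
  · rw [bracket, h, sq_abs]; linarith
  · rw [bracket, h]; nlinarith [sq_nonneg (j : ℝ)]

/-- The sum of the values of `x` over the variables of a monomial, with multiplicity. -/
abbrev varSum (x : Var → ℝ) : MultiIndex →+ ℝ := Finsupp.weight x

theorem varSum_single (x : Var → ℝ) (v : Var) : varSum x (Finsupp.single v 1) = x v := by
  rw [Finsupp.weight_single, one_smul]

theorem varSum_eq (x : Var → ℝ) (n : MultiIndex) :
    varSum x n = ∑ v ∈ n.support, (n v : ℝ) * x v := by
  rw [Finsupp.weight_apply, Finsupp.sum]
  simp only [nsmul_eq_mul]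

theorem varSum_mono {x y : Var → ℝ} {n : MultiIndex} (h : ∀ v, n v ≠ 0 → x v ≤ y v) :
    varSum x n ≤ varSum y n := by
  rw [varSum_eq, varSum_eq]
  exact Finset.sum_le_sum fun v hv =>
    mul_le_mul_of_nonneg_left (h v (Finsupp.mem_support_iff.1 hv)) (Nat.cast_nonneg _)

theorem varSum_nonneg {x : Var → ℝ} (h : ∀ v, 0 ≤ x v) (n : MultiIndex) : 0 ≤ varSum x n := by
  rw [varSum_eq]
  exact Finset.sum_nonneg fun v _ => mul_nonneg (Nat.cast_nonneg _) (h v)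

theorem le_varSum {x : Var → ℝ} (h : ∀ v, 0 ≤ x v) {n : MultiIndex} {v : Var} (hv : n v ≠ 0) :
    x v ≤ varSum x n := by
  have e := tsub_add_cancel_of_le (Finsupp.single_le_iff.2 (Nat.one_le_iff_ne_zero.2 hv))
  rw [← e, map_add, varSum_single]
  have := varSum_nonneg h (n - Finsupp.single v 1)
  linarith

theorem varSum_const_mul (c : ℝ) (x : Var → ℝ) (n : MultiIndex) :
    varSum (fun v => c * x v) n = c * varSum x n := by
  rw [varSum_eq, varSum_eq, Finset.mul_sum]
  exact Finset.sum_congr rfl fun v _ => by ring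

theorem varSum_pow_le {x : Var → ℝ} (h : ∀ v, 0 ≤ x v) {N : ℕ} (hN : N ≠ 0) (n : MultiIndex) :
    varSum (fun v => x v ^ N) n ≤ varSum x n ^ N := by
  induction n using multiIndex_induction with
  | h0 => simp [hN]
  | h1 n w ih =>
    rw [map_add, map_add, varSum_single, varSum_single]
    exact (add_le_add ih le_rfl).trans (pow_add_pow_le (varSum_nonneg h n) (h w) hN)

/-- The growth rate `⟨j⟩ ^ θ` of the logarithms of the weights, as a function on variables. -/
def gevrey (θ : ℝ) (v : Var) : ℝ := bracket (site v) ^ θ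

theorem gevrey_nonneg (θ : ℝ) (v : Var) : 0 ≤ gevrey θ v :=
  Real.rpow_nonneg (bracket_pos _).le _

theorem abs_mom_le (n : MultiIndex) : |(mom n : ℝ)| ≤ varSum (fun v => |(site v : ℝ)|) n := by
  induction n using multiIndex_induction with
  | h0 => simp
  | h1 n w ih =>
    rw [map_add, map_add, varSum_single, mom_single, Int.cast_add]
    refine (abs_add_le _ _).trans (add_le_add ih ?_)
    rcases w with w | w <;> simp [varMomentum, site]

theorem abs_divisor_le {ω : ℤ → ℝ} (hω : ω ∈ frequencies) (n : MultiIndex) :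
    |divisor ω n| ≤ 3 / 2 * varSum (fun v => bracket (site v) ^ 2) n := by
  obtain ⟨c, hc, h⟩ := hω
  induction n using multiIndex_induction with
  | h0 => simp
  | h1 n w ih =>
    rw [map_add, map_add, varSum_single, divisor_single]
    refine (abs_add_le _ _).trans ?_
    have h1 : |varFrequency ω w| = |ω (site w)| := by
      rcases w with w | w <;> simp [varFrequency, site]
    have h2 := abs_le.1 (h (site w))
    have h3 := one_le_bracket (site w)
    have h4 : (site w : ℝ) ^ 2 ≤ bracket (site w) ^ 2 := by
      rw [← sq_abs (site w : ℝ)]; exact pow_le_pow_left₀ (abs_nonneg _) (abs_le_bracket _) 2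
    have h5 : |ω (site w)| ≤ 3 / 2 * bracket (site w) ^ 2 := by
      rw [abs_le]; constructor <;> nlinarith [sq_nonneg (site w : ℝ)]
    rw [h1]; linarith

/-- A product controlling the denominators in the Diophantine condition. -/
def divisorBound (n : MultiIndex) : ℝ :=
  n.prod fun v k => 1 + (k : ℝ) ^ 2 * bracket (site v) ^ 2

theorem divisorBound_eq (n : MultiIndex) {s : Finset Var} (hs : n.support ⊆ s) :
    divisorBound n = ∏ v ∈ s, (1 + (n v : ℝ) ^ 2 * bracket (site v) ^ 2) :=
  Finset.prod_subset hs fun v _ hv => by rw [Finsupp.notMem_support_iff.1 hv]; simp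

theorem divisorBound_pos (n : MultiIndex) : 0 < divisorBound n :=
  Finset.prod_pos fun v _ => by positivity

theorem divisorBound_add_single (n : MultiIndex) (v : Var) :
    divisorBound (n + Finsupp.single v 1) ≤ 3 * bracket (site v) ^ 2 * divisorBound n := by
  classical
  have h1 : (n + Finsupp.single v 1).support ⊆ insert v n.support := by
    intro x hx
    rw [Finset.mem_insert, Finsupp.mem_support_iff]
    by_contra! hc
    simp [hc.1.symm, hc.2] at hx
  rw [divisorBound_eq _ h1, divisorBound_eq n (Finset.subset_insert v _),
    ← Finset.mul_prod_erase _ _ (Finset.mem_insert_self v _),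
    ← Finset.mul_prod_erase _ (fun x => 1 + (n x : ℝ) ^ 2 * bracket (site x) ^ 2)
      (Finset.mem_insert_self v _), ← mul_assoc]
  have h2 : ∏ x ∈ (insert v n.support).erase v,
      (1 + (((n + Finsupp.single v 1 : MultiIndex) x : ℕ) : ℝ) ^ 2 * bracket (site x) ^ 2) =
      ∏ x ∈ (insert v n.support).erase v, (1 + (n x : ℝ) ^ 2 * bracket (site x) ^ 2) := by
    refine Finset.prod_congr rfl fun x hx => ?_
    have : v ≠ x := fun h => Finset.ne_of_mem_erase hx h.symm
    simp [this]
  rw [h2]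
  refine mul_le_mul_of_nonneg_right ?_ (Finset.prod_nonneg fun x _ => by positivity)
  simp only [Finsupp.add_apply, Finsupp.single_eq_same, Nat.cast_add, Nat.cast_one]
  have hb : 1 ≤ bracket (site v) ^ 2 := one_le_pow₀ (one_le_bracket _)
  set b := bracket (site v) ^ 2
  set k : ℝ := (n v : ℝ)
  nlinarith [mul_nonneg (sq_nonneg (k - 1)) (by linarith : 0 ≤ b),
    mul_nonneg (mul_nonneg (sq_nonneg k) (by linarith : 0 ≤ b)) (by linarith : 0 ≤ b - 1)]

/-- The integer vector `α - β` of a monomial. -/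
def intVec (n : MultiIndex) : ℤ →₀ ℤ :=
  n.sum fun v k => (k : ℤ) • Sum.elim (fun j => Finsupp.single j 1) (fun j => Finsupp.single j (-1)) v

theorem intVec_add_single (n : MultiIndex) (v : Var) :
    intVec (n + Finsupp.single v 1) = intVec n +
      Sum.elim (fun j => Finsupp.single j 1) (fun j => Finsupp.single j (-1)) v := by
  classical
  rw [intVec, Finsupp.sum_add_index' (by simp) (by intros; push_cast; rw [add_smul]),
    Finsupp.sum_single_index (by simp)]
  simp [intVec]

theorem intVec_apply (n : MultiIndex) (j : ℤ) :
    intVec n j = (n (Sum.inl j) : ℤ) - n (Sum.inr j) := by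
  classical
  induction n using multiIndex_induction with
  | h0 => simp [intVec]
  | h1 n w ih =>
    rw [intVec_add_single, Finsupp.add_apply, ih]
    rcases w with w | w
    · simp [Finsupp.single_apply]; split_ifs <;> ring
    · simp [Finsupp.single_apply]; split_ifs <;> ring

theorem intVec_sum (ω : ℤ → ℝ) (n : MultiIndex) :
    ((intVec n).sum fun j k => ω j * (k : ℝ)) = divisor ω n := by
  induction n using multiIndex_induction with
  | h0 => simp [intVec]
  | h1 n w ih =>
    rw [intVec_add_single, Finsupp.sum_add_index' (by simp) (by intros; push_cast; ring), ih,
      map_add, divisor_single]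
    congr 1
    rcases w with w | w
    · simp [varFrequency, Finsupp.sum_single_index]
    · rw [Sum.elim_inr, Finsupp.sum_single_index (by simp)]
      simp [varFrequency]

theorem prod_intVec_le (n : MultiIndex) :
    ∏ j ∈ (intVec n).support, (1 + |((intVec n j : ℤ) : ℝ)| ^ 2 * bracket j ^ 2) ≤
      divisorBound n := by
  classical
  -- all sites that occur
  set s : Finset ℤ := n.support.image site ∪ (intVec n).support with hs
  have h1 : n.support ⊆ s.disjSum s := by
    intro v hv
    have : site v ∈ s := Finset.mem_union_left _ (Finset.mem_image_of_mem _ hv)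
    rcases v with v | v
    · exact Finset.inl_mem_disjSum.2 this
    · exact Finset.inr_mem_disjSum.2 this
  rw [divisorBound_eq n h1, Finset.prod_disjSum, ← Finset.prod_mul_distrib]
  have h2 : ∏ j ∈ (intVec n).support, (1 + |((intVec n j : ℤ) : ℝ)| ^ 2 * bracket j ^ 2) =
      ∏ j ∈ s, (1 + |((intVec n j : ℤ) : ℝ)| ^ 2 * bracket j ^ 2) :=
    Finset.prod_subset Finset.subset_union_right fun j _ hj => by
      rw [Finsupp.notMem_support_iff.1 hj]; simp
  rw [h2]
  refine Finset.prod_le_prod (fun j _ => by positivity) fun j _ => ?_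
  · simp only [site, Sum.elim_inl, Sum.elim_inr, id]
    rw [intVec_apply, sq_abs]
    push_cast
    have ha : (0 : ℝ) ≤ n (Sum.inl j) := Nat.cast_nonneg _
    have hb : (0 : ℝ) ≤ n (Sum.inr j) := Nat.cast_nonneg _
    set a : ℝ := ((n (Sum.inl j) : ℕ) : ℝ)
    set b : ℝ := ((n (Sum.inr j) : ℕ) : ℝ)
    have hB : 0 ≤ bracket j ^ 2 := sq_nonneg _
    have h1 : 0 ≤ a * b * bracket j ^ 2 := by positivity
    have h2 : 0 ≤ a ^ 2 * bracket j ^ 2 * (b ^ 2 * bracket j ^ 2) := by positivity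
    nlinarith

theorem intVec_eq_zero_of_divisor {ω : ℤ → ℝ} {n : MultiIndex} (h : intVec n = 0) :
    divisor ω n = 0 := by rw [← intVec_sum, h, Finsupp.sum_zero_index]

/-- The Diophantine condition as a lower bound for the divisor of a nonresonant monomial. Cancellations
in `α - β` only improve the bound. -/
theorem lt_abs_divisor {γ : ℝ} {ω : ℤ → ℝ} (hω : ω ∈ diophantine γ) {n : MultiIndex}
    (hn : divisor ω n ≠ 0) : γ < divisorBound n * |divisor ω n| := by
  have h1 := hω.2 (intVec n) fun h => hn (intVec_eq_zero_of_divisor h)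
  rw [intVec_sum] at h1
  have h2 := prod_intVec_le n
  set Q := ∏ j ∈ (intVec n).support, (1 + |((intVec n j : ℤ) : ℝ)| ^ 2 * bracket j ^ 2) with hQ
  have hQ0 : 0 < Q := Finset.prod_pos fun j _ => by positivity
  have e : ((intVec n).prod fun j k => 1 / (1 + |(k : ℝ)| ^ 2 * bracket j ^ 2)) = Q⁻¹ := by
    rw [Finsupp.prod, hQ, ← Finset.prod_inv_distrib]
    simp only [one_div]
  rw [e, ← div_eq_mul_inv, div_lt_iff₀ hQ0] at h1
  calc γ < |divisor ω n| * Q := h1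
    _ ≤ |divisor ω n| * divisorBound n := mul_le_mul_of_nonneg_left h2 (abs_nonneg _)
    _ = _ := mul_comm _ _

/-- A variable of largest index occurring in a monomial. -/
theorem exists_max_var {n : MultiIndex} (hn : n ≠ 0) : ∃ (v : Var) (m : MultiIndex),
    n = m + Finsupp.single v 1 ∧ ∀ x, n x ≠ 0 → bracket (site x) ≤ bracket (site v) := by
  obtain ⟨v, hv, hmax⟩ := n.support.exists_max_image (fun x => bracket (site x))
    (Finsupp.support_nonempty_iff.2 hn)
  refine ⟨v, n - Finsupp.single v 1, (tsub_add_cancel_of_le ?_).symm, fun x hx =>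
    hmax x (Finsupp.mem_support_iff.2 hx)⟩
  exact Finsupp.single_le_iff.2 (Nat.one_le_iff_ne_zero.2 (Finsupp.mem_support_iff.1 hv))

/-- The two variables of largest index in a monomial of degree at least three, and the rest. -/
structure LeadingPair (n : MultiIndex) where
  (v₁ v₂ : Var)
  rest : MultiIndex
  eq : n = rest + Finsupp.single v₂ 1 + Finsupp.single v₁ 1
  rest_ne : rest ≠ 0
  le₁ : ∀ x, n x ≠ 0 → bracket (site x) ≤ bracket (site v₁)
  le₂ : ∀ x, rest x ≠ 0 → bracket (site x) ≤ bracket (site v₂)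
  le : bracket (site v₂) ≤ bracket (site v₁)

theorem exists_leadingPair {n : MultiIndex} (hn : 3 ≤ n.degree) : Nonempty (LeadingPair n) := by
  obtain ⟨v₁, n', rfl, h1⟩ := exists_max_var (n := n) (by rintro rfl; simp at hn)
  rw [map_add, Finsupp.degree_single] at hn
  obtain ⟨v₂, m, rfl, h2⟩ := exists_max_var (n := n') (by rintro rfl; simp at hn)
  rw [map_add, Finsupp.degree_single] at hn
  refine ⟨⟨v₁, v₂, m, rfl, by rintro rfl; simp at hn, h1, fun x hx => h2 x ?_, h1 v₂ ?_⟩⟩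
  · rw [Finsupp.add_apply]; omega
  · simp

namespace LeadingPair

variable {n : MultiIndex} (L : LeadingPair n)

/-- The sum of the squares of the indices of the variables other than the leading two. -/
def restSq : ℝ := varSum (fun v => bracket (site v) ^ 2) L.rest

theorem one_le_restSq : 1 ≤ L.restSq := by
  obtain ⟨v, hv⟩ := Finsupp.ne_iff.1 L.rest_ne
  exact (one_le_pow₀ (one_le_bracket (site v))).trans
    (le_varSum (fun v => sq_nonneg (bracket (site v))) hv)

theorem varSum_site_le : varSum (fun v => |(site v : ℝ)|) L.rest ≤ L.restSq := by
  refine varSum_mono fun v _ => (abs_le_bracket _).trans ?_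
  nlinarith [one_le_bracket (site v)]

theorem mom_eq (hn : mom n = 0) :
    mom L.rest + varMomentum L.v₂ + varMomentum L.v₁ = 0 := by
  rw [← mom_single, ← mom_single, ← map_add, ← map_add, ← L.eq, hn]

theorem divisor_eq (ω : ℤ → ℝ) :
    divisor ω n = divisor ω L.rest + varFrequency ω L.v₂ + varFrequency ω L.v₁ := by
  rw [← divisor_single, ← divisor_single, ← map_add, ← map_add, ← L.eq]

theorem bracket_le (hn : mom n = 0) :
    bracket (site L.v₁) ≤ bracket (site L.v₂) + varSum (fun v => bracket (site v)) L.rest := by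
  have h1 := abs_mom_le L.rest
  have h2 : varSum (fun v => |(site v : ℝ)|) L.rest ≤ varSum (fun v => bracket (site v)) L.rest :=
    varSum_mono fun v _ => abs_le_bracket _
  have h3 : (mom L.rest : ℝ) + varMomentum L.v₂ + varMomentum L.v₁ = 0 := by
    exact_mod_cast L.mom_eq hn
  have h4 : ∀ v, |(varMomentum v : ℝ)| = |(site v : ℝ)| := by
    intro v; rcases v with v | v <;> simp [varMomentum, site]
  have h5 : |(site L.v₁ : ℝ)| ≤ |(mom L.rest : ℝ)| + |(site L.v₂ : ℝ)| := by
    rw [← h4, ← h4, show (varMomentum L.v₁ : ℝ) = -((mom L.rest : ℝ) + varMomentum L.v₂) by linarith,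
      abs_neg]
    exact abs_add_le _ _
  have h6 := abs_le_bracket (site L.v₂)
  have h7 := one_le_bracket (site L.v₂)
  have h8 := varSum_nonneg (fun v => (bracket_pos (site v)).le) L.rest
  exact max_le (by linarith) (by linarith)

/-- By momentum conservation the weights of the leading pair nearly cancel, so that the weight of
the monomial exceeds twice its largest contribution by a multiple of the weight of the rest. -/
theorem gain {θ : ℝ} (hθ₀ : 0 < θ) (hθ₁ : θ < 1) (hn : mom n = 0) {v : Var} (hv : n v ≠ 0) :
    (1 - θ) * varSum (gevrey θ) L.rest ≤ varSum (gevrey θ) n - 2 * gevrey θ v := by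
  set y := bracket (site L.v₂) with hy
  have hy0 : 0 < y := bracket_pos _
  set T := varSum (fun v => bracket (site v)) L.rest with hT
  have hT0 : 0 ≤ T := varSum_nonneg (fun v => (bracket_pos (site v)).le) L.rest
  have h1 : gevrey θ v ≤ gevrey θ L.v₁ :=
    Real.rpow_le_rpow (bracket_pos _).le (L.le₁ v hv) hθ₀.le
  have h2 : gevrey θ L.v₁ ≤ (y + T) ^ θ :=
    Real.rpow_le_rpow (bracket_pos _).le (L.bracket_le hn) hθ₀.le
  have h3 : (y + T) ^ θ ≤ y ^ θ + θ * (y ^ θ / y * T) := by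
    have e : y + T = y * (1 + T / y) := by field_simp
    rw [e, Real.mul_rpow hy0.le (by positivity)]
    have := rpow_one_add_le_one_add_mul_self (s := T / y) (p := θ)
      (by linarith [div_nonneg hT0 hy0.le]) hθ₀.le hθ₁.le
    calc y ^ θ * (1 + T / y) ^ θ ≤ y ^ θ * (1 + θ * (T / y)) :=
          mul_le_mul_of_nonneg_left this (by positivity)
      _ = _ := by ring
  have h4 : y ^ θ / y * T ≤ varSum (gevrey θ) L.rest := by
    rw [hT, ← varSum_const_mul]
    refine varSum_mono fun x hx => ?_
    have hxy := L.le₂ x hx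
    set b := bracket (site x) with hb
    have hb0 : 0 < b := bracket_pos _
    have h5 : (b / y) ^ (1 : ℝ) ≤ (b / y) ^ θ :=
      Real.rpow_le_rpow_of_exponent_ge (by positivity) ((div_le_one hy0).2 hxy) hθ₁.le
    rw [Real.rpow_one, Real.div_rpow hb0.le hy0.le] at h5
    have hyθ : 0 < y ^ θ := by positivity
    calc y ^ θ / y * b = y ^ θ * (b / y) := by ring
      _ ≤ y ^ θ * (b ^ θ / y ^ θ) := mul_le_mul_of_nonneg_left h5 hyθ.le
      _ = b ^ θ := by field_simp
  have h6 : varSum (gevrey θ) n = varSum (gevrey θ) L.rest + y ^ θ + gevrey θ L.v₁ := by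
    conv_lhs => rw [L.eq, map_add, map_add, varSum_single, varSum_single]
    rfl
  rw [h6]
  nlinarith

/-- If a divisor is small, then either the leading pair does not contribute to it, or the indices
of the pair are controlled by the rest. -/
theorem divisor_eq_or_le {ω : ℤ → ℝ} (hω : ω ∈ frequencies) (hn : mom n = 0)
    (hd : |divisor ω n| < 1) :
    divisor ω n = divisor ω L.rest ∨ bracket (site L.v₁) ≤ 4 * L.restSq := by
  have hB := L.one_le_restSq
  have h1 : |divisor ω L.rest| ≤ 3 / 2 * L.restSq := abs_divisor_le hω L.rest
  have h2 : |(mom L.rest : ℝ)| ≤ L.restSq := (abs_mom_le L.rest).trans L.varSum_site_le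
  have h3 : (mom L.rest : ℝ) + varMomentum L.v₂ + varMomentum L.v₁ = 0 := by
    exact_mod_cast L.mom_eq hn
  have h4 := L.divisor_eq ω
  set B := L.restSq
  obtain ⟨c, hc, hfreq⟩ := hω
  have hfreq' : ∀ j : ℤ, |ω j - (j : ℝ) ^ 2| ≤ 1 / 2 := fun j => (hfreq j).trans hc.le
  have hf1 := abs_le.1 (hfreq' (site L.v₁))
  have hf2 := abs_le.1 (hfreq' (site L.v₂))
  -- the frequencies of the pair are added if its variables are of the same kind, and subtracted if
  -- one of them is conjugated
  have hcases : |ω (site L.v₁) + ω (site L.v₂)| ≤ 1 + 3 / 2 * B ∨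
      (|ω (site L.v₁) - ω (site L.v₂)| ≤ 1 + 3 / 2 * B ∧
        |(site L.v₁ : ℝ) - site L.v₂| ≤ B ∧
        (site L.v₁ = site L.v₂ → divisor ω n = divisor ω L.rest)) := by
    have h5 := abs_lt.1 hd
    have h6 := abs_le.1 h1
    have h7 := abs_le.1 h2
    revert h3 h4
    rcases L.v₁ with i | i <;> rcases L.v₂ with j | j <;>
      simp only [varMomentum, varFrequency, site, Sum.elim_inl, Sum.elim_inr, id, Int.cast_neg,
        abs_le] <;> intro h3 h4
    · left; constructor <;> linarith
    · right
      refine ⟨⟨by linarith, by linarith⟩, ⟨by linarith, by linarith⟩, ?_⟩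
      rintro rfl; linarith
    · right
      refine ⟨⟨by linarith, by linarith⟩, ⟨by linarith, by linarith⟩, ?_⟩
      rintro rfl; linarith
    · left; constructor <;> linarith
  have hb := bracket_sq_le (site L.v₁)
  set i : ℤ := site L.v₁
  set j : ℤ := site L.v₂
  rcases hcases with h | ⟨h, h', h''⟩
  · right
    have := (abs_le.1 h).2
    have h5 : bracket i ^ 2 ≤ (4 * B) ^ 2 := by nlinarith [sq_nonneg (j : ℝ)]
    exact (pow_le_pow_iff_left₀ (bracket_pos i).le (by positivity) two_ne_zero).1 h5
  -- bounds for `i² - j²`, and hence for `i + j`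
  · by_cases hij : i = j
    · exact Or.inl (h'' hij)
    · right
      have h5 : 1 ≤ |(i : ℝ) - j| := by
        have : 1 ≤ |i - j| := Int.one_le_abs (sub_ne_zero.2 hij)
        exact_mod_cast this
      have h6 : |(i : ℝ) - j| * |(i : ℝ) + j| ≤ 2 + 3 / 2 * B := by
        rw [← abs_mul, abs_le]
        have := abs_le.1 h
        constructor <;> nlinarith
      have h7 : |(i : ℝ) + j| ≤ 2 + 3 / 2 * B := by nlinarith [abs_nonneg ((i : ℝ) + j)]
      have h8 : |(i : ℝ)| ≤ 4 * B := by
        have h9 := abs_le.1 h7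
        have h10 := abs_le.1 h'
        rw [abs_le]; constructor <;> linarith
      exact max_le h8 (by linarith)

/-- The Diophantine condition bounds small divisors in terms of the variables other than the
leading pair. -/
theorem lt_abs_divisor {γ : ℝ} {ω : ℤ → ℝ} (hω : ω ∈ diophantine γ) (hn : mom n = 0)
    (hd : |divisor ω n| < 1) (h0 : divisor ω n ≠ 0) :
    γ < 2304 * L.restSq ^ 4 * divisorBound L.rest * |divisor ω n| := by
  have hB := L.one_le_restSq
  have hq := divisorBound_pos L.rest
  rcases L.divisor_eq_or_le hω.1 hn hd with h | h
  · rw [h] at h0 ⊢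
    refine (GevreyBirkhoff.lt_abs_divisor hω h0).trans_le ?_
    refine mul_le_mul_of_nonneg_right ?_ (abs_nonneg _)
    have : 1 ≤ L.restSq ^ 4 := one_le_pow₀ hB
    nlinarith
  · refine (GevreyBirkhoff.lt_abs_divisor hω h0).trans_le ?_
    refine mul_le_mul_of_nonneg_right ?_ (abs_nonneg _)
    set B := L.restSq
    have h1 : bracket (site L.v₁) ^ 2 ≤ (4 * B) ^ 2 := pow_le_pow_left₀ (bracket_pos _).le h 2
    have h2 : bracket (site L.v₂) ^ 2 ≤ (4 * B) ^ 2 :=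
      pow_le_pow_left₀ (bracket_pos _).le (L.le.trans h) 2
    conv_lhs => rw [L.eq]
    calc _ ≤ 3 * bracket (site L.v₁) ^ 2 *
          (3 * bracket (site L.v₂) ^ 2 * divisorBound L.rest) :=
          (divisorBound_add_single _ _).trans
            (mul_le_mul_of_nonneg_left (divisorBound_add_single _ _) (by positivity))
      _ ≤ 3 * (4 * B) ^ 2 * (3 * (4 * B) ^ 2 * divisorBound L.rest) := by gcongr
      _ = _ := by ring

end LeadingPair

theorem summable_inv_bracket_sq : Summable fun j : ℤ => (bracket j ^ 2)⁻¹ := by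
  have h1 : Summable fun j : ℤ => 1 / (j : ℝ) ^ 2 := Real.summable_one_div_int_pow.2 one_lt_two
  have h2 : Summable fun j : ℤ => if j = 0 then (1 : ℝ) else 0 :=
    (hasSum_ite_eq (0 : ℤ) (1 : ℝ)).summable
  refine (h1.add h2).of_nonneg_of_le (fun j => by positivity) fun j => ?_
  by_cases hj : j = 0
  · subst hj; simp [bracket]
  · have : (j : ℝ) ≠ 0 := by exact_mod_cast hj
    rw [if_neg hj, add_zero, one_div]
    refine inv_anti₀ (by positivity) ?_
    rw [← sq_abs]
    exact pow_le_pow_left₀ (abs_nonneg _) (abs_le_bracket j) 2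

theorem sum_inv_bracket_sq_le (s : Finset Var) :
    ∑ v ∈ s, (bracket (site v) ^ 2)⁻¹ ≤ 2 * ∑' j : ℤ, (bracket j ^ 2)⁻¹ := by
  classical
  have h1 : s ⊆ (s.image site).disjSum (s.image site) := by
    intro v hv
    have : site v ∈ s.image site := Finset.mem_image_of_mem _ hv
    rcases v with v | v
    · exact Finset.inl_mem_disjSum.2 this
    · exact Finset.inr_mem_disjSum.2 this
  refine (Finset.sum_le_sum_of_subset_of_nonneg h1 fun v _ _ => by positivity).trans ?_
  rw [Finset.sum_disjSum, two_mul]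
  exact add_le_add (summable_inv_bracket_sq.sum_le_tsum _ fun j _ => by positivity)
    (summable_inv_bracket_sq.sum_le_tsum _ fun j _ => by positivity)

theorem one_add_pow_le_exp {N : ℕ} (hN : N ≠ 0) {y : ℝ} (hy : 0 ≤ y) :
    1 + y ^ (2 * N) ≤ Real.exp ((2 * N).factorial * y) := by
  have hf : (1 : ℝ) ≤ (2 * N).factorial := by exact_mod_cast Nat.factorial_pos _
  have h1 := Real.sum_le_exp_of_nonneg (x := (2 * N).factorial * y) (by positivity) (2 * N + 1)
  refine le_trans ?_ h1
  rw [Finset.sum_range_succ]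
  refine add_le_add ?_ ?_
  · have : (((2 * N).factorial : ℝ) * y) ^ 0 / (Nat.factorial 0 : ℝ) = 1 := by simp
    rw [← this]
    exact Finset.single_le_sum (f := fun i => (((2 * N).factorial : ℝ) * y) ^ i / (i.factorial : ℝ))
      (fun i _ => by positivity) (Finset.mem_range.2 (show 0 < 2 * N by omega))
  · rw [le_div_iff₀ (by positivity), mul_pow, mul_comm]
    exact mul_le_mul_of_nonneg_right (le_self_pow₀ hf (mul_ne_zero two_ne_zero hN)) (by positivity)

/-- The polynomial losses of a single factor are compensated by half-exponential gains, up to a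
constant that is summable over the indices. -/
theorem factor_le {θ σ : ℝ} (hσ : 0 < σ) {N : ℕ} (hN : 2 ≤ θ * N) (hN2 : 2 ≤ N)
    {k : ℕ} (hk : k ≠ 0) (j : ℤ) :
    1 + (k : ℝ) ^ 2 * bracket j ^ 2 ≤ Real.exp (σ * (k * bracket j ^ θ) +
      ((2 * N).factorial : ℝ) ^ (2 * N + 2) * (1 / σ) ^ (2 * N + 1) * (bracket j ^ 2)⁻¹) := by
  set c := bracket j with hc
  have hc1 : 1 ≤ c := one_le_bracket j
  have hc0 : 0 < c := by linarith
  have hk1 : (1 : ℝ) ≤ k := by exact_mod_cast Nat.one_le_iff_ne_zero.2 hk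
  set x : ℝ := k * c ^ θ with hx
  have hx0 : 0 ≤ x := by positivity
  -- the loss is at most `exp (A y)`, and `A y ≤ σ y²` unless `σ y < A`, where `y` is bounded
  set y := Real.sqrt x with hy
  have hy0 : 0 ≤ y := Real.sqrt_nonneg _
  have hyx : y ^ 2 = x := Real.sq_sqrt hx0
  set A : ℝ := (((2 * N).factorial : ℕ) : ℝ) with hA
  have hA0 : 0 < A := by positivity
  have hcN : c ^ 2 ≤ (c ^ θ) ^ N := by
    rw [← Real.rpow_natCast (c ^ θ), ← Real.rpow_mul hc0.le, ← Real.rpow_natCast c 2]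
    exact Real.rpow_le_rpow_of_exponent_le hc1 (by exact_mod_cast hN)
  have h1 : (k : ℝ) ^ 2 * c ^ 2 ≤ y ^ (2 * N) := by
    rw [pow_mul, hyx, hx, mul_pow]
    exact mul_le_mul (pow_le_pow_right₀ hk1 hN2) hcN (by positivity) (by positivity)
  have h2 : c ^ 2 ≤ y ^ (2 * N) := by
    refine le_trans ?_ h1
    exact le_mul_of_one_le_left (by positivity) (one_le_pow₀ hk1)
  refine (add_le_add le_rfl h1).trans ((one_add_pow_le_exp (by omega) hy0).trans
    (Real.exp_le_exp.2 ?_))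
  rw [← hA]
  rcases le_or_gt A (σ * y) with h | h
  · have : 0 ≤ A ^ (2 * N + 2) * (1 / σ) ^ (2 * N + 1) * (c ^ 2)⁻¹ := by positivity
    nlinarith
  · have h3 : A * y ≤ A ^ (2 * N + 2) * (1 / σ) ^ (2 * N + 1) * (c ^ 2)⁻¹ := by
      rw [← div_eq_mul_inv, le_div_iff₀ (by positivity), one_div, inv_pow, ← div_eq_mul_inv,
        le_div_iff₀ (by positivity)]
      calc A * y * c ^ 2 * σ ^ (2 * N + 1) ≤ A * y * y ^ (2 * N) * σ ^ (2 * N + 1) := by gcongr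
        _ = A * (σ * y) ^ (2 * N + 1) := by ring
        _ ≤ A * A ^ (2 * N + 1) := by gcongr
        _ = A ^ (2 * N + 2) := by ring
    have : 0 ≤ σ * x := by positivity
    linarith

theorem divisorBound_le_exp {θ : ℝ} {N : ℕ} (hN : 2 ≤ θ * N) (hN2 : 2 ≤ N) :
    ∃ C : ℝ, 0 ≤ C ∧ ∀ σ : ℝ, 0 < σ → ∀ n : MultiIndex,
      divisorBound n ≤ Real.exp (σ * varSum (gevrey θ) n + C * (1 / σ) ^ (2 * N + 1)) := by
  set A : ℝ := ((2 * N).factorial : ℝ) ^ (2 * N + 2) with hA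
  refine ⟨A * (2 * ∑' j : ℤ, (bracket j ^ 2)⁻¹),
    mul_nonneg (by positivity) (mul_nonneg (by norm_num) (tsum_nonneg fun j => by positivity)),
    fun σ hσ n => ?_⟩
  have h1 : divisorBound n ≤ ∏ v ∈ n.support, Real.exp (σ * (n v * gevrey θ v) +
      A * (1 / σ) ^ (2 * N + 1) * (bracket (site v) ^ 2)⁻¹) :=
    Finset.prod_le_prod (fun v _ => by positivity) fun v hv =>
      factor_le hσ hN hN2 (Finsupp.mem_support_iff.1 hv) (site v)
  refine h1.trans ?_
  rw [← Real.exp_sum, Real.exp_le_exp, Finset.sum_add_distrib, ← Finset.mul_sum, ← Finset.mul_sum,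
    varSum_eq]
  have h2 := sum_inv_bracket_sq_le n.support
  have h3 : A * (1 / σ) ^ (2 * N + 1) * ∑ v ∈ n.support, (bracket (site v) ^ 2)⁻¹ ≤
      A * (1 / σ) ^ (2 * N + 1) * (2 * ∑' j : ℤ, (bracket j ^ 2)⁻¹) :=
    mul_le_mul_of_nonneg_left h2 (by positivity)
  linarith

/-- The loss of regularity in the homological equation. -/
theorem exists_smallDivisor_bound {θ γ : ℝ} (hθ₀ : 0 < θ) (hθ₁ : θ < 1) (hγ : 0 < γ)
    {ω : ℤ → ℝ} (hω : ω ∈ diophantine γ) :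
    ∃ (a : ℕ) (C : ℝ), 0 ≤ C ∧ ∀ σ : ℝ, 0 < σ → σ ≤ 1 → ∀ n : MultiIndex, mom n = 0 →
      3 ≤ n.degree → divisor ω n ≠ 0 → ∀ v, n v ≠ 0 →
        Real.exp (-σ * (varSum (gevrey θ) n - 2 * gevrey θ v)) ≤
          Real.exp (C * (1 / σ) ^ a) * |divisor ω n| := by
  obtain ⟨N, hN⟩ := exists_nat_gt (max (2 / θ) 2)
  have hN2 : 2 ≤ N := by
    have : (2 : ℝ) < N := (le_max_right _ _).trans_lt hN
    exact_mod_cast this.le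
  have hN1 : 2 ≤ θ * N := by
    have : 2 / θ < N := (le_max_left _ _).trans_lt hN
    rw [div_lt_iff₀ hθ₀] at this; linarith
  obtain ⟨C, hC0, hC⟩ := divisorBound_le_exp hN1 hN2
  set κ := (1 - θ) / 2 with hκ
  have hκ0 : 0 < κ := by rw [hκ]; linarith
  -- the logarithm of the constants that do not depend on `σ`
  set E : ℝ := 2304 / γ * (4 * N).factorial * (4 * N).factorial with hE
  have hE0 : 0 < E := by positivity
  set C' : ℝ := Real.exp (E) + 1 / κ + C * (1 / κ) ^ (2 * N + 1) with hC'
  refine ⟨2 * N + 1, C', by positivity, fun σ hσ hσ1 n hn hdeg h0 v hv => ?_⟩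
  obtain ⟨L⟩ := exists_leadingPair hdeg
  have hσa : 1 ≤ (1 / σ) ^ (2 * N + 1) := one_le_pow₀ ((one_le_div hσ).2 hσ1)
  have hσb : 1 / σ ≤ (1 / σ) ^ (2 * N + 1) := le_self_pow₀ ((one_le_div hσ).2 hσ1) (by omega)
  have hgain := L.gain hθ₀ hθ₁ hn hv
  set S := varSum (gevrey θ) L.rest with hS
  have hS0 : 0 ≤ S := varSum_nonneg (gevrey_nonneg θ) _
  have h1 : Real.exp (-σ * (varSum (gevrey θ) n - 2 * gevrey θ v)) ≤
      Real.exp (-(σ * κ * S) - σ * κ * S) := by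
    rw [Real.exp_le_exp]
    have := mul_le_mul_of_nonneg_left hgain hσ.le
    have e : σ * κ * S + σ * κ * S = σ * ((1 - θ) * S) := by rw [hκ]; ring
    linarith
  refine h1.trans ?_
  rcases le_or_gt 1 |divisor ω n| with hd | hd
  · calc Real.exp (-(σ * κ * S) - σ * κ * S) ≤ 1 := by
          rw [Real.exp_le_one_iff]
          have : 0 ≤ σ * κ * S := by positivity
          linarith
      _ ≤ Real.exp (C' * (1 / σ) ^ (2 * N + 1)) * |divisor ω n| := by
          have : 1 ≤ Real.exp (C' * (1 / σ) ^ (2 * N + 1)) := Real.one_le_exp (by positivity)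
          nlinarith
  · have h2 := L.lt_abs_divisor hω hn hd h0
    have h3 : L.restSq ≤ S ^ N := by
      refine le_trans (varSum_mono fun x _ => ?_) (varSum_pow_le (gevrey_nonneg θ) (by omega) L.rest)
      rw [gevrey, ← Real.rpow_natCast (bracket (site x) ^ θ), ← Real.rpow_mul (bracket_pos _).le,
        ← Real.rpow_natCast _ 2]
      exact Real.rpow_le_rpow_of_exponent_le (one_le_bracket _) (by exact_mod_cast hN1)
    have hB0 : 0 ≤ L.restSq := zero_le_one.trans L.one_le_restSq
    have h4 : L.restSq ^ 4 ≤ S ^ (4 * N) := by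
      rw [mul_comm, pow_mul]; exact pow_le_pow_left₀ hB0 h3 4
    -- `S ^ (4 N)` is absorbed by one of the exponentials, at the price of a power of `1 / σ`
    have h5 : S ^ (4 * N) ≤ (4 * N).factorial * (4 * N).factorial *
        Real.exp (1 / (σ * κ)) * Real.exp (σ * κ * S) := by
      have e1 := Real.pow_div_factorial_le_exp (σ * κ * S) (by positivity) (4 * N)
      have e2 := Real.pow_div_factorial_le_exp (1 / (σ * κ)) (by positivity) (4 * N)
      rw [div_le_iff₀ (by positivity)] at e1 e2
      calc S ^ (4 * N) = (1 / (σ * κ)) ^ (4 * N) * (σ * κ * S) ^ (4 * N) := by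
            rw [← mul_pow]; congr 1; field_simp
        _ ≤ (Real.exp (1 / (σ * κ)) * (4 * N).factorial) *
            (Real.exp (σ * κ * S) * (4 * N).factorial) :=
            mul_le_mul e2 e1 (by positivity) (by positivity)
        _ = _ := by ring
    have h6 := hC (σ * κ) (by positivity) L.rest
    rw [← hS] at h6
    have h7 : γ < 2304 * ((4 * N).factorial * (4 * N).factorial *
        Real.exp (1 / (σ * κ)) * Real.exp (σ * κ * S)) *
        Real.exp (σ * κ * S + C * (1 / (σ * κ)) ^ (2 * N + 1)) * |divisor ω n| := by
      refine h2.trans_le (mul_le_mul_of_nonneg_right ?_ (abs_nonneg _))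
      exact mul_le_mul (mul_le_mul_of_nonneg_left (h4.trans h5) (by norm_num)) h6
        (divisorBound_pos _).le (by positivity)
    have h8 : 1 ≤ E * Real.exp (1 / (σ * κ) + C * (1 / (σ * κ)) ^ (2 * N + 1)) *
        Real.exp (σ * κ * S + σ * κ * S) * |divisor ω n| := by
      have := (div_lt_div_of_pos_right h7 hγ).le
      rw [div_self hγ.ne'] at this
      refine this.trans_eq ?_
      rw [hE, Real.exp_add, Real.exp_add, Real.exp_add]
      ring
    have h9 : E * Real.exp (1 / (σ * κ) + C * (1 / (σ * κ)) ^ (2 * N + 1)) ≤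
        Real.exp (C' * (1 / σ) ^ (2 * N + 1)) := by
      have hEE : E ≤ Real.exp E := by linarith [Real.add_one_le_exp E]
      have hEE' : Real.exp E ≤ Real.exp (Real.exp E) := by
        linarith [Real.add_one_le_exp (Real.exp E)]
      refine (mul_le_mul_of_nonneg_right (hEE.trans hEE') (Real.exp_pos _).le).trans ?_
      rw [← Real.exp_add, Real.exp_le_exp, hC']
      have e1 : 1 / (σ * κ) = 1 / κ * (1 / σ) := by field_simp
      have e2 : 0 < Real.exp E := Real.exp_pos _
      have e3 : 0 < 1 / κ := by positivity
      rw [e1, mul_pow]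
      nlinarith
    calc Real.exp (-(σ * κ * S) - σ * κ * S)
        = Real.exp (-(σ * κ * S) - σ * κ * S) * 1 := (mul_one _).symm
      _ ≤ Real.exp (-(σ * κ * S) - σ * κ * S) *
          (E * Real.exp (1 / (σ * κ) + C * (1 / (σ * κ)) ^ (2 * N + 1)) *
            Real.exp (σ * κ * S + σ * κ * S) * |divisor ω n|) :=
          mul_le_mul_of_nonneg_left h8 (Real.exp_pos _).le
      _ = E * Real.exp (1 / (σ * κ) + C * (1 / (σ * κ)) ^ (2 * N + 1)) * |divisor ω n| *
          (Real.exp (-(σ * κ * S) - σ * κ * S) * Real.exp (σ * κ * S + σ * κ * S)) := by ring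
      _ = E * Real.exp (1 / (σ * κ) + C * (1 / (σ * κ)) ^ (2 * N + 1)) * |divisor ω n| := by
          rw [← Real.exp_add]
          simp
      _ ≤ _ := mul_le_mul_of_nonneg_right h9 (abs_nonneg _)

/-! ### The homological equation -/

/-- The weights of the phase space. -/
def gw (s p θ : ℝ) (j : ℤ) : ℝ≥0∞ := ENNReal.ofReal (weight s p θ j)

theorem gw_ne_top (s p θ : ℝ) (j : ℤ) : gw s p θ j ≠ ⊤ := ENNReal.ofReal_ne_top

theorem gw_add (s σ p θ : ℝ) (j : ℤ) :
    gw (s + σ) p θ j = gw s p θ j * ENNReal.ofReal (Real.exp (σ * bracket j ^ θ)) := by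
  rw [gw, gw, ← ENNReal.ofReal_mul (weight_pos s p θ j).le]
  congr 1
  rw [weight, weight, mul_assoc, ← Real.exp_add]
  ring_nf

theorem mon_exp_mul (σ θ : ℝ) (a : ℤ → ℝ≥0∞) (n : MultiIndex) :
    mon n ((fun j => ENNReal.ofReal (Real.exp (σ * bracket j ^ θ)) * a j) ∘ site) =
      ENNReal.ofReal (Real.exp (σ * varSum (gevrey θ) n)) * mon n (a ∘ site) := by
  induction n using multiIndex_induction with
  | h0 => simp
  | h1 n w ih =>
    rw [mon_add, mon_add, ih, mon_single, mon_single, map_add, varSum_single, mul_add, Real.exp_add,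
      ENNReal.ofReal_mul (Real.exp_pos _).le]
    simp only [Function.comp_apply, gevrey]
    ring

/-- A comparison of coefficients that loses an exponential factor is a comparison of vector fields
with respect to different weights. -/
theorem HamBound.change_weight {s σ p θ R c K : ℝ} {P S : PS} (hK : 0 ≤ K)
    (hP : HamBound (gw s p θ) R P c)
    (h : ∀ n : MultiIndex, ∀ v, n v ≠ 0 →
      ‖coeff n S‖ * Real.exp (-σ * (varSum (gevrey θ) n - 2 * gevrey θ v)) ≤ K * ‖coeff n P‖) :
    HamBound (gw (s + σ) p θ) R S (K * c) := by
  intro a ha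
  set a' : ℤ → ℝ≥0∞ := fun j => ENNReal.ofReal (Real.exp (σ * bracket j ^ θ)) * a j with ha'
  have h1 : wnorm (gw s p θ) a' ≤ ENNReal.ofReal R := by
    refine le_trans (le_of_eq (wnorm_congr_mul fun j => ?_)) ha
    rw [gw_add, ha', mul_assoc]
  have h2 : ∀ j, ENNReal.ofReal (Real.exp (σ * bracket j ^ θ)) * maj (pderiv ℂ (Sum.inr j) S) a ≤
      ENNReal.ofReal K * maj (pderiv ℂ (Sum.inr j) P) a' := by
    intro j
    rw [maj_pderiv, maj_pderiv, ← ENNReal.tsum_mul_left, ← ENNReal.tsum_mul_left]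
    refine ENNReal.tsum_le_tsum fun n => ?_
    rcases eq_or_ne (n (Sum.inr j)) 0 with hn | hn
    · simp [hn]
    set m := n - Finsupp.single (Sum.inr j) 1 with hm
    have hnm : n = m + Finsupp.single (Sum.inr j) 1 :=
      (tsub_add_cancel_of_le (Finsupp.single_le_iff.2 (Nat.one_le_iff_ne_zero.2 hn))).symm
    have h3 := h n _ hn
    have h4 : ENNReal.ofReal (Real.exp (σ * bracket j ^ θ)) * ‖coeff n S‖ₑ ≤
        ENNReal.ofReal K * ‖coeff n P‖ₑ * ENNReal.ofReal (Real.exp (σ * varSum (gevrey θ) m)) := by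
      rw [← ofReal_norm, ← ofReal_norm, ← ENNReal.ofReal_mul (Real.exp_pos _).le,
        ← ENNReal.ofReal_mul hK, ← ENNReal.ofReal_mul (by positivity)]
      refine ENNReal.ofReal_le_ofReal ?_
      have e : varSum (gevrey θ) n = varSum (gevrey θ) m + bracket j ^ θ := by
        conv_lhs => rw [hnm, map_add, varSum_single]
        rfl
      have e2 : gevrey θ (Sum.inr j) = bracket j ^ θ := rfl
      rw [e, e2] at h3
      calc Real.exp (σ * bracket j ^ θ) * ‖coeff n S‖
          = ‖coeff n S‖ * Real.exp (-σ * (varSum (gevrey θ) m + bracket j ^ θ -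
              2 * bracket j ^ θ)) * Real.exp (σ * varSum (gevrey θ) m) := by
            rw [mul_assoc, ← Real.exp_add, mul_comm]
            ring_nf
        _ ≤ _ := mul_le_mul_of_nonneg_right h3 (Real.exp_pos _).le
    rw [ha', mon_exp_mul]
    calc ENNReal.ofReal (Real.exp (σ * bracket j ^ θ)) *
          (‖coeff n S‖ₑ * ((n (Sum.inr j) : ℝ≥0∞) * mon m (a ∘ site)))
        = ENNReal.ofReal (Real.exp (σ * bracket j ^ θ)) * ‖coeff n S‖ₑ *
          ((n (Sum.inr j) : ℝ≥0∞) * mon m (a ∘ site)) := by ring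
      _ ≤ ENNReal.ofReal K * ‖coeff n P‖ₑ * ENNReal.ofReal (Real.exp (σ * varSum (gevrey θ) m)) *
          ((n (Sum.inr j) : ℝ≥0∞) * mon m (a ∘ site)) := mul_le_mul' h4 le_rfl
      _ = _ := by ring
  calc wnorm (gw (s + σ) p θ) (fun j => maj (pderiv ℂ (Sum.inr j) S) a)
      ≤ wnorm (gw s p θ) (fun j => ENNReal.ofReal K * maj (pderiv ℂ (Sum.inr j) P) a') := by
        refine wnorm_le_of_mul_le fun j => ?_
        rw [gw_add, mul_assoc]
        exact mul_le_mul' le_rfl (h2 j)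
    _ ≤ ENNReal.ofReal K * ENNReal.ofReal c := by
        rw [wnorm_smul]; exact mul_le_mul' le_rfl (hP a' h1)
    _ = _ := (ENNReal.ofReal_mul hK).symm

/-- Regularity is monotone in the weight. -/
theorem HamBound.mono_weight {s σ p θ R c : ℝ} {P : PS} (hθ₀ : 0 < θ) (hθ₁ : θ < 1) (hσ : 0 ≤ σ)
    (hm : MomentumFree P) (h3 : VanishBelow 3 P) (hP : HamBound (gw s p θ) R P c) :
    HamBound (gw (s + σ) p θ) R P c := by
  have := HamBound.change_weight (σ := σ) (S := P) zero_le_one hP fun n v hv => by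
    by_cases hn : mom n = 0
    · by_cases hd : n.degree < 3
      · rw [h3 n hd]; simp
      · obtain ⟨L⟩ := exists_leadingPair (not_lt.1 hd)
        rw [one_mul]
        refine mul_le_of_le_one_right (norm_nonneg _) (Real.exp_le_one_iff.2 ?_)
        have h1 := L.gain hθ₀ hθ₁ hn hv
        have h2 := varSum_nonneg (gevrey_nonneg θ) L.rest
        have h4 : 0 ≤ (1 - θ) * varSum (gevrey θ) L.rest := mul_nonneg (by linarith) h2
        nlinarith
    · rw [hm n hn]; simp
  rwa [one_mul] at this

/-- The solution of the homological equation `{S, D_ω} = P^res - P`. -/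
def homSol (ω : ℤ → ℝ) (P : PS) : PS := fun n => Complex.I * coeff n P / divisor ω n

theorem coeff_homSol (ω : ℤ → ℝ) (P : PS) (n : MultiIndex) :
    coeff n (homSol ω P) = Complex.I * coeff n P / divisor ω n := rfl

variable {ω : ℤ → ℝ} {P : PS}

theorem MomentumFree.homSol (h : MomentumFree P) : MomentumFree (homSol ω P) := fun n hn => by
  rw [coeff_homSol, h n hn]; simp

theorem VanishBelow.homSol {d : ℕ} (h : VanishBelow d P) : VanishBelow d (homSol ω P) :=
  fun n hn => by rw [coeff_homSol, h n hn]; simp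

theorem IsReal.homSol (h : IsReal P) : IsReal (homSol ω P) := fun n => by
  rw [coeff_homSol, coeff_homSol, h n, divisor_swapIndex]
  simp only [map_div₀, map_mul, Complex.conj_I, Complex.conj_ofReal, Complex.ofReal_neg, div_neg,
    neg_mul, neg_div]

theorem pb_homSol (h : MomentumFree P) :
    pb (homSol ω P) (quadPS ω) = resonantPart ω P - P := by
  rw [pb_antisymm (momentumFree_quadPS ω) h.homSol]
  ext n
  rw [map_neg, coeff_pb_quadPS, coeff_homSol, map_sub]
  by_cases hn : divisor ω n = 0
  · rw [coeff_resonantPart_of_eq P hn, hn]; simp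
  · rw [coeff_resonantPart_of_ne P hn]
    have : (divisor ω n : ℂ) ≠ 0 := by exact_mod_cast hn
    field_simp
    rw [Complex.I_sq]; ring

theorem HamBound.homSol {s σ p θ R c K : ℝ} (hK : 0 ≤ K) (hm : MomentumFree P)
    (h3 : VanishBelow 3 P) (hP : HamBound (gw s p θ) R P c)
    (h : ∀ n : MultiIndex, mom n = 0 → 3 ≤ n.degree → divisor ω n ≠ 0 → ∀ v, n v ≠ 0 →
        Real.exp (-σ * (varSum (gevrey θ) n - 2 * gevrey θ v)) ≤ K * |divisor ω n|) :
    HamBound (gw (s + σ) p θ) R (homSol ω P) (K * c) :=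
  HamBound.change_weight hK hP fun n v hv => by
    by_cases hn : mom n = 0
    · by_cases hd : n.degree < 3
      · rw [coeff_homSol, h3 n hd]; simp
      · by_cases h0 : divisor ω n = 0
        · rw [coeff_homSol, h0]
          simp only [Complex.ofReal_zero, div_zero, norm_zero, zero_mul]
          positivity
        · have h1 := h n hn (not_lt.1 hd) h0 v hv
          have h2 : 0 < |divisor ω n| := abs_pos.2 h0
          rw [coeff_homSol, norm_div, norm_mul, Complex.norm_I, one_mul, Complex.norm_real,
            Real.norm_eq_abs, div_mul_eq_mul_div, div_le_iff₀ h2]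
          calc _ ≤ ‖coeff n P‖ * (K * |divisor ω n|) :=
                mul_le_mul_of_nonneg_left h1 (norm_nonneg _)
            _ = _ := by ring
    · rw [coeff_homSol, hm n hn]; simp

/-! ### The phase space -/

section PhaseSpace

variable {s p θ : ℝ}

theorem enorm_toEll2_apply (u : GevreySpace s p θ) (j : ℤ) :
    ‖toEll2 s p θ u j‖ₑ = gw s p θ j * ‖u j‖ₑ := by
  rw [toEll2_apply, enorm_mul, gw, ← ofReal_norm (E := ℂ) (weight s p θ j : ℂ), Complex.norm_real,
    Real.norm_of_nonneg (weight_pos s p θ j).le]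

theorem wnorm_enorm (u : GevreySpace s p θ) :
    wnorm (gw s p θ) (fun j => ‖u j‖ₑ) = ‖u‖ₑ := by
  have h := lp.hasSum_norm (p := 2) (by norm_num) (toEll2 s p θ u)
  simp only [ENNReal.toReal_ofNat] at h
  have h2 : ∑' j, (gw s p θ j * ‖u j‖ₑ) ^ (2 : ℝ) = ENNReal.ofReal (‖u‖ ^ (2 : ℝ)) := by
    change _ = ENNReal.ofReal (‖toEll2 s p θ u‖ ^ (2 : ℝ))
    rw [← h.tsum_eq, ENNReal.ofReal_tsum_of_nonneg (fun j => by positivity) h.summable]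
    refine tsum_congr fun j => ?_
    rw [← enorm_toEll2_apply, ← ofReal_norm, ENNReal.ofReal_rpow_of_nonneg (norm_nonneg _)
      (by norm_num)]
  rw [wnorm, h2, ENNReal.ofReal_rpow_of_nonneg (by positivity) (by norm_num),
    ← Real.rpow_mul (norm_nonneg _), ← ofReal_norm]
  norm_num

theorem memℓp_of_wnorm_ne_top {x : ℤ → ℂ} (h : wnorm (gw s p θ) (fun j => ‖x j‖ₑ) ≠ ⊤) :
    Memℓp (fun j => weightMul s p θ x j) 2 := by
  refine memℓp_gen ?_
  have h1 : ∑' j, (gw s p θ j * ‖x j‖ₑ) ^ (2 : ℝ) ≠ ⊤ := by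
    intro h2; apply h
    rw [wnorm, h2, ENNReal.top_rpow_of_pos (by norm_num)]
  have h2 : ∀ j, gw s p θ j * ‖x j‖ₑ = ‖weightMul s p θ x j‖ₑ := fun j => by
    change _ = ‖(weight s p θ j : ℂ) * x j‖ₑ
    rw [enorm_mul, gw, ← ofReal_norm (E := ℂ) (weight s p θ j : ℂ), Complex.norm_real,
      Real.norm_of_nonneg (weight_pos s p θ j).le]
  have h3 := ENNReal.summable_toReal h1
  refine h3.congr fun j => ?_
  rw [h2, ← ENNReal.toReal_rpow, toReal_enorm, ENNReal.toReal_ofNat]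

/-- The point of the phase space with given coordinates, provided they have finite norm; otherwise
zero. -/
def ofCoords (s p θ : ℝ) (x : ℤ → ℂ) : GevreySpace s p θ :=
  open scoped Classical in
  if h : wnorm (gw s p θ) (fun j => ‖x j‖ₑ) ≠ ⊤ then ⟨x, memℓp_of_wnorm_ne_top h⟩ else 0

theorem ofCoords_apply {x : ℤ → ℂ} (h : wnorm (gw s p θ) (fun j => ‖x j‖ₑ) ≠ ⊤) (j : ℤ) :
    ofCoords s p θ x j = x j := by
  have e : ofCoords s p θ x = ⟨x, memℓp_of_wnorm_ne_top h⟩ := dif_pos h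
  rw [e]

theorem coords_add (u v : GevreySpace s p θ) (j : ℤ) : (u + v) j = u j + v j := rfl

theorem coords_sub (u v : GevreySpace s p θ) (j : ℤ) : (u - v) j = u j - v j := rfl

theorem coords_smul (c : ℝ) (u : GevreySpace s p θ) (j : ℤ) : (c • u) j = c * u j := rfl

theorem coords_ext {u v : GevreySpace s p θ} (h : ∀ j, u j = v j) : u = v :=
  Subtype.ext (funext h)

theorem weight_mul_norm_le (u : GevreySpace s p θ) (j : ℤ) : weight s p θ j * ‖u j‖ ≤ ‖u‖ := by
  have h := le_wnorm (gw s p θ) (fun j => ‖u j‖ₑ) j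
  rw [wnorm_enorm, gw, ← ofReal_norm, ← ofReal_norm,
    ← ENNReal.ofReal_mul (weight_pos s p θ j).le] at h
  exact (ENNReal.ofReal_le_ofReal_iff (norm_nonneg _)).1 h

/-- The coordinates as continuous linear maps. -/
def coord (s p θ : ℝ) (j : ℤ) : GevreySpace s p θ →L[ℝ] ℂ :=
  LinearMap.mkContinuous
    { toFun := fun u => u j, map_add' := fun u v => coords_add u v j,
      map_smul' := fun c u => coords_smul c u j } (weight s p θ j)⁻¹ fun u => by
    rw [inv_mul_eq_div, le_div_iff₀ (weight_pos s p θ j), mul_comm]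
    exact weight_mul_norm_le u j

@[simp] theorem coord_apply (j : ℤ) (u : GevreySpace s p θ) : coord s p θ j u = u j := rfl

theorem norm_le_iff_wnorm {u : GevreySpace s p θ} {c : ℝ} (hc : 0 ≤ c) :
    ‖u‖ ≤ c ↔ wnorm (gw s p θ) (fun j => ‖u j‖ₑ) ≤ ENNReal.ofReal c := by
  rw [wnorm_enorm, ← ofReal_norm, ENNReal.ofReal_le_ofReal_iff hc]

instance : CompleteSpace (GevreySpace s p θ) := by
  have hsurj : Function.Surjective (toEll2 s p θ) := by
    intro f
    have hf : ∀ j, weightMul s p θ (fun j => (weight s p θ j : ℂ)⁻¹ * f j) j = f j := fun j => by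
      change (weight s p θ j : ℂ) * ((weight s p θ j : ℂ)⁻¹ * f j) = f j
      rw [mul_inv_cancel_left₀]
      exact_mod_cast (weight_pos s p θ j).ne'
    have hmem : Memℓp (fun j => weightMul s p θ (fun j => (weight s p θ j : ℂ)⁻¹ * f j) j) 2 := by
      simp only [hf]; exact lp.memℓp f
    refine ⟨⟨_, hmem⟩, ?_⟩
    ext j
    exact hf j
  let e : GevreySpace s p θ ≃ₗᵢ[ℂ] lp (fun _ : ℤ => ℂ) 2 :=
    { LinearEquiv.ofBijective (toEll2 s p θ) ⟨toEll2_injective s p θ, hsurj⟩ with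
      norm_map' := fun _ => rfl }
  exact (completeSpace_congr e.isometry.isUniformEmbedding (e := e.toEquiv)).2 inferInstance

/-! ### The symplectic form -/

theorem one_le_weight (hs : 0 ≤ s) (hp : 0 ≤ p) (j : ℤ) : 1 ≤ weight s p θ j :=
  one_le_mul_of_one_le_of_one_le (Real.one_le_rpow (one_le_bracket j) hp)
    (Real.one_le_exp (mul_nonneg hs (Real.rpow_nonneg (bracket_pos j).le _)))

theorem summable_norm_mul_norm (hs : 0 ≤ s) (hp : 0 ≤ p) (u v : GevreySpace s p θ) :
    Summable (fun j => ‖u j‖ * ‖v j‖) ∧ ∑' j, ‖u j‖ * ‖v j‖ ≤ ‖u‖ * ‖v‖ := by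
  have hu := lp.hasSum_norm (p := 2) (by norm_num) (toEll2 s p θ u)
  have hv := lp.hasSum_norm (p := 2) (by norm_num) (toEll2 s p θ v)
  simp only [ENNReal.toReal_ofNat] at hu hv
  have h := Real.summable_and_inner_le_Lp_mul_Lq_tsum_of_nonneg (p := 2) (q := 2)
    ⟨by norm_num, by norm_num, by norm_num⟩ (fun j => norm_nonneg (toEll2 s p θ u j))
    (fun j => norm_nonneg (toEll2 s p θ v j)) hu.summable hv.summable
  rw [hu.tsum_eq, hv.tsum_eq, ← Real.rpow_mul (norm_nonneg _), ← Real.rpow_mul (norm_nonneg _)] at h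
  norm_num at h
  have hle : ∀ j, ‖u j‖ * ‖v j‖ ≤ ‖toEll2 s p θ u j‖ * ‖toEll2 s p θ v j‖ := fun j => by
    have h1 : ∀ u : GevreySpace s p θ, ‖u j‖ ≤ ‖toEll2 s p θ u j‖ := fun u => by
      rw [toEll2_apply, norm_mul, Complex.norm_real, Real.norm_of_nonneg (weight_pos s p θ j).le]
      exact le_mul_of_one_le_left (norm_nonneg _) (one_le_weight hs hp j)
    exact mul_le_mul (h1 u) (h1 v) (norm_nonneg _) (norm_nonneg _)
  have hsum := h.1.of_nonneg_of_le (fun j => by positivity) hle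
  exact ⟨hsum, (hsum.tsum_le_tsum hle h.1).trans h.2⟩

theorem summable_symplecticForm (hs : 0 ≤ s) (hp : 0 ≤ p) (u v : GevreySpace s p θ) :
    Summable (fun j => 2 * (u j * (starRingEnd ℂ) (v j)).im) := by
  refine ((summable_norm_mul_norm hs hp u v).1.mul_left 2).of_norm_bounded fun j => ?_
  rw [norm_mul, Real.norm_ofNat]
  refine mul_le_mul_of_nonneg_left ?_ (by norm_num)
  refine (Complex.abs_im_le_norm _).trans_eq ?_
  rw [norm_mul, RCLike.norm_conj]

theorem abs_symplecticForm_le (hs : 0 ≤ s) (hp : 0 ≤ p) (u v : GevreySpace s p θ) :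
    |symplecticForm u v| ≤ 2 * (‖u‖ * ‖v‖) := by
  obtain ⟨h1, h2⟩ := summable_norm_mul_norm hs hp u v
  have h3 : 2 * ∑' j, ‖u j‖ * ‖v j‖ ≤ 2 * (‖u‖ * ‖v‖) :=
    mul_le_mul_of_nonneg_left h2 (by norm_num)
  refine le_trans ?_ h3
  rw [symplecticForm, ← Real.norm_eq_abs]
  refine tsum_of_norm_bounded (h1.hasSum.mul_left 2) fun j => ?_
  rw [norm_mul, Real.norm_ofNat]
  refine mul_le_mul_of_nonneg_left ?_ (by norm_num)
  refine (Complex.abs_im_le_norm _).trans_eq ?_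
  rw [norm_mul, RCLike.norm_conj]

theorem symplecticForm_add_left (hs : 0 ≤ s) (hp : 0 ≤ p) (u u' v : GevreySpace s p θ) :
    symplecticForm (u + u') v = symplecticForm u v + symplecticForm u' v := by
  rw [symplecticForm, symplecticForm, symplecticForm,
    ← (summable_symplecticForm hs hp u v).tsum_add (summable_symplecticForm hs hp u' v)]
  refine tsum_congr fun j => ?_
  rw [coords_add, add_mul, Complex.add_im, mul_add]

theorem symplecticForm_neg_swap (u v : GevreySpace s p θ) :
    symplecticForm u v = -symplecticForm v u := by
  rw [symplecticForm, symplecticForm, ← tsum_neg]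
  refine tsum_congr fun j => ?_
  rw [← mul_neg, ← Complex.conj_im, map_mul, Complex.conj_conj, mul_comm ((starRingEnd ℂ) (v j))]

theorem symplecticForm_add_right (hs : 0 ≤ s) (hp : 0 ≤ p) (u v v' : GevreySpace s p θ) :
    symplecticForm u (v + v') = symplecticForm u v + symplecticForm u v' := by
  rw [symplecticForm_neg_swap, symplecticForm_add_left hs hp, symplecticForm_neg_swap u v,
    symplecticForm_neg_swap u v']
  ring

end PhaseSpace

/-! ### Regular Hamiltonians -/

theorem monomial_toExponent (n : MultiIndex) (u : ℤ → ℂ) :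
    monomial (toExponent n) u = mon n (Sum.elim u fun j => (starRingEnd ℂ) (u j)) := by
  induction n using multiIndex_induction with
  | h0 => simp [monomial]
  | h1 n w ih =>
    rw [mon_add, mon_single, ← ih, map_add]
    simp only [monomial, Prod.fst_add, Prod.snd_add]
    rw [Finsupp.prod_add_index' (fun _ => pow_zero _) (fun _ _ _ => pow_add _ _ _),
      Finsupp.prod_add_index' (fun _ => pow_zero _) (fun _ _ _ => pow_add _ _ _)]
    rcases w with w | w
    · rw [toExponent_single_inl]; simp; ring
    · rw [toExponent_single_inr]; simp; ring

theorem toExponent_sub_single_inr (n : MultiIndex) (j : ℤ) :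
    toExponent (n - Finsupp.single (Sum.inr j) 1) =
      ((toExponent n).1, (toExponent n).2 - unitVec j) := by
  refine Prod.ext ?_ ?_ <;> ext i
  · simp
  · simp [Finsupp.single_apply]

theorem IsMRegular.hamBound {r s p θ : ℝ} {H : FormalSeries} (h : IsMRegular r s p θ H)
    (hr : 0 ≤ r) : ∃ C : ℝ, 0 < C ∧ HamBound (gw s p θ) r (toPS H) C := by
  obtain ⟨C, hC⟩ := h.bounded
  refine ⟨|C| + 1, by positivity, fun a ha => ?_⟩
  have hgw : ∀ j, gw s p θ j ≠ 0 := fun j => by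
    rw [gw, Ne, ENNReal.ofReal_eq_zero, not_le]; exact weight_pos s p θ j
  have hfin : ∀ j, a j ≠ ⊤ := by
    intro j hj
    have h1 := (le_wnorm (gw s p θ) a j).trans ha
    rw [hj, ENNReal.mul_top (hgw j)] at h1
    exact ENNReal.ofReal_ne_top (top_le_iff.1 h1)
  have hen : ∀ j, ‖((a j).toReal : ℂ)‖ₑ = a j := fun j => by
    rw [← ofReal_norm, Complex.norm_real, Real.norm_of_nonneg ENNReal.toReal_nonneg,
      ENNReal.ofReal_toReal (hfin j)]
  have hw : wnorm (gw s p θ) (fun j => ‖((a j).toReal : ℂ)‖ₑ) ≤ ENNReal.ofReal r := by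
    simpa only [hen] using ha
  set u : GevreySpace s p θ := ofCoords s p θ fun j => ((a j).toReal : ℂ) with hu
  have huj : ∀ j, u j = ((a j).toReal : ℂ) :=
    ofCoords_apply (ne_top_of_le_ne_top ENNReal.ofReal_ne_top hw)
  have hur : ‖u‖ ≤ r := by
    rw [norm_le_iff_wnorm hr]; simpa only [huj] using hw
  obtain ⟨X, hX, hXC⟩ := hC u hur
  have key : ∀ j, maj (pderiv ℂ (Sum.inr j) (toPS H)) a ≤ ‖X j‖ₑ := by
    intro j
    have hreal : ∀ m : Exponent, vectorFieldTerm (majorant H) u j m =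
        Complex.I * ((‖vectorFieldTerm (majorant H) u j m‖ : ℝ) : ℂ) := by
      intro m
      have hmon : ∀ m : Exponent, ∃ x : ℝ, 0 ≤ x ∧ monomial m u = x := by
        intro m
        refine ⟨(m.1.prod fun j n => (a j).toReal ^ n) * m.2.prod fun j n => (a j).toReal ^ n,
          mul_nonneg (Finset.prod_nonneg fun _ _ => pow_nonneg ENNReal.toReal_nonneg _)
            (Finset.prod_nonneg fun _ _ => pow_nonneg ENNReal.toReal_nonneg _), ?_⟩
        simp only [monomial, Finsupp.prod]
        push_cast
        simp only [huj, Complex.conj_ofReal]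
      obtain ⟨x, hx, hxm⟩ := hmon (m.1, m.2 - unitVec j)
      rw [vectorFieldTerm, hxm, majorant]
      have : (‖H m‖ : ℂ) * (m.2 j : ℂ) * (x : ℂ) = ((‖H m‖ * (m.2 j : ℝ) * x : ℝ) : ℂ) := by
        push_cast; ring
      rw [this, norm_mul, Complex.norm_I, one_mul, Complex.norm_real,
        Real.norm_of_nonneg (by positivity)]
    have h1 : HasSum (fun m => ‖vectorFieldTerm (majorant H) u j m‖) (X j * -Complex.I).re := by
      have h2 := (hX j).mul_right (-Complex.I)
      have h3 := Complex.hasSum_re h2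
      refine h3.congr_fun fun m => ?_
      conv_rhs => rw [hreal m]
      rw [mul_right_comm, mul_neg, Complex.I_mul_I, neg_neg, one_mul, Complex.ofReal_re]
    have h2 : ∑' m, ‖vectorFieldTerm (majorant H) u j m‖ₑ ≤ ‖X j‖ₑ := by
      have h3 := ENNReal.ofReal_tsum_of_nonneg (fun m => norm_nonneg _) h1.summable
      simp only [ofReal_norm] at h3
      rw [← h3, h1.tsum_eq, ← ofReal_norm]
      refine ENNReal.ofReal_le_ofReal ((Complex.re_le_norm _).trans_eq ?_)
      rw [norm_mul, norm_neg, Complex.norm_I, mul_one]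
    refine le_trans (le_of_eq ?_) h2
    rw [maj_pderiv, ← toExponent.toEquiv.tsum_eq]
    refine tsum_congr fun n => ?_
    simp only [AddEquiv.toEquiv_eq_coe, AddEquiv.coe_toEquiv]
    have h4 : mon (n - Finsupp.single (Sum.inr j) 1) (a ∘ site) =
        ‖monomial ((toExponent n).1, (toExponent n).2 - unitVec j) u‖ₑ := by
      rw [← toExponent_sub_single_inr, monomial_toExponent, enorm_mon]
      congr 1
      funext w
      rcases w with w | w
      · simp [site, huj, hen]
      · simp only [Sum.elim_inr, huj, Complex.conj_ofReal, hen]; rfl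
    rw [vectorFieldTerm, enorm_mul, enorm_mul, enorm_mul, ← h4, enorm_natCast, coeff_toPS, majorant]
    have h5 : ‖(‖H (toExponent n)‖ : ℂ)‖ₑ = ‖H (toExponent n)‖ₑ := by
      rw [← ofReal_norm, Complex.norm_real, norm_norm, ofReal_norm]
    have h6 : ‖Complex.I‖ₑ = 1 := by simp [enorm_eq_nnnorm]
    rw [h5, h6, one_mul, mul_assoc]
    rfl
  calc wnorm (gw s p θ) (fun j => maj (pderiv ℂ (Sum.inr j) (toPS H)) a)
      ≤ wnorm (gw s p θ) (fun j => ‖X j‖ₑ) := wnorm_mono _ key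
    _ = ENNReal.ofReal ‖X‖ := by rw [wnorm_enorm, ofReal_norm]
    _ ≤ _ := ENNReal.ofReal_le_ofReal (by linarith [le_abs_self C])

/-! ### Evaluation of power series -/

theorem summable_of_tsum_enorm_ne_top {ι : Type*} {f : ι → ℂ} (h : ∑' i, ‖f i‖ₑ ≠ ⊤) :
    Summable f := by
  refine Summable.of_norm ((ENNReal.summable_toReal h).congr fun i => ?_)
  rw [toReal_enorm]

theorem enorm_tsum_le {ι : Type*} (f : ι → ℂ) : ‖∑' i, f i‖ₑ ≤ ∑' i, ‖f i‖ₑ :=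
  enorm_tsum_le_tsum_enorm

/-- The value of a power series at a point, where it converges absolutely. -/
def ev (F : PS) (z : Var → ℂ) : ℂ := ∑' n, coeff n F * mon n z

section

variable {a : ℤ → ℝ≥0∞} {z : Var → ℂ}

theorem tsum_enorm_le_maj (F : PS) (hz : ∀ w, ‖z w‖ₑ ≤ a (site w)) :
    ∑' n, ‖coeff n F * mon n z‖ₑ ≤ maj F a := by
  refine ENNReal.tsum_le_tsum fun n => ?_
  rw [enorm_mul, enorm_mon]
  exact mul_le_mul' le_rfl (mon_mono n hz)

theorem summable_ev {F : PS} (hz : ∀ w, ‖z w‖ₑ ≤ a (site w)) (hF : maj F a ≠ ⊤) :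
    Summable fun n => coeff n F * mon n z :=
  summable_of_tsum_enorm_ne_top (ne_top_of_le_ne_top hF (tsum_enorm_le_maj F hz))

theorem enorm_ev_le (F : PS) (hz : ∀ w, ‖z w‖ₑ ≤ a (site w)) : ‖ev F z‖ₑ ≤ maj F a :=
  (enorm_tsum_le _).trans (tsum_enorm_le_maj F hz)

theorem ev_add {F G : PS} (hz : ∀ w, ‖z w‖ₑ ≤ a (site w)) (hF : maj F a ≠ ⊤) (hG : maj G a ≠ ⊤) :
    ev (F + G) z = ev F z + ev G z := by
  rw [ev, ev, ev, ← (summable_ev hz hF).tsum_add (summable_ev hz hG)]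
  exact tsum_congr fun n => by rw [map_add, add_mul]

theorem ev_sub {F G : PS} (hz : ∀ w, ‖z w‖ₑ ≤ a (site w)) (hF : maj F a ≠ ⊤) (hG : maj G a ≠ ⊤) :
    ev (F - G) z = ev F z - ev G z := by
  rw [ev, ev, ev, ← (summable_ev hz hF).tsum_sub (summable_ev hz hG)]
  exact tsum_congr fun n => by rw [map_sub, sub_mul]

theorem ev_mul {F G : PS} (hz : ∀ w, ‖z w‖ₑ ≤ a (site w)) (hF : maj F a ≠ ⊤) (hG : maj G a ≠ ⊤) :
    ev (F * G) z = ev F z * ev G z := by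
  classical
  have hs := summable_mul_of_summable_norm (summable_ev hz hF).norm (summable_ev hz hG).norm
  rw [ev, ev, ev, (summable_ev hz hF).tsum_mul_tsum_eq_tsum_sum_antidiagonal
    (summable_ev hz hG) hs]
  refine tsum_congr fun n => ?_
  rw [coeff_mul, Finset.sum_mul]
  refine Finset.sum_congr rfl fun x hx => ?_
  rw [← Finset.HasAntidiagonal.mem_antidiagonal.1 hx, mon_add]
  ring

theorem ev_X (w : Var) (z : Var → ℂ) : ev (X w) z = z w := by
  classical
  rw [ev, tsum_eq_single (Finsupp.single w 1)]
  · simp [coeff_X]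
  · intro n hn
    rw [coeff_X, if_neg hn, zero_mul]

theorem ev_one (z : Var → ℂ) : ev 1 z = 1 := by
  classical
  rw [ev, tsum_eq_single 0]
  · simp
  · intro n hn
    rw [coeff_one, if_neg hn, zero_mul]

theorem maj_one (a : ℤ → ℝ≥0∞) : maj 1 a = 1 := by
  classical
  rw [maj, tsum_eq_single 0]
  · simp
  · intro n hn
    rw [coeff_one, if_neg hn]; simp

/-- The values of all variables at a point of the phase space. -/
def vars (u : ℤ → ℂ) : Var → ℂ := Sum.elim u fun j => (starRingEnd ℂ) (u j)

theorem enorm_vars (u : ℤ → ℂ) (w : Var) : ‖vars u w‖ₑ = ‖u (site w)‖ₑ := by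
  rcases w with w | w
  · rfl
  · rw [vars, Sum.elim_inr, ← ofReal_norm, RCLike.norm_conj, ofReal_norm]; rfl

theorem mon_swapIndex (n : MultiIndex) (u : ℤ → ℂ) :
    mon (swapIndex n) (vars u) = (starRingEnd ℂ) (mon n (vars u)) := by
  induction n using multiIndex_induction with
  | h0 => simp
  | h1 n w ih =>
    rw [map_add, swapIndex_single, mon_add, mon_add, ih, mon_single, mon_single, map_mul]
    congr 1
    rcases w with w | w <;> simp [vars]

theorem ev_conjPS (F : PS) (u : ℤ → ℂ) :
    ev (conjPS F) (vars u) = (starRingEnd ℂ) (ev F (vars u)) := by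
  rw [ev, ev, Complex.conj_tsum, ← swapIndex.toEquiv.tsum_eq]
  refine tsum_congr fun n => ?_
  simp only [AddEquiv.toEquiv_eq_coe, AddEquiv.coe_toEquiv]
  rw [coeff_conjPS, swapIndex_swapIndex, mon_swapIndex, map_mul]

end

/-! ### Lie series as substitutions -/

section

variable {S : PS}

open scoped MvPowerSeries.WithPiTopology

theorem continuous_expPb (hS : MomentumFree S) : Continuous (expPb S) := by
  refine continuous_pi fun n => ?_
  change Continuous fun F : PS => coeff n (expPartial S (n.degree + 1) F)
  simp only [expPartial, map_sum, coeff_smul]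
  refine continuous_finsetSum _ fun k _ => continuous_const.mul ?_
  exact (WithPiTopology.continuous_coeff ℂ n).comp ((continuous_pb hS).iterate k)

theorem hasSum_coeff_expPb (hS : MomentumFree S) (F : PS) (m : MultiIndex) :
    HasSum (fun n => coeff n F * coeff m (expPb S (MvPowerSeries.monomial n 1)))
      (coeff m (expPb S F)) := by
  have h1 := WithPiTopology.hasSum_of_monomials_self F
  let E : PS →+ ℂ :=
    { toFun := fun G => coeff m (expPb S G)
      map_zero' := by
        have := expPb_smul hS 0 0
        rw [zero_smul, zero_smul] at this
        rw [this, map_zero]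
      map_add' := fun G H => by rw [expPb_add hS, map_add] }
  have hE : Continuous E := Continuous.comp (g := fun G : PS => coeff m G) (f := expPb S)
    (WithPiTopology.continuous_coeff ℂ m) (continuous_expPb hS)
  have h2 := h1.map E hE
  refine h2.congr_fun fun n => ?_
  change _ = coeff m (expPb S (MvPowerSeries.monomial n (coeff n F)))
  have : MvPowerSeries.monomial n (coeff n F) =
      coeff n F • (MvPowerSeries.monomial n 1 : PS) := by
    rw [← map_smul, smul_eq_mul, mul_one]
  rw [this, expPb_smul hS, coeff_smul]

theorem expPb_one (hS : MomentumFree S) : expPb S 1 = 1 := by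
  ext n
  change coeff n (expPartial S (n.degree + 1) 1) = _
  rw [expPartial, Finset.sum_range_succ', map_add, map_sum, Finset.sum_eq_zero, zero_add]
  · simp
  · intro k _
    have h : pb S 1 = 0 := (poissonDer S hS).map_one_eq_zero
    have h0 : ∀ k, (pb S)^[k] 0 = 0 := fun k => by
      induction k with
      | zero => rfl
      | succ k ih => rw [Function.iterate_succ_apply, pb_zero hS, ih]
    rw [Function.iterate_succ_apply, h, h0, smul_zero, map_zero]

theorem expPb_monomial_add_single (hS : MomentumFree S) (hS3 : VanishBelow 3 S) (n : MultiIndex)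
    (w : Var) : expPb S (MvPowerSeries.monomial (n + Finsupp.single w 1) 1) =
      expPb S (MvPowerSeries.monomial n 1) * expPb S (X w) := by
  rw [← expPb_mul hS hS3, X, monomial_mul_monomial, one_mul]

theorem expPb_monomial_zero (hS : MomentumFree S) :
    expPb S (MvPowerSeries.monomial 0 1) = 1 := by
  rw [monomial_zero_one, expPb_one hS]

theorem maj_expPb_monomial_le (hS : MomentumFree S) (hS3 : VanishBelow 3 S) (n : MultiIndex)
    (a : ℤ → ℝ≥0∞) :
    maj (expPb S (MvPowerSeries.monomial n 1)) a ≤ mon n fun w => maj (expPb S (X w)) a := by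
  induction n using multiIndex_induction with
  | h0 => rw [expPb_monomial_zero hS, maj_one, mon_zero]
  | h1 n w ih =>
    rw [expPb_monomial_add_single hS hS3, mon_add, mon_single]
    exact (maj_mul_le _ _ _).trans (mul_le_mul' ih le_rfl)

variable {a : ℤ → ℝ≥0∞} {z : Var → ℂ}

theorem mon_ne_top (n : MultiIndex) {b : Var → ℝ≥0∞} (hb : ∀ w, b w ≠ ⊤) : mon n b ≠ ⊤ := by
  induction n using multiIndex_induction with
  | h0 => simp
  | h1 n w ih =>
    rw [mon_add, mon_single]
    exact ENNReal.mul_ne_top ih (hb w)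

theorem ev_expPb_monomial (hS : MomentumFree S) (hS3 : VanishBelow 3 S)
    (hz : ∀ w, ‖z w‖ₑ ≤ a (site w)) (hb : ∀ w, maj (expPb S (X w)) a ≠ ⊤) (n : MultiIndex) :
    ev (expPb S (MvPowerSeries.monomial n 1)) z = mon n fun w => ev (expPb S (X w)) z := by
  induction n using multiIndex_induction with
  | h0 => rw [expPb_monomial_zero hS, ev_one, mon_zero]
  | h1 n w ih =>
    rw [expPb_monomial_add_single hS hS3, mon_add, mon_single, ev_mul hz ?_ (hb w), ih]
    exact ne_top_of_le_ne_top (mon_ne_top n hb) (maj_expPb_monomial_le hS hS3 n a)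

/-- `exp {S, ·}` is the substitution of the time-one flow of `S`. -/
theorem ev_expPb (hS : MomentumFree S) (hS3 : VanishBelow 3 S) {F : PS}
    (hz : ∀ w, ‖z w‖ₑ ≤ a (site w)) (hb : ∀ w, maj (expPb S (X w)) a ≠ ⊤)
    (hF : ∑' n, ‖coeff n F‖ₑ * mon n (fun w => maj (expPb S (X w)) a) ≠ ⊤) :
    ev (expPb S F) z = ev F fun w => ev (expPb S (X w)) z := by
  set E : MultiIndex → PS := fun n => expPb S (MvPowerSeries.monomial n 1) with hE
  have h1 : Summable (Function.uncurry fun m n => coeff n F * coeff m (E n) * mon m z) := by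
    refine summable_of_tsum_enorm_ne_top (ne_top_of_le_ne_top hF ?_)
    rw [ENNReal.tsum_prod', ENNReal.tsum_comm]
    refine ENNReal.tsum_le_tsum fun n => ?_
    simp only [Function.uncurry_apply_pair, mul_assoc]
    simp only [enorm_mul (coeff n F), ENNReal.tsum_mul_left]
    refine mul_le_mul' le_rfl ?_
    exact (tsum_enorm_le_maj (E n) hz).trans (maj_expPb_monomial_le hS hS3 n a)
  calc ev (expPb S F) z = ∑' m, ∑' n, coeff n F * coeff m (E n) * mon m z := by
        refine tsum_congr fun m => ?_
        rw [← (hasSum_coeff_expPb hS F m).tsum_eq, tsum_mul_right]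
    _ = ∑' n, ∑' m, coeff n F * coeff m (E n) * mon m z := h1.tsum_comm.symm
    _ = ∑' n, coeff n F * ev (E n) z := by
        refine tsum_congr fun n => ?_
        simp only [mul_assoc]
        rw [tsum_mul_left]
        rfl
    _ = _ := tsum_congr fun n => by rw [ev_expPb_monomial hS hS3 hz hb]

theorem expPb_X_inr (hS : IsReal S) (j : ℤ) :
    expPb S (X (Sum.inr j)) = conjPS (expPb S (X (Sum.inl j))) := by
  rw [conjPS_expPb, isReal_iff.1 hS, conjPS_X]; rfl

theorem maj_conjPS (F : PS) (a : ℤ → ℝ≥0∞) : maj (conjPS F) a = maj F a := by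
  have key : ∀ m : MultiIndex, mon (swapIndex m) (a ∘ site) = mon m (a ∘ site) := by
    intro m
    induction m using multiIndex_induction with
    | h0 => simp
    | h1 n w ih =>
      rw [map_add, swapIndex_single, mon_add, mon_add, ih, mon_single, mon_single]
      simp
  rw [maj, maj, ← swapIndex.toEquiv.tsum_eq]
  refine tsum_congr fun n => ?_
  simp only [AddEquiv.toEquiv_eq_coe, AddEquiv.coe_toEquiv]
  rw [coeff_conjPS, swapIndex_swapIndex, key, ← ofReal_norm, RCLike.norm_conj, ofReal_norm]

/-- The substitution property at a point of the phase space. -/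
theorem ev_expPb_vars (hSr : IsReal S) (hS : MomentumFree S) (hS3 : VanishBelow 3 S) {F : PS}
    {u x : ℤ → ℂ} (hx : ∀ j, ev (expPb S (X (Sum.inl j))) (vars u) = x j)
    (hb : ∀ j, maj (expPb S (X (Sum.inl j))) (fun j => ‖u j‖ₑ) ≠ ⊤)
    (hF : maj F (fun j => maj (expPb S (X (Sum.inl j))) (fun j => ‖u j‖ₑ)) ≠ ⊤) :
    ev (expPb S F) (vars u) = ev F (vars x) := by
  have h1 : (fun w => maj (expPb S (X w)) (fun j => ‖u j‖ₑ)) =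
      (fun j => maj (expPb S (X (Sum.inl j))) (fun j => ‖u j‖ₑ)) ∘ site := by
    funext w
    rcases w with w | w
    · rfl
    · rw [expPb_X_inr hSr, maj_conjPS]; rfl
  have h2 : (fun w => ev (expPb S (X w)) (vars u)) = vars x := by
    funext w
    rcases w with w | w
    · exact hx w
    · rw [expPb_X_inr hSr, ev_conjPS, hx]; rfl
  rw [← h2]
  refine ev_expPb hS hS3 (a := fun j => ‖u j‖ₑ) (fun w => (enorm_vars u w).le) (fun w => ?_) ?_
  · rw [congrFun h1 w]; exact hb _
  · rw [h1]; exact hF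

end

/-! ### Maps of the phase space given by power series -/

section

variable {s p θ : ℝ} {R c : ℝ} {Y : ℤ → PS}

theorem gw_ne_zero (s p θ : ℝ) (j : ℤ) : gw s p θ j ≠ 0 := by
  rw [gw, Ne, ENNReal.ofReal_eq_zero, not_le]; exact weight_pos s p θ j

theorem ne_top_of_wnorm_le {a : ℤ → ℝ≥0∞} (h : wnorm (gw s p θ) a ≤ ENNReal.ofReal c) (j : ℤ) :
    a j ≠ ⊤ := by
  intro hj
  have h1 := (le_wnorm (gw s p θ) a j).trans h
  rw [hj, ENNReal.mul_top (gw_ne_zero s p θ j)] at h1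
  exact ENNReal.ofReal_ne_top (top_le_iff.1 h1)

theorem wnorm_enorm_le_ofReal {u : GevreySpace s p θ} (hu : ‖u‖ ≤ R) :
    wnorm (gw s p θ) (fun j => ‖u j‖ₑ) ≤ ENNReal.ofReal R := by
  rw [wnorm_enorm, ← ofReal_norm]; exact ENNReal.ofReal_le_ofReal hu

/-- The map of the phase space whose components are the functions represented by the `Y j`. -/
def evFam (s p θ : ℝ) (Y : ℤ → PS) (u : GevreySpace s p θ) : GevreySpace s p θ :=
  ofCoords s p θ fun j => ev (Y j) (vars u)

theorem FamBound.maj_ne_top (hY : FamBound (gw s p θ) R Y c) {u : GevreySpace s p θ}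
    (hu : ‖u‖ ≤ R) (j : ℤ) : maj (Y j) (fun j => ‖u j‖ₑ) ≠ ⊤ :=
  ne_top_of_wnorm_le (hY _ (wnorm_enorm_le_ofReal hu)) j

theorem FamBound.wnorm_ev_le (hY : FamBound (gw s p θ) R Y c) {u : GevreySpace s p θ}
    (hu : ‖u‖ ≤ R) :
    wnorm (gw s p θ) (fun j => ‖ev (Y j) (vars u)‖ₑ) ≤ ENNReal.ofReal c :=
  (wnorm_mono _ fun j => enorm_ev_le (Y j) fun w => (enorm_vars u w).le).trans
    (hY _ (wnorm_enorm_le_ofReal hu))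

theorem FamBound.evFam_apply (hY : FamBound (gw s p θ) R Y c) {u : GevreySpace s p θ}
    (hu : ‖u‖ ≤ R) (j : ℤ) : evFam s p θ Y u j = ev (Y j) (vars u) :=
  ofCoords_apply (ne_top_of_le_ne_top ENNReal.ofReal_ne_top (hY.wnorm_ev_le hu)) j

theorem FamBound.norm_evFam_le (hY : FamBound (gw s p θ) R Y c) (hc : 0 ≤ c)
    {u : GevreySpace s p θ} (hu : ‖u‖ ≤ R) : ‖evFam s p θ Y u‖ ≤ c := by
  rw [norm_le_iff_wnorm hc]
  simp only [hY.evFam_apply hu]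
  exact hY.wnorm_ev_le hu

theorem evFam_sub {d : ℝ} {Z : ℤ → PS} (hY : FamBound (gw s p θ) R Y c)
    (hZ : FamBound (gw s p θ) R Z d) (hYZ : FamBound (gw s p θ) R (fun j => Y j - Z j) (c + d))
    {u : GevreySpace s p θ} (hu : ‖u‖ ≤ R) :
    evFam s p θ (fun j => Y j - Z j) u = evFam s p θ Y u - evFam s p θ Z u :=
  coords_ext fun j => by
    rw [hYZ.evFam_apply hu, coords_sub, hY.evFam_apply hu, hZ.evFam_apply hu,
      ev_sub (a := fun j => ‖u j‖ₑ) (fun w => (enorm_vars u w).le) (hY.maj_ne_top hu j)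
        (hZ.maj_ne_top hu j)]

/-! ### Analyticity -/

theorem exists_listing (n : MultiIndex) {d : ℕ} (hd : n.degree = d) :
    ∃ v : Fin d → Var, n = ∑ i, Finsupp.single (v i) 1 := by
  induction n using multiIndex_induction generalizing d with
  | h0 =>
    obtain rfl : 0 = d := by simpa using hd
    exact ⟨fun i => i.elim0, by simp⟩
  | h1 n w ih =>
    obtain ⟨v, hv⟩ := ih rfl
    obtain rfl : n.degree + 1 = d := by simpa [map_add] using hd
    refine ⟨Fin.snoc v w, ?_⟩
    rw [Fin.sum_univ_castSucc]
    simp only [Fin.snoc_castSucc, Fin.snoc_last]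
    rw [← hv]

/-- The variables of a monomial of degree `d`, in some order. -/
def listing {d : ℕ} (n : {n : MultiIndex // n.degree = d}) : Fin d → Var :=
  (exists_listing n.1 n.2).choose

theorem mon_eq_prod_listing {A : Type*} [CommSemiring A] {d : ℕ}
    (n : {n : MultiIndex // n.degree = d}) (z : Var → A) : mon n.1 z = ∏ i, z (listing n i) := by
  classical
  have key : ∀ t : Finset (Fin d), mon (∑ i ∈ t, Finsupp.single (listing n i) 1) z =
      ∏ i ∈ t, z (listing n i) := by
    intro t
    induction t using Finset.induction_on with
    | empty => simp
    | insert i t hi ih => rw [Finset.sum_insert hi, Finset.prod_insert hi, mon_add, mon_single, ih]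
  rw [← key]
  exact congrArg (fun m => mon m z) (exists_listing n.1 n.2).choose_spec

/-- The variables as real-linear functionals. -/
def varsL (s p θ : ℝ) (w : Var) : GevreySpace s p θ →ₗ[ℝ] ℂ where
  toFun u := vars u w
  map_add' u v := by
    rcases w with w | w
    · rfl
    · change (starRingEnd ℂ) ((u + v) w) = _
      rw [coords_add, map_add]; rfl
  map_smul' x u := by
    rcases w with w | w
    · rfl
    · change (starRingEnd ℂ) ((x • u) w) = _
      rw [coords_smul, map_mul, Complex.conj_ofReal]; rfl

/-- The symmetric multilinear form that represents a monomial, multiplied by `d!`. -/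
def symMon (s p θ : ℝ) {d : ℕ} (v : Fin d → Var) :
    MultilinearMap ℝ (fun _ : Fin d => GevreySpace s p θ) ℂ :=
  ∑ σ : Equiv.Perm (Fin d),
    ((MultilinearMap.mkPiAlgebra ℝ (Fin d) ℂ).compLinearMap fun i => varsL s p θ (v i)).domDomCongr σ

theorem symMon_apply {d : ℕ} (v : Fin d → Var) (a : Fin d → GevreySpace s p θ) :
    symMon s p θ v a = ∑ σ : Equiv.Perm (Fin d), ∏ i, vars (a (σ i)) (v i) := by
  rw [symMon, sum_apply]
  rfl

theorem symMon_diag {d : ℕ} (n : {n : MultiIndex // n.degree = d}) (u : GevreySpace s p θ) :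
    (d.factorial : ℂ)⁻¹ * symMon s p θ (listing n) (fun _ => u) = mon n.1 (vars u) := by
  rw [symMon_apply, Finset.sum_const, Finset.card_univ, Fintype.card_perm, Fintype.card_fin,
    nsmul_eq_mul, inv_mul_cancel_left₀ (by exact_mod_cast d.factorial_ne_zero),
    ← mon_eq_prod_listing]

theorem enorm_symMon_le {d : ℕ} (n : {n : MultiIndex // n.degree = d})
    (a : Fin d → GevreySpace s p θ) :
    ‖symMon s p θ (listing n) a‖ₑ ≤ mon n.1 ((fun j => ∑ k, ‖a k j‖ₑ) ∘ site) := by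
  rw [symMon_apply, mon_eq_prod_listing]
  simp only [Function.comp_apply]
  rw [Finset.prod_univ_sum]
  refine (enorm_sum_le _ _).trans ?_
  have h1 : ∀ σ : Equiv.Perm (Fin d), ‖∏ i, vars (a (σ i)) (listing n i)‖ₑ =
      (fun f : Fin d → Fin d => ∏ i, ‖a (f i) (site (listing n i))‖ₑ) σ := by
    intro σ
    simp only [← enorm_vars]
    simp only [enorm_eq_nnnorm, nnnorm_prod]
    exact ENNReal.ofNNReal_finsetProd _ _
  simp only [h1]
  have h2 := ENNReal.tsum_comp_le_tsum_of_injective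
    (f := fun σ : Equiv.Perm (Fin d) => (σ : Fin d → Fin d)) DFunLike.coe_injective
    fun f : Fin d → Fin d => ∏ i, ‖a (f i) (site (listing n i))‖ₑ
  rw [tsum_fintype, tsum_fintype] at h2
  refine h2.trans_eq ?_
  rw [Fintype.piFinset_univ]

/-- The homogeneous part of degree `d` of the majorant. -/
def hmaj (d : ℕ) (F : PS) (a : ℤ → ℝ≥0∞) : ℝ≥0∞ :=
  ∑' n : {n : MultiIndex // n.degree = d}, ‖coeff n.1 F‖ₑ * mon n.1 (a ∘ site)

theorem hmaj_le_maj (d : ℕ) (F : PS) (a : ℤ → ℝ≥0∞) : hmaj d F a ≤ maj F a :=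
  ENNReal.tsum_comp_le_tsum_of_injective Subtype.val_injective
    fun n => ‖coeff n F‖ₑ * mon n (a ∘ site)

theorem hmaj_smul (d : ℕ) (F : PS) (x : ℝ≥0∞) (a : ℤ → ℝ≥0∞) :
    hmaj d F (fun j => x * a j) = x ^ d * hmaj d F a := by
  rw [hmaj, hmaj, ← ENNReal.tsum_mul_left]
  refine tsum_congr fun n => ?_
  have := mon_smul n.1 x (a ∘ site)
  rw [n.2] at this
  rw [mul_left_comm, ← this]
  rfl

theorem FamBound.wnorm_hmaj_le (hY : FamBound (gw s p θ) R Y c) (hR : 0 < R) (d : ℕ)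
    {a : ℤ → ℝ≥0∞} {N : ℝ} (hN : 0 < N) (ha : wnorm (gw s p θ) a ≤ ENNReal.ofReal N) :
    wnorm (gw s p θ) (fun j => hmaj d (Y j) a) ≤ ENNReal.ofReal ((N / R) ^ d * c) := by
  set x : ℝ := R / N with hx
  have hx0 : 0 < x := div_pos hR hN
  have h1 : wnorm (gw s p θ) (fun j => ENNReal.ofReal x * a j) ≤ ENNReal.ofReal R := by
    rw [wnorm_smul]
    refine (mul_le_mul' le_rfl ha).trans_eq ?_
    rw [← ENNReal.ofReal_mul hx0.le, hx, div_mul_cancel₀ _ hN.ne']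
  have h2 : ∀ j, hmaj d (Y j) a ≤
      ENNReal.ofReal ((N / R) ^ d) * maj (Y j) (fun j => ENNReal.ofReal x * a j) := by
    intro j
    refine le_trans (le_of_eq ?_) (mul_le_mul' le_rfl (hmaj_le_maj d (Y j) _))
    rw [hmaj_smul, ← mul_assoc, ← ENNReal.ofReal_pow hx0.le, ← ENNReal.ofReal_mul (by positivity),
      ← mul_pow, hx, div_mul_div_cancel₀ hR.ne', div_self hN.ne', one_pow, ENNReal.ofReal_one,
      one_mul]
  refine (wnorm_mono _ h2).trans ?_
  rw [wnorm_smul, ENNReal.ofReal_mul (by positivity)]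
  exact mul_le_mul' le_rfl (hY _ h1)

/-- The polarization of the homogeneous part of degree `d`. -/
def polar (d : ℕ) (F : PS) (a : Fin d → GevreySpace s p θ) : ℂ :=
  ∑' n : {n : MultiIndex // n.degree = d},
    coeff n.1 F * ((d.factorial : ℂ)⁻¹ * symMon s p θ (listing n) a)

theorem tsum_enorm_polar_le (d : ℕ) (F : PS) (a : Fin d → GevreySpace s p θ) :
    ∑' n : {n : MultiIndex // n.degree = d},
      ‖coeff n.1 F * ((d.factorial : ℂ)⁻¹ * symMon s p θ (listing n) a)‖ₑ ≤
      ENNReal.ofReal ((d.factorial : ℝ)⁻¹) * hmaj d F (fun j => ∑ k, ‖a k j‖ₑ) := by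
  rw [hmaj, ← ENNReal.tsum_mul_left]
  refine ENNReal.tsum_le_tsum fun n => ?_
  rw [enorm_mul, enorm_mul, ← ofReal_norm (E := ℂ) (d.factorial : ℂ)⁻¹, norm_inv_factorial,
    mul_left_comm]
  exact mul_le_mul' le_rfl (mul_le_mul' le_rfl (enorm_symMon_le n a))

theorem wnorm_sum_le {d : ℕ} (a : Fin d → GevreySpace s p θ) :
    wnorm (gw s p θ) (fun j => ∑ k, ‖a k j‖ₑ) ≤ ENNReal.ofReal (∑ k, ‖a k‖) := by
  have h := wnorm_tsum_le (gw_ne_top s p θ) (fun k j => ‖a k j‖ₑ)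
  simp only [tsum_fintype, wnorm_enorm] at h
  refine h.trans_eq ?_
  rw [ENNReal.ofReal_sum_of_nonneg fun k _ => norm_nonneg _]
  simp only [ofReal_norm]

theorem FamBound.wnorm_polar_le (hY : FamBound (gw s p θ) R Y c) (hR : 0 < R) {d : ℕ}
    (a : Fin d → GevreySpace s p θ) {N : ℝ} (hN : 0 < N) (ha : ∑ k, ‖a k‖ ≤ N) :
    wnorm (gw s p θ) (fun j => ∑' n : {n : MultiIndex // n.degree = d},
      ‖coeff n.1 (Y j) * ((d.factorial : ℂ)⁻¹ * symMon s p θ (listing n) a)‖ₑ) ≤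
      ENNReal.ofReal ((d.factorial : ℝ)⁻¹ * ((N / R) ^ d * c)) := by
  refine (wnorm_mono _ fun j => tsum_enorm_polar_le d (Y j) a).trans ?_
  rw [wnorm_smul, ENNReal.ofReal_mul (by positivity)]
  exact mul_le_mul' le_rfl
    (hY.wnorm_hmaj_le hR d hN ((wnorm_sum_le a).trans (ENNReal.ofReal_le_ofReal ha)))

theorem FamBound.summable_polar (hY : FamBound (gw s p θ) R Y c) (hR : 0 < R) {d : ℕ}
    (a : Fin d → GevreySpace s p θ) (j : ℤ) :
    Summable fun n : {n : MultiIndex // n.degree = d} =>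
      coeff n.1 (Y j) * ((d.factorial : ℂ)⁻¹ * symMon s p θ (listing n) a) := by
  have hpos : 0 ≤ ∑ k, ‖a k‖ := Finset.sum_nonneg fun k _ => norm_nonneg _
  have h := hY.wnorm_polar_le hR a (N := ∑ k, ‖a k‖ + 1) (by linarith) (by linarith)
  exact summable_of_tsum_enorm_ne_top (ne_top_of_wnorm_le h j)

theorem FamBound.wnorm_enorm_polar_le (hY : FamBound (gw s p θ) R Y c) (hR : 0 < R) {d : ℕ}
    (a : Fin d → GevreySpace s p θ) {N : ℝ} (hN : 0 < N) (ha : ∑ k, ‖a k‖ ≤ N) :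
    wnorm (gw s p θ) (fun j => ‖polar d (Y j) a‖ₑ) ≤
      ENNReal.ofReal ((d.factorial : ℝ)⁻¹ * ((N / R) ^ d * c)) :=
  (wnorm_mono _ fun _ => enorm_tsum_le _).trans (hY.wnorm_polar_le hR a hN ha)

theorem FamBound.polar_apply (hY : FamBound (gw s p θ) R Y c) (hR : 0 < R) {d : ℕ}
    (a : Fin d → GevreySpace s p θ) (j : ℤ) :
    ofCoords s p θ (fun j => polar d (Y j) a) j = polar d (Y j) a := by
  have hpos : 0 ≤ ∑ k, ‖a k‖ := Finset.sum_nonneg fun k _ => norm_nonneg _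
  exact ofCoords_apply (ne_top_of_le_ne_top ENNReal.ofReal_ne_top
    (hY.wnorm_enorm_polar_le hR a (N := ∑ k, ‖a k‖ + 1) (by linarith) (by linarith))) j

/-- The multilinear maps in the power series of `evFam`. -/
def polarMap (hY : FamBound (gw s p θ) R Y c) (hR : 0 < R) (d : ℕ) :
    MultilinearMap ℝ (fun _ : Fin d => GevreySpace s p θ) (GevreySpace s p θ) where
  toFun a := ofCoords s p θ fun j => polar d (Y j) a
  map_update_add' a i x y := coords_ext fun j => by
    rw [coords_add, hY.polar_apply hR, hY.polar_apply hR, hY.polar_apply hR, polar, polar, polar,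
      ← (hY.summable_polar hR _ j).tsum_add (hY.summable_polar hR _ j)]
    exact tsum_congr fun n => by rw [MultilinearMap.map_update_add]; ring
  map_update_smul' a i x y := coords_ext fun j => by
    rw [coords_smul, hY.polar_apply hR, hY.polar_apply hR, polar, polar, ← tsum_mul_left]
    exact tsum_congr fun n => by
      rw [MultilinearMap.map_update_smul, Complex.real_smul]; ring

theorem polarMap_apply (hY : FamBound (gw s p θ) R Y c) (hR : 0 < R) {d : ℕ}
    (a : Fin d → GevreySpace s p θ) (j : ℤ) : polarMap hY hR d a j = polar d (Y j) a :=
  hY.polar_apply hR a j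

/-- The factor `3 ^ d` is the cost `d ^ d / d!` of polarization. -/
theorem norm_polarMap_le (hY : FamBound (gw s p θ) R Y c) (hR : 0 < R) (hc : 0 ≤ c) {d : ℕ}
    (a : Fin d → GevreySpace s p θ) :
    ‖polarMap hY hR d a‖ ≤ (3 * (1 / R)) ^ d * c * ∏ i, ‖a i‖ := by
  by_cases h0 : ∃ i, a i = 0
  · obtain ⟨i, hi⟩ := h0
    rw [(polarMap hY hR d).map_coord_zero i hi, norm_zero]
    positivity
  push Not at h0
  -- normalize the arguments
  set e : Fin d → GevreySpace s p θ := fun i => ‖a i‖⁻¹ • a i with he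
  have hea : a = fun i => ‖a i‖ • e i := by
    funext i
    rw [he]
    simp only
    rw [smul_smul, mul_inv_cancel₀ (norm_ne_zero_iff.2 (h0 i)), one_smul]
  have hen : ∀ i, ‖e i‖ = 1 := fun i => by
    rw [he]
    simp only
    rw [norm_smul, norm_inv, norm_norm, inv_mul_cancel₀ (norm_ne_zero_iff.2 (h0 i))]
  have h1 : ‖polarMap hY hR d e‖ ≤ (3 * (1 / R)) ^ d * c := by
    rcases Nat.eq_zero_or_pos d with rfl | hd
    · rw [norm_le_iff_wnorm (by positivity)]
      simp only [polarMap_apply]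
      refine (hY.wnorm_enorm_polar_le hR e one_pos (by simp)).trans
        (ENNReal.ofReal_le_ofReal ?_)
      simp
    · have hd0 : (0 : ℝ) < d := by exact_mod_cast hd
      rw [norm_le_iff_wnorm (by positivity)]
      simp only [polarMap_apply]
      refine (hY.wnorm_enorm_polar_le hR e hd0 (by simp [hen])).trans
        (ENNReal.ofReal_le_ofReal ?_)
      rw [← mul_assoc]
      refine mul_le_mul_of_nonneg_right ?_ hc
      have := mul_pow_div_factorial_le (x := 1 / R) (by positivity) d
      rwa [inv_mul_eq_div, show (d : ℝ) / R = d * (1 / R) by ring]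
  conv_lhs => rw [hea]
  rw [MultilinearMap.map_smul_univ, norm_smul, norm_prod]
  simp only [norm_norm]
  rw [mul_comm]
  exact mul_le_mul_of_nonneg_right h1 (Finset.prod_nonneg fun i _ => norm_nonneg _)

theorem polar_diag (d : ℕ) (F : PS) (u : GevreySpace s p θ) :
    polar d F (fun _ => u) =
      ∑' n : {n : MultiIndex // n.degree = d}, coeff n.1 F * mon n.1 (vars u) := by
  rw [polar]
  exact tsum_congr fun n => by rw [symMon_diag]

/-- Bounded majorants give convergent power series in the real sense; `conj u_j` is real-linear, not
complex-linear, in `u`. -/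
theorem FamBound.hasFPowerSeriesOnBall (hY : FamBound (gw s p θ) R Y c) (hR : 0 < R)
    (hc : 0 ≤ c) :
    HasFPowerSeriesOnBall (evFam s p θ Y) (fun d => (polarMap hY hR d).mkContinuous
      ((3 * (1 / R)) ^ d * c) (norm_polarMap_le hY hR hc)) 0 (ENNReal.ofReal (R / 3)) where
  r_le := by
    have h := FormalMultilinearSeries.le_radius_of_bound (r := (R / 3).toNNReal)
      (fun d => (polarMap hY hR d).mkContinuous
      ((3 * (1 / R)) ^ d * c) (norm_polarMap_le hY hR hc)) c fun d => ?_
    · exact h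
    · refine (mul_le_mul_of_nonneg_right (MultilinearMap.mkContinuous_norm_le _ (by positivity) _)
        (by positivity)).trans_eq ?_
      rw [Real.coe_toNNReal _ (by positivity), mul_right_comm, ← mul_pow]
      have : 3 * (1 / R) * (R / 3) = 1 := by field_simp
      rw [this, one_pow, one_mul]
  r_pos := ENNReal.ofReal_pos.2 (by positivity)
  hasSum := by
    intro y hy
    have hy' : ‖y‖ < R / 3 := by
      have h := hy
      rw [Metric.mem_eball, edist_zero_right, ← ofReal_norm,
        ENNReal.ofReal_lt_ofReal_iff (by positivity)] at h
      exact h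
    have hyR : ‖y‖ ≤ R := by linarith [norm_nonneg y]
    have hx : 3 * (1 / R) * ‖y‖ < 1 := by
      rw [show 3 * (1 / R) * ‖y‖ = ‖y‖ / (R / 3) by field_simp]
      exact (div_lt_one (by positivity)).2 hy'
    have hsum : Summable fun d => polarMap hY hR d (fun _ => y) := by
      refine ((summable_geometric_of_lt_one (by positivity) hx).mul_right c).of_norm_bounded
        fun d => ?_
      refine (norm_polarMap_le hY hR hc _).trans_eq ?_
      rw [Finset.prod_const, Finset.card_univ, Fintype.card_fin]
      ring
    rw [zero_add]
    have h1 : ∑' d, polarMap hY hR d (fun _ => y) = evFam s p θ Y y := by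
      refine coords_ext fun j => ?_
      have h2 := hsum.hasSum.mapL (coord s p θ j)
      simp only [coord_apply, polarMap_apply, polar_diag] at h2
      refine h2.unique ?_
      rw [hY.evFam_apply hyR]
      have h3 := (summable_ev (fun w => (enorm_vars y w).le) (hY.maj_ne_top hyR j)).hasSum
      have h4 := (Equiv.sigmaFiberEquiv (fun n : MultiIndex => n.degree)).hasSum_iff.2 h3
      exact h4.sigma fun d => (h4.summable.sigma_factor d).hasSum
    rw [← h1]
    exact hsum.hasSum

theorem FamBound.analyticOnNhd (hY : FamBound (gw s p θ) R Y c) (hR : 0 < R) (hc : 0 ≤ c) :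
    AnalyticOnNhd ℝ (evFam s p θ Y) (Metric.ball 0 (R / 3)) := by
  have h := (hY.hasFPowerSeriesOnBall hR hc).analyticOnNhd
  rwa [Metric.eball_ofReal] at h

end

/-! ### Derivatives -/

section

variable {s p θ : ℝ} {R c : ℝ} {Y : ℤ → PS}

/-- The Cauchy estimate for the derivative of the majorants. -/
theorem FamBound.wnorm_dmaj_le {w : ℤ → ℝ≥0∞} (hw : ∀ j, w j ≠ ⊤) (hY : FamBound w R Y c)
    {R₁ b t : ℝ} (hR₁ : 0 ≤ R₁) (hb : 0 ≤ b) (ht : 0 < t) (h : R₁ + t * b ≤ R) {a a' : ℤ → ℝ≥0∞}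
    (ha : wnorm w a ≤ ENNReal.ofReal R₁) (ha' : wnorm w a' ≤ ENNReal.ofReal b) :
    wnorm w (fun j => dmaj (Y j) a (a' ∘ site)) ≤ ENNReal.ofReal (c / t) := by
  have h1 : ∀ j, ENNReal.ofReal t * dmaj (Y j) a (a' ∘ site) ≤
      maj (Y j) (fun i => a i + ENNReal.ofReal t * a' i) := by
    intro j
    refine le_trans (le_of_eq ?_) (le_add_self.trans (maj_add_dmaj_le (Y j) a _))
    rw [← dmaj_smul]
    rfl
  have h2 : wnorm w (fun i => a i + ENNReal.ofReal t * a' i) ≤ ENNReal.ofReal R := by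
    refine (wnorm_add_le hw _ _).trans ?_
    rw [wnorm_smul]
    refine le_trans ?_ (ENNReal.ofReal_le_ofReal h)
    rw [ENNReal.ofReal_add hR₁ (by positivity), ENNReal.ofReal_mul ht.le]
    exact add_le_add ha (mul_le_mul' le_rfl ha')
  have h3 := (wnorm_mono w h1).trans (hY _ h2)
  rw [wnorm_smul] at h3
  have h4 : ENNReal.ofReal t⁻¹ * ENNReal.ofReal t = 1 := by
    rw [← ENNReal.ofReal_mul (by positivity), inv_mul_cancel₀ ht.ne', ENNReal.ofReal_one]
  calc _ = ENNReal.ofReal t⁻¹ * (ENNReal.ofReal t * wnorm w fun j => dmaj (Y j) a (a' ∘ site)) := by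
        rw [← mul_assoc, h4, one_mul]
    _ ≤ ENNReal.ofReal t⁻¹ * ENNReal.ofReal c := mul_le_mul' le_rfl h3
    _ = _ := by rw [← ENNReal.ofReal_mul (by positivity), inv_mul_eq_div]

/-- The derivative of the function represented by a series, at `u` in the direction `v`. -/
def dev (F : PS) (u v : ℤ → ℂ) : ℂ := ∑' n, coeff n F * dmon n (vars u) (vars v)

theorem tsum_enorm_dev_le (F : PS) (u v : ℤ → ℂ) :
    ∑' n, ‖coeff n F * dmon n (vars u) (vars v)‖ₑ ≤
      dmaj F (fun j => ‖u j‖ₑ) ((fun j => ‖v j‖ₑ) ∘ site) := by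
  refine ENNReal.tsum_le_tsum fun n => ?_
  rw [enorm_mul]
  refine mul_le_mul' le_rfl ((enorm_dmon_le n _ _).trans (dmon_mono n ?_ ?_))
  · exact fun w => (enorm_vars u w).le
  · exact fun w => (enorm_vars v w).le

theorem vars_add_smul (u v : GevreySpace s p θ) (t : ℝ) (w : Var) :
    vars (u + t • v : GevreySpace s p θ) w = vars u w + (t : ℂ) * vars v w := by
  have h := (varsL s p θ w).map_add u (t • v)
  rw [map_smul, Complex.real_smul] at h
  exact h

theorem FamBound.fderiv_apply (hY : FamBound (gw s p θ) R Y c) (hR : 0 < R) (hc : 0 ≤ c)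
    {u : GevreySpace s p θ} (hu : ‖u‖ < R / 3) (v : GevreySpace s p θ) (j : ℤ) :
    (fderiv ℝ (evFam s p θ Y) u v) j = dev (Y j) u v := by
  have hd : DifferentiableAt ℝ (evFam s p θ Y) u :=
    ((hY.analyticOnNhd hR hc) u (by simpa using hu)).differentiableAt
  set δ : ℝ := R / (3 * (‖v‖ + 1)) with hδ
  have hv1 : 0 < ‖v‖ + 1 := by positivity
  have hδ0 : 0 < δ := by positivity
  have hδv : δ * ‖v‖ ≤ R / 3 := by
    rw [hδ, div_mul_eq_mul_div, div_le_div_iff₀ (by positivity) (by norm_num)]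
    nlinarith [norm_nonneg v]
  -- the derivative along the line through `u` in the direction `v`, from both descriptions
  have hline : HasDerivAt (fun t : ℝ => u + t • v) v 0 := by
    simpa using ((hasDerivAt_id (0 : ℝ)).smul_const v).const_add u
  have h1 : HasDerivAt (fun t : ℝ => evFam s p θ Y (u + t • v) j)
      ((fderiv ℝ (evFam s p θ Y) u v) j) 0 := by
    have h2 : HasFDerivAt (evFam s p θ Y) (fderiv ℝ (evFam s p θ Y) u) (u + (0 : ℝ) • v) := by
      rw [zero_smul, add_zero]; exact hd.hasFDerivAt
    have h3 := (coord s p θ j).hasFDerivAt.comp_hasDerivAt (0 : ℝ) (h2.comp_hasDerivAt (0 : ℝ) hline)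
    exact h3
  have hnorm : ∀ t : ℝ, |t| < δ → ‖u + t • v‖ ≤ R := by
    intro t ht
    refine (norm_add_le _ _).trans ?_
    rw [norm_smul, Real.norm_eq_abs]
    have : |t| * ‖v‖ ≤ δ * ‖v‖ := mul_le_mul_of_nonneg_right ht.le (norm_nonneg v)
    linarith
  set A : ℤ → ℝ≥0∞ := fun j => ‖u j‖ₑ + ENNReal.ofReal δ * ‖v j‖ₑ with hA
  have hAn : wnorm (gw s p θ) A ≤ ENNReal.ofReal (2 * (R / 3)) := by
    refine (wnorm_add_le (gw_ne_top s p θ) _ _).trans ?_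
    rw [wnorm_smul, wnorm_enorm, wnorm_enorm, ← ofReal_norm, ← ofReal_norm,
      ← ENNReal.ofReal_mul hδ0.le, ← ENNReal.ofReal_add (norm_nonneg _) (by positivity)]
    exact ENNReal.ofReal_le_ofReal (by linarith)
  have hfin : dmaj (Y j) A ((fun j => ‖v j‖ₑ) ∘ site) ≠ ⊤ := by
    have h := hY.wnorm_dmaj_le (gw_ne_top s p θ) (R₁ := 2 * (R / 3)) (by positivity)
      (norm_nonneg v) hδ0 (by linarith) hAn (wnorm_enorm_le_ofReal le_rfl)
    exact ne_top_of_wnorm_le h j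
  have h4 : HasDerivAt (fun t : ℝ => ∑' n, coeff n (Y j) * mon n (vars (u + t • v : GevreySpace s p θ)))
      (∑' n, coeff n (Y j) * dmon n (vars (u + (0 : ℝ) • v : GevreySpace s p θ)) (vars v)) 0 := by
    have hsum : Summable fun n => (‖coeff n (Y j)‖ₑ * dmon n (A ∘ site) ((fun j => ‖v j‖ₑ) ∘ site)).toReal :=
      ENNReal.summable_toReal hfin
    refine hasDerivAt_tsum_of_isPreconnected hsum (t := Metric.ball (0 : ℝ) δ) Metric.isOpen_ball
      (convex_ball _ _).isPreconnected (g' := fun n t => coeff n (Y j) *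
        dmon n (vars (u + t • v : GevreySpace s p θ)) (vars v)) (fun n t _ => ?_) (fun n t ht => ?_)
      (Metric.mem_ball_self hδ0) ?_ (Metric.mem_ball_self hδ0)
    · refine (hasDerivAt_mon n (z := fun t : ℝ => vars (u + t • v : GevreySpace s p θ))
        (v := fun _ => vars v) fun w => ?_).const_mul _
      simp only [vars_add_smul]
      simpa using ((Complex.ofRealCLM.hasDerivAt (x := t)).mul_const (vars v w)).const_add
        (vars u w)
    · have ht' : |t| ≤ δ := by
        rw [Metric.mem_ball, dist_zero_right, Real.norm_eq_abs] at ht; exact ht.le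
      have h5 : ‖coeff n (Y j) * dmon n (vars (u + t • v : GevreySpace s p θ)) (vars v)‖ₑ ≤
          ‖coeff n (Y j)‖ₑ * dmon n (A ∘ site) ((fun j => ‖v j‖ₑ) ∘ site) := by
        rw [enorm_mul]
        refine mul_le_mul' le_rfl ((enorm_dmon_le n _ _).trans (dmon_mono n (fun w => ?_) fun w =>
          (enorm_vars v w).le))
        rw [vars_add_smul]
        refine (enorm_add_le _ _).trans ?_
        rw [enorm_mul, enorm_vars, enorm_vars, ← ofReal_norm (E := ℂ) (t : ℂ), Complex.norm_real,
          Real.norm_eq_abs]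
        exact add_le_add le_rfl (mul_le_mul' (ENNReal.ofReal_le_ofReal ht') le_rfl)
      rw [← toReal_enorm]
      exact ENNReal.toReal_mono (ne_top_of_le_ne_top hfin (ENNReal.le_tsum n)) h5
    · exact summable_ev (fun w => (enorm_vars _ w).le)
        (hY.maj_ne_top (hnorm 0 (by simpa using hδ0)) j)
  have h5 : (fun t : ℝ => evFam s p θ Y (u + t • v) j) =ᶠ[nhds 0]
      fun t : ℝ => ∑' n, coeff n (Y j) * mon n (vars (u + t • v : GevreySpace s p θ)) := by
    filter_upwards [Metric.ball_mem_nhds (0 : ℝ) hδ0] with t ht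
    rw [Metric.mem_ball, dist_zero_right, Real.norm_eq_abs] at ht
    exact hY.evFam_apply (hnorm t ht) j
  have h6 := h1.unique (h4.congr_of_eventuallyEq h5)
  rw [h6, zero_smul, add_zero]
  rfl

theorem FamBound.norm_fderiv_apply_le (hY : FamBound (gw s p θ) R Y c) (hc : 0 ≤ c)
    {u : GevreySpace s p θ} (hu : ‖u‖ < R / 3) {ρ : ℝ} (hρ : 0 < ρ) (huρ : ‖u‖ + ρ ≤ R)
    (v : GevreySpace s p θ) : ‖fderiv ℝ (evFam s p θ Y) u v‖ ≤ c / ρ * ‖v‖ := by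
  have hR : 0 < R := by linarith [norm_nonneg u]
  rcases eq_or_ne v 0 with rfl | hv
  · simp
  have hv0 : 0 < ‖v‖ := norm_pos_iff.2 hv
  rw [norm_le_iff_wnorm (by positivity)]
  simp only [hY.fderiv_apply hR hc hu]
  refine (wnorm_mono _ fun j => (enorm_tsum_le _).trans (tsum_enorm_dev_le (Y j) u v)).trans ?_
  have h := hY.wnorm_dmaj_le (gw_ne_top s p θ) (R₁ := ‖u‖) (b := ‖v‖) (t := ρ / ‖v‖)
    (norm_nonneg u) (norm_nonneg v) (by positivity) (by rwa [div_mul_cancel₀ _ hv0.ne'])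
    (wnorm_enorm_le_ofReal le_rfl) (wnorm_enorm_le_ofReal le_rfl)
  refine h.trans_eq ?_
  congr 1
  field_simp

/-! ### Hamiltonian vector fields are infinitesimally symplectic -/

theorem dmon_eq_tsum (n : MultiIndex) (z v : Var → ℂ) :
    dmon n z v = ∑' x, (n x : ℂ) * mon (n - Finsupp.single x 1) z * v x := by
  rw [tsum_eq_sum (s := n.support)]
  · rfl
  · intro x hx
    rw [Finsupp.notMem_support_iff.1 hx]; simp

theorem ev_pderiv (F : PS) (z : Var → ℂ) (x : Var) :
    ev (pderiv ℂ x F) z = ∑' n, coeff n F * ((n x : ℂ) * mon (n - Finsupp.single x 1) z) := by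
  have hinj : Function.Injective fun n : MultiIndex => n + Finsupp.single x 1 :=
    fun _ _ h => add_right_cancel h
  rw [← hinj.tsum_eq (f := fun n => coeff n F * ((n x : ℂ) * mon (n - Finsupp.single x 1) z))]
  · refine tsum_congr fun n => ?_
    rw [coeff_pderiv]
    simp only [Finsupp.add_apply, Finsupp.single_eq_same, add_tsub_cancel_right]
    push_cast
    ring
  · intro n hn
    have hv : n x ≠ 0 := by
      intro h; exact hn (by simp [h])
    exact ⟨n - Finsupp.single x 1, tsub_add_cancel_of_le
      (Finsupp.single_le_iff.2 (Nat.one_le_iff_ne_zero.2 hv))⟩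

theorem dev_eq_tsum {F : PS} {u v : ℤ → ℂ}
    (h : dmaj F (fun j => ‖u j‖ₑ) ((fun j => ‖v j‖ₑ) ∘ site) ≠ ⊤) :
    dev F u v = ∑' x, ev (pderiv ℂ x F) (vars u) * vars v x := by
  have h1 : Summable (Function.uncurry fun (n : MultiIndex) (x : Var) =>
      coeff n F * ((n x : ℂ) * mon (n - Finsupp.single x 1) (vars u)) * vars v x) := by
    refine summable_of_tsum_enorm_ne_top (ne_top_of_le_ne_top h ?_)
    rw [ENNReal.tsum_prod', ENNReal.tsum_comm, dmaj_eq_tsum]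
    refine ENNReal.tsum_le_tsum fun x => ?_
    simp only [Function.uncurry_apply_pair, enorm_mul _ (vars v x), ENNReal.tsum_mul_right]
    rw [mul_comm, maj_pderiv, enorm_vars]
    refine mul_le_mul' le_rfl (ENNReal.tsum_le_tsum fun n => ?_)
    rw [enorm_mul, enorm_mul, enorm_natCast, enorm_mon]
    exact mul_le_mul' le_rfl (mul_le_mul' le_rfl (mon_mono _ fun w => (enorm_vars u w).le))
  calc dev F u v = ∑' n, ∑' x, coeff n F *
        ((n x : ℂ) * mon (n - Finsupp.single x 1) (vars u)) * vars v x := by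
        refine tsum_congr fun n => ?_
        rw [dmon_eq_tsum, ← tsum_mul_left]
        exact tsum_congr fun x => by ring
    _ = ∑' x, ∑' n, coeff n F *
        ((n x : ℂ) * mon (n - Finsupp.single x 1) (vars u)) * vars v x := h1.tsum_comm.symm
    _ = _ := tsum_congr fun x => by rw [tsum_mul_right, ev_pderiv]

theorem dmon_swapIndex (n : MultiIndex) (u v : ℤ → ℂ) :
    dmon (swapIndex n) (vars u) (vars v) = (starRingEnd ℂ) (dmon n (vars u) (vars v)) := by
  have h : ∀ (u : ℤ → ℂ) (w : Var), vars u w.swap = (starRingEnd ℂ) (vars u w) := by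
    intro u w
    rcases w with w | w <;> simp [vars]
  induction n using multiIndex_induction with
  | h0 => simp
  | h1 n w ih =>
    rw [map_add, swapIndex_single, dmon_add_single, dmon_add_single, ih, mon_swapIndex, h, h,
      map_add, map_mul, map_mul]

theorem dev_conjPS (F : PS) (u v : ℤ → ℂ) :
    dev (conjPS F) u v = (starRingEnd ℂ) (dev F u v) := by
  rw [dev, dev, Complex.conj_tsum, ← swapIndex.toEquiv.tsum_eq]
  refine tsum_congr fun n => ?_
  simp only [AddEquiv.toEquiv_eq_coe, AddEquiv.coe_toEquiv]
  rw [coeff_conjPS, swapIndex_swapIndex, dmon_swapIndex, map_mul]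

theorem dev_smul (x : ℂ) (F : PS) (u v : ℤ → ℂ) : dev (x • F) u v = x * dev F u v := by
  rw [dev, dev, ← tsum_mul_left]
  exact tsum_congr fun n => by rw [coeff_smul, mul_assoc]

theorem dmaj_conjPS (F : PS) (a b : ℤ → ℝ≥0∞) :
    dmaj (conjPS F) a (b ∘ site) = dmaj F a (b ∘ site) := by
  rw [dmaj_eq_tsum, dmaj_eq_tsum, ← (Equiv.sumComm ℤ ℤ).tsum_eq]
  refine tsum_congr fun x => ?_
  change b (site x.swap) * maj (pderiv ℂ x.swap (conjPS F)) a = _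
  rw [← conjPS_pderiv, maj_conjPS, site_swap]
  rfl

/-- The Cauchy-Schwarz inequality. -/
theorem tsum_mul_le_wnorm {w : ℤ → ℝ≥0∞} (hw : ∀ j, 1 ≤ w j) (a b : ℤ → ℝ≥0∞) :
    ∑' j, a j * b j ≤ wnorm w a * wnorm w b := by
  have h1 : ∀ x : ℤ → ℝ≥0∞, ∀ t : Finset ℤ,
      (∑ j ∈ t, x j ^ (2 : ℝ)) ^ (1 / 2 : ℝ) ≤ wnorm w x := fun x t => by
    refine ENNReal.rpow_le_rpow ((Finset.sum_le_sum fun j _ => ENNReal.rpow_le_rpow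
      (le_mul_of_one_le_left' (hw j)) (by norm_num)).trans (ENNReal.sum_le_tsum t)) (by norm_num)
  rw [ENNReal.tsum_eq_iSup_sum]
  refine iSup_le fun t => ?_
  exact (ENNReal.inner_le_Lp_mul_Lq t a b ⟨by norm_num, by norm_num, by norm_num⟩).trans
    (mul_le_mul' (h1 a t) (h1 b t))

theorem one_le_gw (hs : 0 ≤ s) (hp : 0 ≤ p) (j : ℤ) : 1 ≤ gw s p θ j :=
  ENNReal.one_le_ofReal.2 (one_le_weight hs hp j)

/-- The second derivative of a Hamiltonian at `u`, in the directions `v` and `w`. -/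
def hess (S : PS) (u v w : ℤ → ℂ) : ℂ := ∑' y, dev (pderiv ℂ y S) u v * vars w y

theorem HamBound.wnorm_dmaj_le {S : PS} (hS : HamBound (gw s p θ) R S c)
    {u : GevreySpace s p θ} (hu : ‖u‖ < R) (v : GevreySpace s p θ) :
    wnorm (gw s p θ) (fun j => dmaj (pderiv ℂ (Sum.inr j) S) (fun j => ‖u j‖ₑ)
      ((fun j => ‖v j‖ₑ) ∘ site)) ≤ ENNReal.ofReal (c / ((R - ‖u‖) / (‖v‖ + 1))) :=
  FamBound.wnorm_dmaj_le (gw_ne_top s p θ) hS (R₁ := ‖u‖) (b := ‖v‖) (norm_nonneg u)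
    (norm_nonneg v) (div_pos (by linarith) (by positivity)) (by
      have : (R - ‖u‖) / (‖v‖ + 1) * ‖v‖ ≤ R - ‖u‖ := by
        rw [div_mul_eq_mul_div, div_le_iff₀ (by positivity)]
        nlinarith [norm_nonneg v]
      linarith) (wnorm_enorm_le_ofReal le_rfl) (wnorm_enorm_le_ofReal le_rfl)

theorem HamBound.tsum_dmaj_ne_top {S : PS} (hs : 0 ≤ s) (hp : 0 ≤ p)
    (hS : HamBound (gw s p θ) R S c) (hSr : IsReal S) {u : GevreySpace s p θ} (hu : ‖u‖ < R)
    (v w : GevreySpace s p θ) :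
    ∑' y, dmaj (pderiv ℂ y S) (fun j => ‖u j‖ₑ) ((fun j => ‖v j‖ₑ) ∘ site) * ‖vars w y‖ₑ ≠ ⊤ := by
  set b : ℤ → ℝ≥0∞ := fun j =>
    dmaj (pderiv ℂ (Sum.inr j) S) (fun j => ‖u j‖ₑ) ((fun j => ‖v j‖ₑ) ∘ site) with hb
  have h1 : ∀ y : Var, dmaj (pderiv ℂ y S) (fun j => ‖u j‖ₑ) ((fun j => ‖v j‖ₑ) ∘ site) =
      b (site y) := by
    intro y
    rcases y with j | j
    · have : pderiv ℂ (Sum.inl j) S = conjPS (pderiv ℂ (Sum.inr j) S) := by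
        rw [conjPS_pderiv, isReal_iff.1 hSr]; rfl
      rw [this, dmaj_conjPS]; rfl
    · rfl
  simp only [h1, enorm_vars]
  rw [Summable.tsum_sum ENNReal.summable ENNReal.summable]
  have h2 : ∑' j, b j * ‖w j‖ₑ ≠ ⊤ := by
    refine ne_top_of_le_ne_top ?_ (tsum_mul_le_wnorm (one_le_gw (θ := θ) hs hp) b fun j => ‖w j‖ₑ)
    rw [wnorm_enorm]
    exact ENNReal.mul_ne_top (ne_top_of_le_ne_top ENNReal.ofReal_ne_top (hS.wnorm_dmaj_le hu v))
      enorm_ne_top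
  exact ENNReal.add_ne_top.2 ⟨h2, h2⟩

theorem HamBound.dmaj_ne_top {S : PS} (hS : HamBound (gw s p θ) R S c) (hSr : IsReal S)
    {u : GevreySpace s p θ} (hu : ‖u‖ < R) (v : GevreySpace s p θ) (y : Var) :
    dmaj (pderiv ℂ y S) (fun j => ‖u j‖ₑ) ((fun j => ‖v j‖ₑ) ∘ site) ≠ ⊤ := by
  have key : ∀ j, dmaj (pderiv ℂ (Sum.inr j) S) (fun j => ‖u j‖ₑ)
      ((fun j => ‖v j‖ₑ) ∘ site) ≠ ⊤ := fun j => ne_top_of_wnorm_le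
    (hS.wnorm_dmaj_le hu v) j
  rcases y with j | j
  · have : pderiv ℂ (Sum.inl j) S = conjPS (pderiv ℂ (Sum.inr j) S) := by
      rw [conjPS_pderiv, isReal_iff.1 hSr]; rfl
    rw [this, dmaj_conjPS]; exact key j
  · exact key j

theorem HamBound.hess_symm {S : PS} (hs : 0 ≤ s) (hp : 0 ≤ p) (hS : HamBound (gw s p θ) R S c)
    (hSr : IsReal S) {u : GevreySpace s p θ} (hu : ‖u‖ < R) (v w : GevreySpace s p θ) :
    hess S u v w = hess S u w v := by
  have h1 : ∀ v w : GevreySpace s p θ, hess S u v w =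
      ∑' y, ∑' x, ev (pderiv ℂ x (pderiv ℂ y S)) (vars u) * vars v x * vars w y := by
    intro v w
    refine tsum_congr fun y => ?_
    rw [dev_eq_tsum (hS.dmaj_ne_top hSr hu v y), ← tsum_mul_right]
  have h2 : Summable (Function.uncurry fun y x =>
      ev (pderiv ℂ x (pderiv ℂ y S)) (vars u) * vars v x * vars w y) := by
    refine summable_of_tsum_enorm_ne_top
      (ne_top_of_le_ne_top (hS.tsum_dmaj_ne_top hs hp hSr hu v w) ?_)
    rw [ENNReal.tsum_prod']
    refine ENNReal.tsum_le_tsum fun y => ?_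
    simp only [Function.uncurry_apply_pair, enorm_mul _ (vars w y), ENNReal.tsum_mul_right]
    refine mul_le_mul' ?_ le_rfl
    rw [dmaj_eq_tsum]
    refine ENNReal.tsum_le_tsum fun x => ?_
    rw [enorm_mul, mul_comm, enorm_vars]
    exact mul_le_mul' le_rfl (enorm_ev_le _ fun w => (enorm_vars u w).le)
  rw [h1, h1, h2.tsum_comm.symm]
  refine tsum_congr fun x => tsum_congr fun y => ?_
  rw [pderiv_comm x y]
  ring

/-- The Hamiltonian vector field of `S`. -/
def hamVec (S : PS) (j : ℤ) : PS := hamField S (Sum.inl j)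

theorem HamBound.hamVec {S : PS} {w : ℤ → ℝ≥0∞} (hS : HamBound w R S c) :
    FamBound w R (hamVec S) c := fun a ha => by
  have h : ∀ j, maj (GevreyBirkhoff.hamVec S j) a = maj (pderiv ℂ (Sum.inr j) S) a :=
    fun j => maj_hamField S _ a
  simp only [h]
  exact hS a ha

/-- The symplectic form turns the derivative of a Hamiltonian vector field into the Hessian. -/
theorem HamBound.symplecticForm_fderiv {S : PS} (hs : 0 ≤ s) (hp : 0 ≤ p) (hR : 0 < R)
    (hc : 0 ≤ c) (hS : HamBound (gw s p θ) R S c) (hSr : IsReal S) {u : GevreySpace s p θ}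
    (hu : ‖u‖ < R / 3) (v w : GevreySpace s p θ) :
    (symplecticForm (fderiv ℝ (evFam s p θ (GevreyBirkhoff.hamVec S)) u v) w : ℂ) =
      -hess S u v w := by
  have huR : ‖u‖ < R := by linarith
  have hsum : Summable fun y => dev (pderiv ℂ y S) u v * vars w y := by
    refine summable_of_tsum_enorm_ne_top
      (ne_top_of_le_ne_top (hS.tsum_dmaj_ne_top hs hp hSr huR v w) ?_)
    refine ENNReal.tsum_le_tsum fun y => ?_
    rw [enorm_mul]
    exact mul_le_mul' ((enorm_tsum_le _).trans (tsum_enorm_dev_le _ _ _)) le_rfl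
  have h0 := (hsum.comp_injective Sum.inl_injective).tsum_add
    (hsum.comp_injective Sum.inr_injective)
  simp only [Function.comp_apply] at h0
  rw [hess, Summable.tsum_sum (hsum.comp_injective Sum.inl_injective)
    (hsum.comp_injective Sum.inr_injective), ← h0, symplecticForm, Complex.ofReal_tsum, ← tsum_neg]
  refine tsum_congr fun j => ?_
  rw [hS.hamVec.fderiv_apply hR hc hu, GevreyBirkhoff.hamVec, hamField, dev_smul]
  have h1 : dev (pderiv ℂ (Sum.inl j) S) u v =
      (starRingEnd ℂ) (dev (pderiv ℂ (Sum.inr j) S) u v) := by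
    rw [← dev_conjPS, conjPS_pderiv, isReal_iff.1 hSr]; rfl
  simp only [Sum.swap_inl, h1, vars, Sum.elim_inl, Sum.elim_inr, hamSign]
  set x := dev (pderiv ℂ (Sum.inr j) S) u v
  apply Complex.ext <;> simp <;> ring

/-- The derivative of a Hamiltonian vector field is skew for the symplectic form. -/
theorem HamBound.symplecticForm_fderiv_add {S : PS} (hs : 0 ≤ s) (hp : 0 ≤ p) (hR : 0 < R)
    (hc : 0 ≤ c) (hS : HamBound (gw s p θ) R S c) (hSr : IsReal S) {u : GevreySpace s p θ}
    (hu : ‖u‖ < R / 3) (v w : GevreySpace s p θ) :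
    symplecticForm (fderiv ℝ (evFam s p θ (GevreyBirkhoff.hamVec S)) u v) w +
      symplecticForm v (fderiv ℝ (evFam s p θ (GevreyBirkhoff.hamVec S)) u w) = 0 := by
  have h1 := hS.symplecticForm_fderiv hs hp hR hc hSr hu v w
  have h2 := hS.symplecticForm_fderiv hs hp hR hc hSr hu w v
  rw [hS.hess_symm hs hp hSr (by linarith) w v, ← h1] at h2
  rw [symplecticForm_neg_swap v]
  have h3 := Complex.ofReal_injective h2
  linarith

end

/-! ### Time-one maps are symplectic -/

/-- The second order Taylor estimate for Lie series. -/
theorem FamBound.expPb_sub_sub {w : ℤ → ℝ≥0∞} (hw : ∀ j, w j ≠ ⊤) {R ρ η c : ℝ} {S : PS}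
    {Y : ℤ → PS} (hR : 0 ≤ R) (hρ : 0 < ρ) (hη : 0 < η) (hc : 0 ≤ c) (hSr : IsReal S)
    (hS3 : VanishBelow 3 S) (hS : HamBound w (R + ρ) S η) (hY : FamBound w (R + ρ) Y c)
    (hsmall : 6 * η ≤ ρ) :
    FamBound w R (fun j => expPb S (Y j) - Y j - GevreyBirkhoff.pb S (Y j))
      (18 * (η / ρ) ^ 2 * c) := by
  have hx2 : 3 * (η / ρ) ≤ 1 / 2 := by rw [← mul_div_assoc, div_le_iff₀ hρ]; linarith
  have hx0 : 0 ≤ 3 * (η / ρ) := by positivity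
  obtain ⟨hs, hle⟩ := summable_geometric_tail (c := 3 * (η / ρ) * c) hx0 hx2 (by positivity)
  have e : ∀ k : ℕ, (3 * (η / ρ)) ^ (k + 1) * (3 * (η / ρ) * c) =
      (3 * (η / ρ)) ^ (k + 1 + 1) * c := fun k => by ring
  simp only [e] at hs hle
  refine (FamBound.of_tsum hw (fun k => hY.iterate_div_factorial hw hR hρ hη hc hSr hS (k + 1 + 1))
    (fun k => by positivity) hs fun j n => ?_).mono le_rfl (hle.trans_eq (by ring))
  rw [map_sub, coeff_expPb_sub_self]
  rcases Nat.eq_zero_or_pos n.degree with h0 | h0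
  · have h1 : VanishBelow 2 (GevreyBirkhoff.pb S (Y j)) := hS3.pb_const _ (by norm_num)
    rw [h0, h1 n (by omega)]; simp
  · obtain ⟨d, hd⟩ : ∃ d, n.degree = d + 1 := ⟨n.degree - 1, by omega⟩
    rw [hd, Finset.sum_range_succ']
    simp only [zero_add, Nat.factorial_one, Nat.cast_one, inv_one, one_smul,
      Function.iterate_one, add_sub_cancel_right]
    exact enorm_sum_le_tsum _ _

theorem HamBound.smul {w : ℤ → ℝ≥0∞} {R c : ℝ} {S : PS} (h : HamBound w R S c) (x : ℂ) :
    HamBound w R (x • S) (‖x‖ * c) := by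
  have := FamBound.smul h x
  simpa only [HamBound, pderiv_smul] using this

/-- A formal Hamiltonian whose time-one flow is close to the identity on the ball of radius `R`. -/
structure Generator (s p θ R η : ℝ) (S : PS) : Prop where
  real : IsReal S
  mom : MomentumFree S
  vanish : VanishBelow 3 S
  bound : HamBound (gw s p θ) R S η
  pos : 0 < η
  small : 300 * η ≤ R
  s_nonneg : 0 ≤ s
  p_nonneg : 0 ≤ p

/-- The components of the time-one flow. -/
def flow (S : PS) (j : ℤ) : PS := expPb S (X (Sum.inl j))

section

variable {s p θ : ℝ}

theorem evFam_X : evFam s p θ (fun j => X (Sum.inl j)) = id := by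
  funext u
  exact coords_ext fun j => by rw [(famBound_X _ ‖u‖).evFam_apply le_rfl, ev_X]; rfl

theorem FamBound.hasFDerivAt {Y : ℤ → PS} {R c : ℝ} (hY : FamBound (gw s p θ) R Y c) (hc : 0 ≤ c)
    {u : GevreySpace s p θ} (hu : ‖u‖ < R / 3) :
    HasFDerivAt (evFam s p θ Y) (fderiv ℝ (evFam s p θ Y) u) u := by
  have hR : 0 < R := by linarith [norm_nonneg u]
  exact ((hY.analyticOnNhd hR hc) u (by simpa using hu)).differentiableAt.hasFDerivAt

theorem FamBound.fderiv_sub {Y Z : ℤ → PS} {R c d : ℝ} (hY : FamBound (gw s p θ) R Y c)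
    (hZ : FamBound (gw s p θ) R Z d) (hc : 0 ≤ c) (hd : 0 ≤ d) {u : GevreySpace s p θ}
    (hu : ‖u‖ < R / 3) :
    fderiv ℝ (evFam s p θ fun j => Y j - Z j) u =
      fderiv ℝ (evFam s p θ Y) u - fderiv ℝ (evFam s p θ Z) u := by
  have hR : 0 < R := by linarith [norm_nonneg u]
  have hYZ := hY.sub (gw_ne_top s p θ) hZ hc hd
  have h1 : evFam s p θ (fun j => Y j - Z j) =ᶠ[nhds u]
      fun u => evFam s p θ Y u - evFam s p θ Z u := by
    filter_upwards [Metric.isOpen_ball.mem_nhds (by simpa using hu : u ∈ Metric.ball 0 (R / 3))]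
      with x hx
    rw [mem_ball_zero_iff] at hx
    exact evFam_sub hY hZ hYZ (by linarith)
  rw [h1.fderiv_eq]
  exact ((hY.hasFDerivAt hc hu).sub (hZ.hasFDerivAt hd hu)).fderiv

end

namespace Generator

variable {s p θ R η : ℝ} {S : PS}

theorem R_pos (h : Generator s p θ R η S) : 0 < R := by linarith [h.pos, h.small]

/-- The flow for a fraction of the time. -/
theorem smul (h : Generator s p θ R η S) {t : ℝ} (ht : 0 < t) (ht1 : t ≤ 1) :
    Generator s p θ R (t * η) ((t : ℂ) • S) where
  real := h.real.smul t
  mom := h.mom.smul _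
  vanish := h.vanish.smul _
  bound := by
    have := h.bound.smul (t : ℂ)
    rwa [Complex.norm_real, Real.norm_of_nonneg ht.le] at this
  pos := mul_pos ht h.pos
  small := by nlinarith [h.pos, h.small]
  s_nonneg := h.s_nonneg
  p_nonneg := h.p_nonneg

theorem flow_sub (h : Generator s p θ R η S) {Y : ℤ → PS} {c : ℝ} (hc : 0 ≤ c)
    (hY : FamBound (gw s p θ) R Y c) :
    FamBound (gw s p θ) (R / 2) (fun j => expPb S (Y j) - Y j) (12 * (η / R) * c) := by
  have hR := h.R_pos
  have := FamBound.expPb_sub_self (gw_ne_top s p θ) (R := R / 2) (ρ := R / 2) (by positivity)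
    (by positivity) h.pos hc h.real (by rw [add_halves]; exact h.bound)
    (by rw [add_halves]; exact hY) (by linarith [h.small, h.pos])
  refine this.mono le_rfl (le_of_eq ?_)
  field_simp
  ring

theorem flow_sub_X (h : Generator s p θ R η S) :
    FamBound (gw s p θ) (R / 2) (fun j => flow S j - X (Sum.inl j)) (12 * η) := by
  refine (h.flow_sub h.R_pos.le (famBound_X _ R)).mono le_rfl (le_of_eq ?_)
  have := h.R_pos
  field_simp

theorem flow_bound (h : Generator s p θ R η S) {R' : ℝ} (hR' : R' ≤ R / 2) (hR0 : 0 ≤ R') :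
    FamBound (gw s p θ) R' (flow S) (R' + 12 * η) := by
  have h1 := (famBound_X (gw s p θ) R').add (gw_ne_top s p θ) (h.flow_sub_X.mono hR' le_rfl) hR0
    (by linarith [h.pos])
  simpa only [add_sub_cancel] using h1

theorem norm_evFam_flow_le (h : Generator s p θ R η S) {u : GevreySpace s p θ} (hu : ‖u‖ ≤ R / 2) :
    ‖evFam s p θ (flow S) u‖ ≤ ‖u‖ + 12 * η :=
  (h.flow_bound hu (norm_nonneg u)).norm_evFam_le (by linarith [h.pos, norm_nonneg u]) le_rfl

/-- Composition with the time-one map is the action of the Lie series. -/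
theorem evFam_expPb (h : Generator s p θ R η S) {Y : ℤ → PS} {R' c : ℝ}
    (hY : FamBound (gw s p θ) R' Y c) {u : GevreySpace s p θ} (hu : ‖u‖ ≤ R / 2)
    (huR : ‖u‖ + 12 * η ≤ R') :
    evFam s p θ (fun j => expPb S (Y j)) u = evFam s p θ Y (evFam s p θ (flow S) u) := by
  have hb := h.flow_bound hu (norm_nonneg u)
  refine congrArg (ofCoords s p θ) (funext fun j => ?_)
  refine ev_expPb_vars h.real h.mom h.vanish (fun j => (hb.evFam_apply le_rfl j).symm)
    (hb.maj_ne_top le_rfl) ?_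
  exact ne_top_of_wnorm_le (hY _ ((hb _ (wnorm_enorm_le_ofReal le_rfl)).trans
    (ENNReal.ofReal_le_ofReal huR))) j

theorem fderiv_flow (h : Generator s p θ R η S) {u : GevreySpace s p θ} (hu : ‖u‖ < R / 6) :
    fderiv ℝ (evFam s p θ fun j => flow S j - X (Sum.inl j)) u =
      fderiv ℝ (evFam s p θ (flow S)) u - ContinuousLinearMap.id ℝ _ := by
  have hR := h.R_pos
  rw [FamBound.fderiv_sub (h.flow_bound le_rfl (by positivity)) (famBound_X (gw s p θ) (R / 2))
    (by linarith [h.pos]) (by positivity) (by linarith), evFam_X, fderiv_id]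

theorem norm_fderiv_flow_sub_le (h : Generator s p θ R η S) {u : GevreySpace s p θ}
    (hu : ‖u‖ < R / 6) (v : GevreySpace s p θ) :
    ‖fderiv ℝ (evFam s p θ (flow S)) u v - v‖ ≤ 36 * (η / R) * ‖v‖ := by
  have hR := h.R_pos
  have h1 := h.flow_sub_X.norm_fderiv_apply_le (by linarith [h.pos]) (u := u) (ρ := R / 3)
    (by linarith) (by positivity) (by linarith) v
  rw [h.fderiv_flow hu] at h1
  refine h1.trans_eq ?_
  field_simp
  ring

/-- Over short times, the flow is symplectic up to an error of second order. -/
theorem abs_symplecticForm_sub_le (h : Generator s p θ R η S) {u : GevreySpace s p θ}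
    (hu : ‖u‖ < R / 6) (v w : GevreySpace s p θ) :
    |symplecticForm (fderiv ℝ (evFam s p θ (flow S)) u v) (fderiv ℝ (evFam s p θ (flow S)) u w) -
      symplecticForm v w| ≤ 1000 * (η / R) ^ 2 * (‖v‖ * ‖w‖) := by
  have hR := h.R_pos
  have hη := h.pos
  set x := η / R with hx
  have hx0 : 0 < x := div_pos hη hR
  have hx1 : x ≤ 1 / 300 := by rw [hx, div_le_iff₀ hR]; linarith [h.small]
  have hV := h.bound.hamVec
  have hpb : (fun j => pb S (X (Sum.inl j))) = hamVec S := funext fun j => pb_X h.mom (Sum.inl j)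
  have hZ : FamBound (gw s p θ) (R / 2) (fun j => (flow S j - X (Sum.inl j)) - hamVec S j)
      (72 * x * η) := by
    have h1 := FamBound.expPb_sub_sub (gw_ne_top s p θ) (R := R / 2) (ρ := R / 2) (c := R)
      (Y := fun j => X (Sum.inl j)) (by positivity) (by positivity) hη hR.le h.real h.vanish
      (by rw [add_halves]; exact h.bound) (by rw [add_halves]; exact famBound_X _ R)
      (by linarith [h.small])
    simp only [← hpb]
    refine h1.mono le_rfl (le_of_eq ?_)
    rw [hx]; field_simp; ring
  set D := fderiv ℝ (evFam s p θ (flow S)) u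
  set A := fderiv ℝ (evFam s p θ (hamVec S)) u
  set E := fderiv ℝ (evFam s p θ fun j => (flow S j - X (Sum.inl j)) - hamVec S j) u with hE
  have hD : ∀ v, D v = v + A v + E v := by
    intro v
    rw [hE, FamBound.fderiv_sub h.flow_sub_X (hV.mono (by linarith) le_rfl) (by linarith) hη.le
      (by linarith), h.fderiv_flow hu]
    simp only [sub_apply, ContinuousLinearMap.id_apply]
    abel
  have hA : ∀ v, ‖A v‖ ≤ 3 * x * ‖v‖ := fun v => by
    refine (hV.norm_fderiv_apply_le hη.le (u := u) (ρ := R / 3) (by linarith) (by positivity)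
      (by linarith) v).trans_eq ?_
    rw [hx]; field_simp
  have hE' : ∀ v, ‖E v‖ ≤ 216 * x ^ 2 * ‖v‖ := fun v => by
    refine (hZ.norm_fderiv_apply_le (by positivity) (u := u) (ρ := R / 3) (by linarith)
      (by positivity) (by linarith) v).trans_eq ?_
    rw [hx]; field_simp; ring
  have hAle : ∀ v, ‖A v‖ ≤ ‖v‖ / 100 := fun v => (hA v).trans (by nlinarith [norm_nonneg v])
  have hEle : ∀ v, ‖E v‖ ≤ ‖v‖ / 100 := fun v => (hE' v).trans (by
    have : 216 * x ^ 2 ≤ 1 / 100 := by nlinarith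
    nlinarith [norm_nonneg v])
  -- the terms of first order cancel, as `A` is skew
  have key : symplecticForm (D v) (D w) - symplecticForm v w =
      symplecticForm (A v) (A w) + symplecticForm (E v) (D w) + symplecticForm (v + A v) (E w) := by
    have h0 := h.bound.symplecticForm_fderiv_add h.s_nonneg h.p_nonneg hR hη.le h.real (u := u)
      (by linarith) v w
    simp only [hD, symplecticForm_add_left h.s_nonneg h.p_nonneg,
      symplecticForm_add_right h.s_nonneg h.p_nonneg]
    linear_combination h0
  have hΩ : ∀ v w : GevreySpace s p θ, |symplecticForm v w| ≤ 2 * (‖v‖ * ‖w‖) :=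
    abs_symplecticForm_le h.s_nonneg h.p_nonneg
  rw [key]
  have b1 : |symplecticForm (A v) (A w)| ≤ 18 * x ^ 2 * (‖v‖ * ‖w‖) := by
    refine (hΩ _ _).trans ?_
    have := mul_le_mul (hA v) (hA w) (norm_nonneg _) (by positivity)
    nlinarith
  have b2 : |symplecticForm (E v) (D w)| ≤ 450 * x ^ 2 * (‖v‖ * ‖w‖) := by
    refine (hΩ _ _).trans ?_
    have hDw : ‖D w‖ ≤ 102 / 100 * ‖w‖ := by
      rw [hD]
      have := (norm_add_le (w + A w) (E w)).trans (add_le_add_left (norm_add_le w (A w)) _)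
      linarith [hAle w, hEle w]
    have h1 := mul_le_mul (hE' v) hDw (norm_nonneg _) (by positivity)
    have h2 : 0 ≤ x ^ 2 * (‖v‖ * ‖w‖) := by positivity
    nlinarith
  have b3 : |symplecticForm (v + A v) (E w)| ≤ 450 * x ^ 2 * (‖v‖ * ‖w‖) := by
    refine (hΩ _ _).trans ?_
    have hDv : ‖v + A v‖ ≤ 102 / 100 * ‖v‖ := by
      linarith [norm_add_le v (A v), hAle v, norm_nonneg v]
    have h1 := mul_le_mul hDv (hE' w) (norm_nonneg _) (by positivity)
    have h2 : 0 ≤ x ^ 2 * (‖v‖ * ‖w‖) := by positivity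
    nlinarith
  have h2 : 0 ≤ x ^ 2 * (‖v‖ * ‖w‖) := by positivity
  refine (abs_add_three _ _ _).trans ?_
  nlinarith

/-- The time-one map of a real Hamiltonian is symplectic: the interval `[0, 1]` is divided into `N`
steps, each of which contributes an error of order `N⁻²`. -/
theorem symplecticForm_fderiv_flow (h : Generator s p θ R η S) {u : GevreySpace s p θ}
    (hu : ‖u‖ < R / 8) (v w : GevreySpace s p θ) :
    symplecticForm (fderiv ℝ (evFam s p θ (flow S)) u v) (fderiv ℝ (evFam s p θ (flow S)) u w) =
      symplecticForm v w := by
  have hR := h.R_pos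
  have hη := h.pos
  set x := η / R with hx
  have key : ∀ N : ℕ, 0 < N → ∀ k : ℕ, k + 1 ≤ N → ∀ u : GevreySpace s p θ, ‖u‖ < R / 8 →
      ∀ v w : GevreySpace s p θ,
      |symplecticForm (fderiv ℝ (evFam s p θ (flow ((((k + 1 : ℕ) / N : ℝ) : ℂ) • S))) u v)
        (fderiv ℝ (evFam s p θ (flow ((((k + 1 : ℕ) / N : ℝ) : ℂ) • S))) u w) -
        symplecticForm v w| ≤ (k + 1 : ℕ) * (4000 * (x / N) ^ 2 * (‖v‖ * ‖w‖)) := by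
    intro N hN k
    have hN0 : (0 : ℝ) < N := by exact_mod_cast hN
    have hgen : ∀ k : ℕ, k + 1 ≤ N →
        Generator s p θ R (((k + 1 : ℕ) / N : ℝ) * η) ((((k + 1 : ℕ) / N : ℝ) : ℂ) • S) :=
      fun k hk => h.smul (by positivity) ((div_le_one hN0).2 (by exact_mod_cast hk))
    have hstep := hgen 0 (by omega)
    have hone : ∀ u : GevreySpace s p θ, ‖u‖ < R / 6 → ∀ v w : GevreySpace s p θ,
        |symplecticForm (fderiv ℝ (evFam s p θ (flow ((((0 + 1 : ℕ) / N : ℝ) : ℂ) • S))) u v)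
        (fderiv ℝ (evFam s p θ (flow ((((0 + 1 : ℕ) / N : ℝ) : ℂ) • S))) u w) -
        symplecticForm v w| ≤ 1000 * (x / N) ^ 2 * (‖v‖ * ‖w‖) := by
      intro u hu v w
      refine (hstep.abs_symplecticForm_sub_le hu v w).trans_eq ?_
      rw [hx]; push_cast; field_simp
    induction k with
    | zero =>
      intro _ u hu v w
      refine (hone u (by linarith) v w).trans ?_
      have : 0 ≤ (x / N) ^ 2 * (‖v‖ * ‖w‖) := by positivity
      push_cast; linarith
    | succ k ih =>
      intro hk u hu v w
      have hk' : k + 1 ≤ N := by omega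
      have hgk := hgen k hk'
      have hηk : ((k + 1 : ℕ) / N : ℝ) * η ≤ η := by
        have : ((k + 1 : ℕ) / N : ℝ) ≤ 1 := (div_le_one hN0).2 (by exact_mod_cast hk')
        nlinarith
      have hη1 : ((0 + 1 : ℕ) / N : ℝ) * η ≤ η := by
        have : ((0 + 1 : ℕ) / N : ℝ) ≤ 1 := (div_le_one hN0).2 (by exact_mod_cast hN)
        nlinarith
      set Φ := evFam s p θ (flow ((((k + 1 : ℕ) / N : ℝ) : ℂ) • S)) with hΦ
      set Φ₁ := evFam s p θ (flow ((((0 + 1 : ℕ) / N : ℝ) : ℂ) • S)) with hΦ₁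
      have hΦu : ∀ u : GevreySpace s p θ, ‖u‖ < R / 8 → ‖Φ u‖ < R / 6 := fun u hu => by
        have := hgk.norm_evFam_flow_le (u := u) (by linarith)
        linarith [h.small]
      have hcomp : evFam s p θ (flow ((((k + 1 + 1 : ℕ) / N : ℝ) : ℂ) • S)) =ᶠ[nhds u] Φ₁ ∘ Φ := by
        filter_upwards [Metric.isOpen_ball.mem_nhds
          (by simpa using hu : u ∈ Metric.ball 0 (R / 8))] with y hy
        rw [mem_ball_zero_iff] at hy
        have h1 := hgk.evFam_expPb (hstep.flow_bound le_rfl (by positivity)) (u := y)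
          (by linarith) (by linarith [h.small])
        refine Eq.trans (congrFun (congrArg _ (funext fun j => ?_)) y) h1
        rw [flow, flow, expPb_smul_expPb_smul h.mom h.vanish]
        congr 2
        push_cast
        ring
      have hd1 : HasFDerivAt Φ (fderiv ℝ Φ u) u :=
        (hgk.flow_bound le_rfl (by positivity)).hasFDerivAt (by positivity) (by linarith)
      have hd2 : HasFDerivAt Φ₁ (fderiv ℝ Φ₁ (Φ u)) (Φ u) :=
        (hstep.flow_bound le_rfl (by positivity)).hasFDerivAt (by positivity)
          (by linarith [hΦu u hu])
      rw [hcomp.fderiv_eq, (hd2.comp u hd1).fderiv]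
      simp only [ContinuousLinearMap.comp_apply]
      have hb : ∀ v, ‖fderiv ℝ Φ u v‖ ≤ 2 * ‖v‖ := fun v => by
        have h1 := hgk.norm_fderiv_flow_sub_le (u := u) (by linarith) v
        have h2 : 36 * (((k + 1 : ℕ) / N : ℝ) * η / R) ≤ 1 := by
          rw [← mul_div_assoc, div_le_one hR]; linarith [h.small]
        have h3 := norm_le_norm_add_norm_sub' (fderiv ℝ Φ u v) v
        nlinarith [norm_nonneg v]
      have e1 := hone (Φ u) (hΦu u hu) (fderiv ℝ Φ u v) (fderiv ℝ Φ u w)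
      have e2 := ih hk' u hu v w
      have e3 := mul_le_mul (hb v) (hb w) (norm_nonneg _) (by positivity)
      have e4 : 1000 * (x / N) ^ 2 * (‖fderiv ℝ Φ u v‖ * ‖fderiv ℝ Φ u w‖) ≤
          4000 * (x / N) ^ 2 * (‖v‖ * ‖w‖) := by
        have := mul_le_mul_of_nonneg_left e3 (by positivity : 0 ≤ 1000 * (x / N) ^ 2)
        linarith
      have e5 := abs_sub_le (symplecticForm (fderiv ℝ Φ₁ (Φ u) (fderiv ℝ Φ u v))
        (fderiv ℝ Φ₁ (Φ u) (fderiv ℝ Φ u w)))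
        (symplecticForm (fderiv ℝ Φ u v) (fderiv ℝ Φ u w)) (symplecticForm v w)
      push_cast at e2 ⊢
      linarith
  have hlim : ∀ N : ℕ, |symplecticForm (fderiv ℝ (evFam s p θ (flow S)) u v)
      (fderiv ℝ (evFam s p θ (flow S)) u w) - symplecticForm v w| ≤
      4000 * x ^ 2 * (‖v‖ * ‖w‖) * (1 / ((N : ℝ) + 1)) := by
    intro N
    have h1 := key (N + 1) N.succ_pos N le_rfl u hu v w
    rw [div_self (by positivity), Complex.ofReal_one, one_smul] at h1
    refine h1.trans_eq ?_
    push_cast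
    field_simp
  have h0 := ge_of_tendsto' ((tendsto_one_div_add_atTop_nhds_zero_nat (𝕜 := ℝ)).const_mul
    (4000 * x ^ 2 * (‖v‖ * ‖w‖))) hlim
  rw [mul_zero] at h0
  exact sub_eq_zero.1 (abs_nonpos_iff.1 h0)

end Generator

/-! ### The Newton scheme -/

theorem VanishBelow.iterate_pb {d m k : ℕ} {S F : PS} (hS : VanishBelow (d + 2) S)
    (hF : VanishBelow m F) : VanishBelow (k * d + m) ((GevreyBirkhoff.pb S)^[k] F) := by
  induction k with
  | zero => simpa using hF
  | succ k ih =>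
    rw [Function.iterate_succ_apply']
    exact hS.pb ih (by rw [Nat.succ_mul]; omega)

/-- The order of the remainder is doubled by a Newton step: the solution of the homological
equation cancels the nonresonant part of `P`. -/
theorem vanishBelow_newton {ω : ℤ → ℝ} {d : ℕ} {S P : PS} (hSm : MomentumFree S)
    (hS : VanishBelow (d + 2) S) (hP : VanishBelow (d + 2) P)
    (hZ : VanishBelow (2 * d + 2) (resonantPart ω P))
    (hhom : pb S (quadPS ω) = resonantPart ω P - P) :
    VanishBelow (2 * d + 2) (expPb S (quadPS ω + P) - quadPS ω) := by
  have hQ : VanishBelow (d + 2) (resonantPart ω P - P) := (hZ.mono (by omega)).sub hP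
  have h1 : VanishBelow (2 * d + 2) (expPb S P - P) := fun n hn => by
    rw [coeff_expPb_sub_self]
    refine Finset.sum_eq_zero fun k _ => ?_
    exact ((VanishBelow.iterate_pb (k := k + 1) hS hP).smul _) n (by rw [Nat.succ_mul]; omega)
  have h2 : VanishBelow (2 * d + 2) (expPb S (quadPS ω) - quadPS ω + P) := fun n hn => by
    rw [map_add, coeff_expPb_sub_self]
    simp only [Function.iterate_succ_apply, hhom]
    rcases Nat.eq_zero_or_pos n.degree with h0 | h0
    · rw [h0, hP n (by omega)]; simp
    · obtain ⟨e, he⟩ : ∃ e, n.degree = e + 1 := ⟨n.degree - 1, by omega⟩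
      rw [he, Finset.sum_range_succ', Finset.sum_eq_zero fun k _ =>
        ((VanishBelow.iterate_pb (k := k + 1) hS hQ).smul _) n (by rw [Nat.succ_mul]; omega)]
      simp only [zero_add, Nat.factorial_one, Nat.cast_one, inv_one, one_smul,
        Function.iterate_zero, id]
      rw [← map_add, sub_add_cancel, hZ n hn]
  have e : expPb S (quadPS ω + P) - quadPS ω =
      (expPb S P - P) + (expPb S (quadPS ω) - quadPS ω + P) := by
    rw [expPb_add hSm]; abel
  rw [e]
  exact h1.add h2

/-- The perturbations produced by the Newton scheme. -/
def newtonSeq (ω : ℤ → ℝ) (P : PS) : ℕ → PS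
  | 0 => P
  | k + 1 => expPb (homSol ω (newtonSeq ω P k)) (quadPS ω + newtonSeq ω P k) - quadPS ω

/-- A perturbation of order `d + 2` of the quadratic part, for which the sum is still formally
linearizable. -/
structure Perturbation (ω : ℤ → ℝ) (d : ℕ) (P : PS) : Prop where
  real : IsReal P
  mom : MomentumFree P
  vanish : VanishBelow (d + 2) P
  lin : Linearizable ω (quadPS ω + P)

theorem isReal_quadPS (ω : ℤ → ℝ) : IsReal (quadPS ω) := isReal_toPS (quadratic_mem ω).1

theorem Perturbation.step {ω : ℤ → ℝ} {d : ℕ} {P : PS} (hd : 1 ≤ d) (h : Perturbation ω d P) :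
    Perturbation ω (2 * d) (expPb (homSol ω P) (quadPS ω + P) - quadPS ω) where
  real := (h.real.homSol.expPb ((isReal_quadPS ω).add h.real)).sub (isReal_quadPS ω)
  mom := (h.mom.homSol.expPb ((momentumFree_quadPS ω).add h.mom)).sub (momentumFree_quadPS ω)
  vanish := vanishBelow_newton h.mom.homSol h.vanish.homSol h.vanish
    (vanishBelow_resonantPart h.mom h.real h.vanish h.lin) (pb_homSol h.mom)
  lin := by
    rw [add_sub_cancel]
    exact Linearizable.expPb ((momentumFree_quadPS ω).add h.mom) h.mom.homSol
      (h.vanish.homSol.mono (by omega)) h.lin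

theorem Perturbation.newtonSeq {ω : ℤ → ℝ} {P : PS} (h : Perturbation ω 1 P) (k : ℕ) :
    Perturbation ω (2 ^ k) (newtonSeq ω P k) := by
  induction k with
  | zero => exact h
  | succ k ih =>
    rw [pow_succ']
    exact ih.step Nat.one_le_two_pow

/-- The gain in order dominates the small divisors. -/
theorem exists_growth_bound (C : ℝ) (hC : 0 ≤ C) : ∃ B : ℝ, 0 < B ∧ ∀ k : ℕ,
    8 ^ k * Real.exp (C * (5 / 4) ^ k - (3 / 2) ^ k / 8) ≤ B := by
  obtain ⟨N, hN⟩ := pow_unbounded_of_one_lt (8 * (C + 12)) (by norm_num : (1 : ℝ) < 6 / 5)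
  refine ⟨Real.exp ((C + 12) * (5 / 4) ^ N), Real.exp_pos _, fun k => ?_⟩
  have h8 : (8 : ℝ) ^ k ≤ Real.exp (12 * (5 / 4) ^ k) := by
    have h1 : (8 : ℝ) ≤ Real.exp 3 := by
      have := Real.exp_one_gt_d9
      have e : Real.exp 3 = Real.exp 1 ^ 3 := by rw [← Real.exp_nat_mul]; norm_num
      rw [e]
      calc (8 : ℝ) = 2 ^ 3 := by norm_num
        _ ≤ _ := pow_le_pow_left₀ (by norm_num) (by linarith) 3
    have h2 : (3 : ℝ) * k ≤ 12 * (5 / 4) ^ k := by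
      have := one_add_mul_le_pow (show (-2 : ℝ) ≤ 1 / 4 by norm_num) k
      norm_num at this
      linarith
    calc (8 : ℝ) ^ k ≤ Real.exp 3 ^ k := pow_le_pow_left₀ (by norm_num) h1 k
      _ = Real.exp (3 * k) := by rw [← Real.exp_nat_mul, mul_comm]
      _ ≤ _ := Real.exp_le_exp.2 h2
  calc 8 ^ k * Real.exp (C * (5 / 4) ^ k - (3 / 2) ^ k / 8)
      ≤ Real.exp (12 * (5 / 4) ^ k) * Real.exp (C * (5 / 4) ^ k - (3 / 2) ^ k / 8) :=
        mul_le_mul_of_nonneg_right h8 (Real.exp_pos _).le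
    _ = Real.exp ((C + 12) * (5 / 4) ^ k - (3 / 2) ^ k / 8) := by
        rw [← Real.exp_add]; congr 1; ring
    _ ≤ _ := Real.exp_le_exp.2 ?_
  have e : (3 / 2 : ℝ) ^ k = (6 / 5) ^ k * (5 / 4) ^ k := by rw [← mul_pow]; norm_num
  have hp : (0 : ℝ) < (5 / 4) ^ k := by positivity
  have hpN : (0 : ℝ) < (C + 12) * (5 / 4) ^ N := by positivity
  rcases le_total N k with hk | hk
  · have h1 : (6 / 5 : ℝ) ^ N ≤ (6 / 5) ^ k := pow_le_pow_right₀ (by norm_num) hk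
    rw [e]
    nlinarith
  · have h1 : (5 / 4 : ℝ) ^ k ≤ (5 / 4) ^ N := pow_le_pow_right₀ (by norm_num) hk
    have h2 : (0 : ℝ) < (3 / 2) ^ k := by positivity
    nlinarith

/-- The quantitative convergence of the Newton scheme, on a fixed ball of a smaller phase space. The
`k`-th perturbation is bounded by `E k` for the parameter `s k` and the radius `Rk k`, which decreases
to half its initial value. -/
theorem exists_newton_bounds {p θ γ r s₀ : ℝ} (hθ₀ : 0 < θ) (hθ₁ : θ < 1) (hγ : 0 < γ)
    (hr : 0 < r) {ω : ℤ → ℝ} (hω : ω ∈ diophantine γ) {P : PS} (hP : Perturbation ω 1 P)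
    {c : ℝ} (hc : 0 < c) (hb : HamBound (gw s₀ p θ) r P c) {μ : ℝ} (hμ : 0 < μ)
    (hμ1 : μ ≤ 1 / 400) :
    ∃ s₁ R : ℝ, s₀ < s₁ ∧ 0 < R ∧ R ≤ r ∧ ∀ k : ℕ,
      HamBound (gw s₁ p θ) R (newtonSeq ω P k) (μ * R / 4 ^ k) ∧
      HamBound (gw s₁ p θ) R (homSol ω (newtonSeq ω P k)) (μ * R / 4 ^ k) := by
  obtain ⟨a, C, hC, hdiv⟩ := exists_smallDivisor_bound hθ₀ hθ₁ hγ hω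
  obtain ⟨B, hB, hgrow⟩ := exists_growth_bound C hC
  -- the losses of regularity `τ ^ k` are summable, but `(1 / τ ^ k) ^ a` grows slowly
  set τ : ℝ := 1 - 1 / (5 * ((a : ℝ) + 1)) with hτ
  have hτx : 1 / (5 * ((a : ℝ) + 1)) ≤ 1 / 5 :=
    one_div_le_one_div_of_le (by norm_num) (by linarith [(Nat.cast_nonneg a : (0 : ℝ) ≤ a)])
  have hτx0 : 0 < 1 / (5 * ((a : ℝ) + 1)) := by positivity
  have hτ0 : 0 < τ := by rw [hτ]; linarith
  have hτ1 : τ < 1 := by rw [hτ]; linarith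
  have hτa : 4 / 5 ≤ τ ^ a := by
    have h1 := one_add_mul_le_pow (show (-2 : ℝ) ≤ -(1 / (5 * ((a : ℝ) + 1))) by linarith) a
    have h2 : (a : ℝ) * (1 / (5 * ((a : ℝ) + 1))) ≤ 1 / 5 := by
      rw [mul_one_div, div_le_div_iff₀ (by positivity) (by norm_num)]
      linarith
    rw [hτ, sub_eq_add_neg]
    linarith
  have hK : ∀ k : ℕ, Real.exp (C * (1 / τ ^ k) ^ a) ≤ Real.exp (C * (5 / 4) ^ k) := by
    intro k
    refine Real.exp_le_exp.2 (mul_le_mul_of_nonneg_left ?_ hC)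
    rw [one_div_pow, ← pow_mul, mul_comm, pow_mul, ← one_div_pow]
    refine pow_le_pow_left₀ (by positivity) ?_ k
    rw [one_div_le (by positivity) (by norm_num)]
    linarith
  set b : ℝ := c * Real.exp (1 / 8) * B with hbdef
  have hb0 : 0 < b := by positivity
  -- on a ball of radius `l * r` the perturbation, of order three, is smaller by the factor `l ^ 2`,
  -- one power of `l` more than the radius
  obtain ⟨l, hl0, hl1, hlb⟩ : ∃ l : ℝ, 0 < l ∧ l ≤ 1 ∧ l * b ≤ μ / 2 * r := by
    refine ⟨min 1 (μ / 2 * r / b), lt_min one_pos (by positivity), min_le_left _ _, ?_⟩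
    rw [← le_div_iff₀ hb0]
    exact min_le_right _ _
  -- a step doubles the bound, and the reduction of the radius by `1 - (3 / 4) ^ k / 16` divides it by
  -- `exp ((3 / 2) ^ k / 16)`, as the order is at least `2 ^ k`
  set E : ℕ → ℝ := fun k => l ^ 2 * c * (2 ^ k * Real.exp (-((3 / 2) ^ k - 1) / 8)) with hE
  have hE0 : ∀ k, 0 < E k := fun k => by positivity
  have hη : ∀ k, Real.exp (C * (1 / τ ^ k) ^ a) * E k ≤ μ / 2 * (l * r) / 4 ^ k := by
    intro k
    have h4 : (0 : ℝ) < 4 ^ k := by positivity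
    rw [le_div_iff₀ h4]
    have e8 : (8 : ℝ) ^ k = 2 ^ k * 4 ^ k := by rw [← mul_pow]; norm_num
    calc Real.exp (C * (1 / τ ^ k) ^ a) * E k * 4 ^ k
        ≤ Real.exp (C * (5 / 4) ^ k) * E k * 4 ^ k := by
          exact mul_le_mul_of_nonneg_right
            (mul_le_mul_of_nonneg_right (hK k) (hE0 k).le) h4.le
      _ = l ^ 2 * c * Real.exp (1 / 8) *
          (8 ^ k * Real.exp (C * (5 / 4) ^ k - (3 / 2) ^ k / 8)) := by
          have : Real.exp (-((3 / 2) ^ k - 1) / 8) * Real.exp (C * (5 / 4) ^ k) =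
              Real.exp (1 / 8) * Real.exp (C * (5 / 4) ^ k - (3 / 2) ^ k / 8) := by
            rw [← Real.exp_add, ← Real.exp_add]; congr 1; ring
          rw [hE, e8]
          linear_combination l ^ 2 * c * 2 ^ k * 4 ^ k * this
      _ ≤ l ^ 2 * c * Real.exp (1 / 8) * B :=
          mul_le_mul_of_nonneg_left (hgrow k) (by positivity)
      _ = l * (l * b) := by rw [hbdef]; ring
      _ ≤ l * (μ / 2 * r) := mul_le_mul_of_nonneg_left hlb hl0.le
      _ = _ := by ring
  have hEη : ∀ k, E k ≤ μ / 2 * (l * r) / 4 ^ k := fun k =>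
    (le_mul_of_one_le_left (hE0 k).le (Real.one_le_exp (by positivity))).trans (hη k)
  set s : ℕ → ℝ := fun k => s₀ + ∑ i ∈ Finset.range k, τ ^ i with hs
  set Rk : ℕ → ℝ := fun k => l * r * (1 + (3 / 4) ^ k) / 2 with hRk
  have hS : ∀ k ρ, HamBound (gw (s k) p θ) ρ (newtonSeq ω P k) (E k) →
      HamBound (gw (s (k + 1)) p θ) ρ (homSol ω (newtonSeq ω P k))
        (μ / 2 * (l * r) / 4 ^ k) := by
    intro k ρ h
    have hk := hP.newtonSeq k
    have h3 : VanishBelow 3 (newtonSeq ω P k) :=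
      hk.vanish.mono (by have := Nat.one_le_two_pow (n := k); omega)
    have h1 := HamBound.homSol (σ := τ ^ k) (Real.exp_pos _).le hk.mom h3 h
      (hdiv (τ ^ k) (by positivity) (pow_le_one₀ hτ0.le hτ1.le))
    have e : s (k + 1) = s k + τ ^ k := by simp only [hs, Finset.sum_range_succ]; ring
    rw [e]
    exact h1.mono le_rfl (hη k)
  have main : ∀ k, HamBound (gw (s k) p θ) (Rk k) (newtonSeq ω P k) (E k) := by
    intro k
    induction k with
    | zero =>
      have h1 := HamBound.shrink (d := 2) hl0 hl1 hP.vanish hb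
      have e1 : s 0 = s₀ := by simp [hs]
      have e2 : Rk 0 = l * r := by simp only [hRk, pow_zero]; ring
      have e3 : E 0 = l ^ 2 * c := by simp [hE]
      rw [e1, e2, e3]
      exact h1
    | succ k ih =>
      have hk := hP.newtonSeq k
      have hk1 := hP.newtonSeq (k + 1)
      have h3 : VanishBelow 3 (newtonSeq ω P k) :=
        hk.vanish.mono (by have := Nat.one_le_two_pow (n := k); omega)
      have e : s (k + 1) = s k + τ ^ k := by simp only [hs, Finset.sum_range_succ]; ring
      have hP1 : HamBound (gw (s (k + 1)) p θ) (Rk k) (newtonSeq ω P k) (E k) := by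
        rw [e]; exact ih.mono_weight hθ₀ hθ₁ (by positivity) hk.mom h3
      have hS1 := hS k (Rk k) ih
      set x : ℝ := (3 / 4) ^ k with hx
      have hx0 : 0 < x := by positivity
      have hx1 : x ≤ 1 := pow_le_one₀ (by norm_num) (by norm_num)
      have hlr : 0 < l * r := mul_pos hl0 hr
      have hRkx : Rk k = l * r * (1 + x) / 2 := rfl
      have hRk1 : Rk (k + 1) = l * r * (1 + 3 / 4 * x) / 2 := by
        simp only [hRk, pow_succ', hx]
      set δ : ℝ := x / 16 with hδ
      have hδ1 : δ ≤ 1 / 16 := by rw [hδ]; linarith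
      have hδ0 : 0 < δ := by positivity
      have hρ : 0 < δ * Rk k := by rw [hRkx]; positivity
      have h4 : (1 : ℝ) / 4 ^ k ≤ x := by
        rw [hx, ← one_div_pow]
        exact pow_le_pow_left₀ (by norm_num) (by norm_num) k
      have hsmall : 12 * (μ / 2 * (l * r) / 4 ^ k) ≤ δ * Rk k / 2 := by
        have h5 : μ / 2 * (l * r) / 4 ^ k ≤ 1 / 800 * (l * r) * x := by
          calc μ / 2 * (l * r) / 4 ^ k = μ / 2 * (l * r) * (1 / 4 ^ k) := by ring
            _ ≤ 1 / 800 * (l * r) * x := mul_le_mul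
                (mul_le_mul_of_nonneg_right (by linarith) hlr.le) h4 (by positivity)
                (by positivity)
        rw [hRkx, hδ]
        have h6 : 0 < l * r * x := by positivity
        have h7 : 0 < l * r * x * x := by positivity
        nlinarith
      have hN := HamBound.newton (gw_ne_top (s (k + 1)) p θ) (R := Rk k - δ * Rk k)
        (ρ := δ * Rk k) (by rw [hRkx]; nlinarith [mul_pos hlr hx0]) hρ
        (by positivity : 0 < μ / 2 * (l * r) / 4 ^ k) (hE0 k)
        hk.real.homSol hk.real hk.mom.homSol hk.mom h3
        (by rw [sub_add_cancel]; exact hS1) (by rw [sub_add_cancel]; exact hP1) hsmall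
        (pb_homSol hk.mom)
      have hsh := HamBound.shrink (l := 1 - δ) (d := 2 ^ (k + 1) + 1) (by linarith) (by linarith)
        hk1.vanish hN
      refine hsh.mono ?_ ?_
      · rw [hRk1, hRkx, hδ]
        nlinarith [mul_pos hlr hx0, mul_pos (mul_pos hlr hx0) hx0,
          mul_nonneg (mul_nonneg hlr.le hx0.le) (sub_nonneg.2 hx1),
          mul_nonneg (mul_pos (mul_pos hlr hx0) hx0).le (sub_nonneg.2 hx1),
          mul_pos (mul_pos (mul_pos hlr hx0) hx0) hx0]
      · have h5 : (1 - δ) ^ (2 ^ (k + 1) + 1) ≤ Real.exp (-(3 / 2) ^ k / 16) := by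
          calc (1 - δ) ^ (2 ^ (k + 1) + 1) ≤ (1 - δ) ^ 2 ^ k :=
                pow_le_pow_of_le_one (by linarith) (by linarith) (by rw [pow_succ]; omega)
            _ ≤ Real.exp (-δ) ^ 2 ^ k :=
                pow_le_pow_left₀ (by linarith) (Real.one_sub_le_exp_neg δ) _
            _ = _ := by
                rw [← Real.exp_nat_mul]
                congr 1
                push_cast
                have : (3 / 2 : ℝ) ^ k = 2 ^ k * x := by rw [hx, ← mul_pow]; norm_num
                rw [this, hδ]; ring
        have h6 : E (k + 1) = Real.exp (-(3 / 2) ^ k / 16) * (2 * E k) := by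
          have : Real.exp (-((3 / 2) ^ (k + 1) - 1) / 8) =
              Real.exp (-(3 / 2) ^ k / 16) * Real.exp (-((3 / 2) ^ k - 1) / 8) := by
            rw [← Real.exp_add]; congr 1; ring
          simp only [hE, this]
          ring
        rw [h6]
        exact mul_le_mul_of_nonneg_right h5 (by linarith [hE0 k])
  have hsum : ∀ k, ∑ i ∈ Finset.range k, τ ^ i ≤ (1 - τ)⁻¹ := fun k => by
    rw [← tsum_geometric_of_lt_one hτ0.le hτ1]
    exact (summable_geometric_of_lt_one hτ0.le hτ1).sum_le_tsum _ fun i _ => by positivity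
  have hR : ∀ k, l * r / 2 ≤ Rk k := fun k => by
    have : 0 < l * r * (3 / 4) ^ k := by positivity
    simp only [hRk]
    linarith
  refine ⟨s₀ + (1 - τ)⁻¹, l * r / 2, by have := inv_pos.2 (sub_pos.2 hτ1); linarith,
    by positivity, by nlinarith, fun k => ?_⟩
  have hk := hP.newtonSeq k
  have h3 : VanishBelow 3 (newtonSeq ω P k) :=
    hk.vanish.mono (by have := Nat.one_le_two_pow (n := k); omega)
  have e : μ / 2 * (l * r) / 4 ^ k = μ * (l * r / 2) / 4 ^ k := by ring
  constructor
  · have h1 := (main k).mono_weight (σ := s₀ + (1 - τ)⁻¹ - s k) hθ₀ hθ₁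
      (by have := hsum k; simp only [hs]; linarith) hk.mom h3
    rw [add_sub_cancel] at h1
    exact h1.mono (hR k) (e ▸ hEη k)
  · have h1 := (hS k _ (main k)).mono_weight (σ := s₀ + (1 - τ)⁻¹ - s (k + 1)) hθ₀ hθ₁
      (by have := hsum (k + 1); simp only [hs]; linarith) hk.mom.homSol h3.homSol
    rw [add_sub_cancel] at h1
    exact h1.mono (hR k) e.le

/-! ### Infinite compositions of symplectic maps -/

/-- Generators of time-one maps which converge rapidly to the identity, both in size and in order. -/
structure GeneratorSeq (s p θ R μ : ℝ) (S : ℕ → PS) : Prop where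
  gen : ∀ k, Generator s p θ R (μ * R / 4 ^ k) (S k)
  vanish : ∀ k, VanishBelow (2 ^ k + 2) (S k)
  R_pos : 0 < R
  pos : 0 < μ
  small : μ ≤ 1 / 1000

/-- The components of the composition of the first `k` time-one maps. -/
def compFlow (S : ℕ → PS) : ℕ → ℤ → PS
  | 0 => fun j => X (Sum.inl j)
  | k + 1 => fun j => expPb (S k) (compFlow S k j)

/-- The components of the infinite composition. The coefficients of order `d` are those of the
`d`-th partial composition. -/
def limitFlow (S : ℕ → PS) (j : ℤ) : PS := fun n => coeff n (compFlow S n.degree j)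

namespace GeneratorSeq

variable {s p θ R μ : ℝ} {S : ℕ → PS}

theorem vanishBelow_compFlow (h : GeneratorSeq s p θ R μ S) (k : ℕ) (j : ℤ) :
    VanishBelow 1 (compFlow S k j) := by
  induction k with
  | zero => exact vanishBelow_X _
  | succ k ih => exact VanishBelow.expPb (h.gen k).vanish ih

theorem vanishBelow_compFlow_sub (h : GeneratorSeq s p θ R μ S) (k : ℕ) (j : ℤ) :
    VanishBelow (k + 2) (compFlow S (k + 1) j - compFlow S k j) := fun n hn => by
  change coeff n (expPb (S k) (compFlow S k j) - compFlow S k j) = 0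
  rw [coeff_expPb_sub_self]
  refine Finset.sum_eq_zero fun i _ => ?_
  refine ((VanishBelow.iterate_pb (k := i + 1) (h.vanish k)
    (h.vanishBelow_compFlow k j)).smul _) n ?_
  have : k + 1 ≤ 2 ^ k := Nat.lt_two_pow_self
  rw [Nat.succ_mul]
  omega

theorem coeff_limitFlow (h : GeneratorSeq s p θ R μ S) (j : ℤ) {n : MultiIndex} {k : ℕ}
    (hk : n.degree ≤ k) : coeff n (limitFlow S j) = coeff n (compFlow S k j) := by
  induction k, hk using Nat.le_induction with
  | base => rfl
  | succ k hk ih =>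
    rw [ih, eq_comm, ← sub_eq_zero, ← map_sub]
    exact h.vanishBelow_compFlow_sub k j n (by omega)

theorem vanishBelow_limitFlow_sub (h : GeneratorSeq s p θ R μ S) (j : ℤ) :
    VanishBelow 2 (limitFlow S j - X (Sum.inl j)) := fun n hn => by
  have h1 := h.vanishBelow_compFlow_sub 0 j n hn
  rw [map_sub] at h1 ⊢
  rw [h.coeff_limitFlow j (k := 1) (by omega)]
  exact h1

theorem famBound_compFlow_aux (h : GeneratorSeq s p θ R μ S) (k : ℕ) :
    FamBound (gw s p θ) (R * (1 + (1 / 2) ^ k) / 2) (compFlow S k)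
      (R * (2 - (1 / 2) ^ k)) ∧
    FamBound (gw s p θ) (R / 2) (fun j => compFlow S (k + 1) j - compFlow S k j)
      (48 * μ * R * (1 / 2) ^ k) := by
  have hR := h.R_pos
  have hμ := h.pos
  have step : ∀ k : ℕ, FamBound (gw s p θ) (R * (1 + (1 / 2) ^ k) / 2) (compFlow S k)
      (R * (2 - (1 / 2) ^ k)) → FamBound (gw s p θ) (R * (1 + (1 / 2) ^ (k + 1)) / 2)
        (fun j => compFlow S (k + 1) j - compFlow S k j) (48 * μ * R * (1 / 2) ^ k) := by
    intro k ih
    set x : ℝ := (1 / 2) ^ k with hx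
    have hx0 : 0 < x := by positivity
    have hx1 : x ≤ 1 := pow_le_one₀ (by norm_num) (by norm_num)
    have h4 : μ * R / 4 ^ k = μ * R * x ^ 2 := by
      rw [hx, ← pow_mul, mul_comm k 2, pow_mul, div_eq_mul_inv, ← inv_pow]; norm_num
    have e1 : R * (1 + (1 / 2) ^ (k + 1)) / 2 + R * x / 4 = R * (1 + x) / 2 := by
      rw [pow_succ, ← hx]; ring
    have hg := h.gen k
    rw [h4] at hg
    have h1 := FamBound.expPb_sub_self (gw_ne_top s p θ) (R := R * (1 + (1 / 2) ^ (k + 1)) / 2)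
      (ρ := R * x / 4) (by positivity) (by positivity) hg.pos
      (mul_nonneg hR.le (by linarith : 0 ≤ 2 - x)) hg.real
      (by rw [e1]; exact hg.bound.mono (by nlinarith) le_rfl) (by rw [e1]; exact ih) (by
        have : R * x * (24 * μ * x) ≤ R * x * 1 :=
          mul_le_mul_of_nonneg_left (by nlinarith [h.small]) (by positivity)
        linarith)
    refine h1.mono le_rfl ?_
    have : 6 * (μ * R * x ^ 2 / (R * x / 4)) * (R * (2 - x)) = 24 * μ * R * x * (2 - x) := by
      field_simp
      ring
    rw [this]
    have : 0 < μ * R * x := by positivity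
    nlinarith
  have main : FamBound (gw s p θ) (R * (1 + (1 / 2) ^ k) / 2) (compFlow S k)
      (R * (2 - (1 / 2) ^ k)) := by
    induction k with
    | zero =>
      refine (famBound_X (gw s p θ) R).mono ?_ ?_ <;> norm_num
    | succ k ih =>
      have hx0 : (0 : ℝ) < (1 / 2) ^ k := by positivity
      have hx1 : ((1 / 2) ^ k : ℝ) ≤ 1 := pow_le_one₀ (by norm_num) (by norm_num)
      have h1 := (ih.mono (R' := R * (1 + (1 / 2) ^ (k + 1)) / 2) (by
        rw [pow_succ]; nlinarith) le_rfl).add (gw_ne_top s p θ) (step k ih)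
        (mul_nonneg hR.le (by linarith)) (by positivity)
      simp only [add_sub_cancel] at h1
      refine h1.mono le_rfl ?_
      rw [pow_succ]
      have : R * (1 / 2) ^ k * (48 * μ) ≤ R * (1 / 2) ^ k * (1 / 2) :=
        mul_le_mul_of_nonneg_left (by linarith [h.small]) (by positivity)
      linarith
  refine ⟨main, (step k main).mono ?_ le_rfl⟩
  have : 0 < R * (1 / 2) ^ (k + 1) := by positivity
  linarith

theorem famBound_compFlow (h : GeneratorSeq s p θ R μ S) (k : ℕ) :
    FamBound (gw s p θ) (R / 2) (compFlow S k) (2 * R) := by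
  have hR := h.R_pos
  have : 0 < R * (1 / 2) ^ k := by positivity
  exact (h.famBound_compFlow_aux k).1.mono (by linarith) (by linarith)

theorem famBound_compFlow_sub (h : GeneratorSeq s p θ R μ S) (k : ℕ) :
    FamBound (gw s p θ) (R / 2) (fun j => compFlow S (k + 1) j - compFlow S k j)
      (48 * μ * R * (1 / 2) ^ k) := (h.famBound_compFlow_aux k).2

theorem famBound_limitFlow_sub (h : GeneratorSeq s p θ R μ S) (k : ℕ) :
    FamBound (gw s p θ) (R / 2) (fun j => limitFlow S j - compFlow S k j)
      (96 * μ * R * (1 / 2) ^ k) := by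
  have hR := h.R_pos
  have hμ := h.pos
  have hs : HasSum (fun i : ℕ => 48 * μ * R * (1 / 2) ^ (k + i)) (96 * μ * R * (1 / 2) ^ k) := by
    have := (hasSum_geometric_two.mul_left (48 * μ * R * (1 / 2) ^ k))
    have e1 : (fun i : ℕ => 48 * μ * R * (1 / 2) ^ (k + i)) =
        fun i => 48 * μ * R * (1 / 2) ^ k * (1 / 2) ^ i := by funext i; rw [pow_add]; ring
    have e2 : 96 * μ * R * (1 / 2) ^ k = 48 * μ * R * (1 / 2) ^ k * 2 := by ring
    rw [e1, e2]
    exact this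
  rw [← hs.tsum_eq]
  refine FamBound.of_tsum (gw_ne_top s p θ) (fun i => h.famBound_compFlow_sub (k + i))
    (fun i => by positivity) hs.summable fun j n => ?_
  have e : coeff n (limitFlow S j - compFlow S k j) = ∑ i ∈ Finset.range n.degree,
      coeff n (compFlow S (k + i + 1) j - compFlow S (k + i) j) := by
    rw [map_sub, h.coeff_limitFlow j (k := k + n.degree) (by omega)]
    have := Finset.sum_range_sub (fun i => coeff n (compFlow S (k + i) j)) n.degree
    simp only [map_sub]
    exact this.symm
  rw [e]
  exact enorm_sum_le_tsum (fun i => coeff n (compFlow S (k + i + 1) j - compFlow S (k + i) j)) _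

theorem famBound_limitFlow_sub_X (h : GeneratorSeq s p θ R μ S) :
    FamBound (gw s p θ) (R / 2) (fun j => limitFlow S j - X (Sum.inl j)) (96 * μ * R) := by
  have := h.famBound_limitFlow_sub 0
  rwa [pow_zero, mul_one] at this

theorem famBound_limitFlow (h : GeneratorSeq s p θ R μ S) :
    FamBound (gw s p θ) (R / 2) (limitFlow S) R := by
  have hR := h.R_pos
  have hμ := h.pos
  have h1 := (famBound_X (gw s p θ) (R / 2)).add (gw_ne_top s p θ) h.famBound_limitFlow_sub_X
    (by positivity) (by positivity)
  simp only [add_sub_cancel] at h1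
  exact h1.mono le_rfl (by nlinarith [h.small])

theorem evFam_limitFlow_sub (h : GeneratorSeq s p θ R μ S) {u : GevreySpace s p θ}
    (hu : ‖u‖ ≤ R / 2) : evFam s p θ (fun j => limitFlow S j - X (Sum.inl j)) u =
      evFam s p θ (limitFlow S) u - u := by
  have hR := h.R_pos
  rw [evFam_sub h.famBound_limitFlow (famBound_X (gw s p θ) (R / 2))
    (h.famBound_limitFlow.sub (gw_ne_top s p θ) (famBound_X (gw s p θ) (R / 2)) hR.le
      (by positivity)) hu, evFam_X]
  rfl

/-- The limit is quadratically close to the identity. -/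
theorem norm_evFam_limitFlow_sub_le (h : GeneratorSeq s p θ R μ S) {u : GevreySpace s p θ}
    (hu : ‖u‖ < R / 2) : ‖evFam s p θ (limitFlow S) u - u‖ ≤ 1 / R * ‖u‖ ^ 2 := by
  have hR := h.R_pos
  have hμ := h.pos
  have key : ∀ t : ℝ, ‖u‖ < t → t < R / 2 →
      ‖evFam s p θ (limitFlow S) u - u‖ ≤ 1 / R * t ^ 2 := by
    intro t ht htR
    have ht0 : 0 < t := (norm_nonneg u).trans_lt ht
    have h1 := FamBound.shrink (l := t / (R / 2)) (by positivity)
      ((div_le_one (by positivity)).2 htR.le) h.vanishBelow_limitFlow_sub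
      h.famBound_limitFlow_sub_X
    rw [div_mul_cancel₀ _ (by positivity)] at h1
    rw [← h.evFam_limitFlow_sub hu.le]
    refine (h1.norm_evFam_le (by positivity) ht.le).trans ?_
    have : (t / (R / 2)) ^ 2 * (96 * μ * R) = 384 * μ * (1 / R * t ^ 2) := by field_simp; ring
    rw [this]
    exact mul_le_of_le_one_left (by positivity) (by linarith [h.small])
  have hc : Filter.Tendsto (fun t : ℝ => 1 / R * t ^ 2) (nhdsWithin ‖u‖ (Set.Ioi ‖u‖))
      (nhds (1 / R * ‖u‖ ^ 2)) :=
    ((continuous_const.mul (continuous_pow 2)).tendsto _).mono_left nhdsWithin_le_nhds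
  refine ge_of_tendsto hc ?_
  filter_upwards [Ioo_mem_nhdsGT hu] with t ht
  exact key t ht.1 ht.2

theorem norm_fderiv_limitFlow_sub_le (h : GeneratorSeq s p θ R μ S) {u : GevreySpace s p θ}
    (hu : ‖u‖ < R / 6) :
    ‖fderiv ℝ (evFam s p θ (limitFlow S)) u - ContinuousLinearMap.id ℝ _‖ ≤ 1 / 2 := by
  have hR := h.R_pos
  have hμ := h.pos
  refine ContinuousLinearMap.opNorm_le_bound _ (by norm_num) fun v => ?_
  have h1 := h.famBound_limitFlow_sub_X.norm_fderiv_apply_le (by positivity) (u := u) (ρ := R / 3)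
    (by linarith) (by positivity) (by linarith) v
  rw [FamBound.fderiv_sub h.famBound_limitFlow (famBound_X (gw s p θ) (R / 2)) hR.le
    (by positivity) (by linarith), evFam_X, fderiv_id] at h1
  refine h1.trans (mul_le_mul_of_nonneg_right ?_ (norm_nonneg v))
  rw [div_le_iff₀ (by positivity)]
  nlinarith [h.small]

/-- The compositions map balls to larger balls on which the preceding composition is controlled. -/
theorem norm_flow_lt (h : GeneratorSeq s p θ R μ S) {k : ℕ} {u : GevreySpace s p θ}
    (hu : ‖u‖ < R / 16 * (1 + (1 / 2) ^ (k + 1))) :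
    ‖u‖ < R / 8 ∧ ‖evFam s p θ (flow (S k)) u‖ < R / 16 * (1 + (1 / 2) ^ k) := by
  have hR := h.R_pos
  have hx0 : (0 : ℝ) < (1 / 2) ^ k := by positivity
  have hx1 : ((1 / 2) ^ k : ℝ) ≤ 1 := pow_le_one₀ (by norm_num) (by norm_num)
  have h4 : μ * R / 4 ^ k = μ * R * ((1 / 2) ^ k) ^ 2 := by
    rw [← pow_mul, mul_comm k 2, pow_mul, div_eq_mul_inv, ← inv_pow]; norm_num
  rw [pow_succ] at hu
  have hu8 : ‖u‖ < R / 8 := by nlinarith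
  refine ⟨hu8, ?_⟩
  have h1 := (h.gen k).norm_evFam_flow_le (u := u) (by linarith)
  rw [h4] at h1
  have h2 : 12 * (μ * R * ((1 / 2) ^ k) ^ 2) ≤ R / 32 * (1 / 2) ^ k := by
    have h3 : R * (1 / 2) ^ k * (12 * μ * (1 / 2) ^ k) ≤ R * (1 / 2) ^ k * (1 / 32) :=
      mul_le_mul_of_nonneg_left (by nlinarith [h.small, h.pos]) (by positivity)
    linarith
  linarith

theorem evFam_compFlow_succ (h : GeneratorSeq s p θ R μ S) {k : ℕ} {u : GevreySpace s p θ}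
    (hu : ‖u‖ < R / 16 * (1 + (1 / 2) ^ (k + 1))) :
    evFam s p θ (compFlow S (k + 1)) u =
      evFam s p θ (compFlow S k) (evFam s p θ (flow (S k)) u) := by
  have hR := h.R_pos
  have h1 := (h.norm_flow_lt hu).1
  exact (h.gen k).evFam_expPb (h.famBound_compFlow k) (by linarith)
    (by linarith [(h.gen k).small])

theorem symplecticForm_fderiv_compFlow (h : GeneratorSeq s p θ R μ S) (k : ℕ) :
    ∀ u : GevreySpace s p θ, ‖u‖ < R / 16 * (1 + (1 / 2) ^ k) → ∀ v w : GevreySpace s p θ,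
      symplecticForm (fderiv ℝ (evFam s p θ (compFlow S k)) u v)
        (fderiv ℝ (evFam s p θ (compFlow S k)) u w) = symplecticForm v w := by
  have hR := h.R_pos
  induction k with
  | zero =>
    intro u _ v w
    change symplecticForm (fderiv ℝ (evFam s p θ fun j => X (Sum.inl j)) u v)
      (fderiv ℝ (evFam s p θ fun j => X (Sum.inl j)) u w) = _
    rw [evFam_X, fderiv_id]; rfl
  | succ k ih =>
    intro u hu v w
    obtain ⟨hu8, hΦ⟩ := h.norm_flow_lt hu
    have hx1 : ((1 / 2) ^ k : ℝ) ≤ 1 := pow_le_one₀ (by norm_num) (by norm_num)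
    have hd1 : HasFDerivAt (evFam s p θ (flow (S k))) (fderiv ℝ (evFam s p θ (flow (S k))) u) u :=
      ((h.gen k).flow_bound le_rfl (by positivity)).hasFDerivAt
        (by linarith [(h.gen k).pos]) (by linarith)
    have hd2 := (h.famBound_compFlow k).hasFDerivAt (by positivity)
      (u := evFam s p θ (flow (S k)) u) (by nlinarith)
    have hcomp : evFam s p θ (compFlow S (k + 1)) =ᶠ[nhds u]
        evFam s p θ (compFlow S k) ∘ evFam s p θ (flow (S k)) := by
      filter_upwards [Metric.isOpen_ball.mem_nhds (by simpa using hu :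
        u ∈ Metric.ball 0 (R / 16 * (1 + (1 / 2) ^ (k + 1))))] with y hy
      exact h.evFam_compFlow_succ (mem_ball_zero_iff.1 hy)
    rw [hcomp.fderiv_eq, (hd2.comp u hd1).fderiv]
    simp only [ContinuousLinearMap.comp_apply]
    rw [ih _ hΦ, (h.gen k).symplecticForm_fderiv_flow hu8]

theorem norm_fderiv_limitFlow_sub_compFlow_le (h : GeneratorSeq s p θ R μ S) (k : ℕ)
    {u : GevreySpace s p θ} (hu : ‖u‖ < R / 6) (v : GevreySpace s p θ) :
    ‖fderiv ℝ (evFam s p θ (limitFlow S)) u v - fderiv ℝ (evFam s p θ (compFlow S k)) u v‖ ≤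
      (1 / 2) ^ k * ‖v‖ := by
  have hR := h.R_pos
  have hμ := h.pos
  have h1 := (h.famBound_limitFlow_sub k).norm_fderiv_apply_le (by positivity) (u := u)
    (ρ := R / 3) (by linarith) (by positivity) (by linarith) v
  rw [FamBound.fderiv_sub h.famBound_limitFlow (h.famBound_compFlow k) hR.le
    (by positivity) (by linarith)] at h1
  refine h1.trans (mul_le_mul_of_nonneg_right ?_ (norm_nonneg v))
  have : 96 * μ * R * (1 / 2) ^ k / (R / 3) = 288 * μ * (1 / 2) ^ k := by field_simp; ring
  rw [this]
  exact mul_le_of_le_one_left (by positivity) (by linarith [h.small])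

/-- The limit of the compositions is symplectic. -/
theorem symplecticForm_fderiv_limitFlow (h : GeneratorSeq s p θ R μ S) {u : GevreySpace s p θ}
    (hu : ‖u‖ < R / 16) (v w : GevreySpace s p θ) :
    symplecticForm (fderiv ℝ (evFam s p θ (limitFlow S)) u v)
      (fderiv ℝ (evFam s p θ (limitFlow S)) u w) = symplecticForm v w := by
  have hR := h.R_pos
  have hs := (h.gen 0).s_nonneg
  have hp := (h.gen 0).p_nonneg
  set V := fderiv ℝ (evFam s p θ (limitFlow S)) u v with hV
  set W := fderiv ℝ (evFam s p θ (limitFlow S)) u w with hW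
  have key : ∀ k : ℕ, |symplecticForm V W - symplecticForm v w| ≤
      (2 * (‖v‖ * ‖W‖) + 2 * ((‖V‖ + ‖v‖) * ‖w‖)) * (1 / 2) ^ k := by
    intro k
    have hx1 : ((1 / 2) ^ k : ℝ) ≤ 1 := pow_le_one₀ (by norm_num) (by norm_num)
    have hx0 : (0 : ℝ) < (1 / 2) ^ k := by positivity
    have h1 := h.symplecticForm_fderiv_compFlow k u (by nlinarith) v w
    have hv := h.norm_fderiv_limitFlow_sub_compFlow_le k (u := u) (by linarith) v
    have hw := h.norm_fderiv_limitFlow_sub_compFlow_le k (u := u) (by linarith) w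
    rw [← hV] at hv
    rw [← hW] at hw
    set V' := fderiv ℝ (evFam s p θ (compFlow S k)) u v
    set W' := fderiv ℝ (evFam s p θ (compFlow S k)) u w
    have e : symplecticForm V W - symplecticForm v w =
        symplecticForm (V - V') W + symplecticForm V' (W - W') := by
      have e1 := symplecticForm_add_left hs hp (V - V') V' W
      have e2 := symplecticForm_add_right hs hp V' (W - W') W'
      rw [sub_add_cancel] at e1 e2
      rw [← h1, e1, e2]; ring
    have hV' : ‖V'‖ ≤ ‖V‖ + ‖v‖ := by
      have h2 := norm_le_norm_add_norm_sub V V'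
      nlinarith [norm_nonneg v]
    rw [e]
    refine (abs_add_le _ _).trans ?_
    have b1 := (abs_symplecticForm_le hs hp (V - V') W).trans
      (mul_le_mul_of_nonneg_left (mul_le_mul_of_nonneg_right hv (norm_nonneg W)) (by norm_num))
    have b2 := (abs_symplecticForm_le hs hp V' (W - W')).trans
      (mul_le_mul_of_nonneg_left (mul_le_mul hV' hw (norm_nonneg _) (by positivity)) (by norm_num))
    linarith
  have hlim := ge_of_tendsto' ((tendsto_pow_atTop_nhds_zero_of_lt_one (r := (1 / 2 : ℝ))
    (by norm_num) (by norm_num)).const_mul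
      (2 * (‖v‖ * ‖W‖) + 2 * ((‖V‖ + ‖v‖) * ‖w‖))) key
  rw [mul_zero] at hlim
  exact sub_eq_zero.1 (abs_nonpos_iff.1 hlim)

end GeneratorSeq

/-! ### Values of Hamiltonians -/

theorem mon_le_dmon_self (n : MultiIndex) (hn : n.degree ≠ 0) (z : Var → ℝ≥0∞) :
    mon n z ≤ dmon n z z := by
  induction n using multiIndex_induction with
  | h0 => simp at hn
  | h1 n w _ =>
    rw [dmon_add_single, mon_add, mon_single]
    exact le_add_self

/-- Euler's formula bounds a Hamiltonian by its vector field. -/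
theorem HamBound.maj_le {s p θ R c : ℝ} (hs : 0 ≤ s) (hp : 0 ≤ p) {P : PS} (hR : 0 ≤ R)
    (h : HamBound (gw s p θ) R P c) (hr : IsReal P) (h1 : VanishBelow 1 P) {a : ℤ → ℝ≥0∞}
    (ha : wnorm (gw s p θ) a ≤ ENNReal.ofReal R) : maj P a ≤ ENNReal.ofReal (2 * (R * c)) := by
  calc maj P a ≤ dmaj P a (a ∘ site) := by
        refine ENNReal.tsum_le_tsum fun n => ?_
        by_cases hn : n.degree = 0
        · rw [h1 n (by omega)]; simp
        · exact mul_le_mul' le_rfl (mon_le_dmon_self n hn _)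
    _ = ∑' v, a (site v) * maj (pderiv ℂ v P) a := dmaj_eq_tsum _ _ _
    _ = 2 * ∑' j, a j * maj (pderiv ℂ (Sum.inr j) P) a := by
        rw [Summable.tsum_sum ENNReal.summable ENNReal.summable, two_mul]
        congr 1
        exact tsum_congr fun j => by rw [← hr.maj_pderiv_swap a (Sum.inl j)]; rfl
    _ ≤ 2 * (wnorm (gw s p θ) a * wnorm (gw s p θ) fun j => maj (pderiv ℂ (Sum.inr j) P) a) :=
        mul_le_mul' le_rfl (tsum_mul_le_wnorm (one_le_gw hs hp) _ _)
    _ ≤ 2 * (ENNReal.ofReal R * ENNReal.ofReal c) :=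
        mul_le_mul' le_rfl (mul_le_mul' ha (h a ha))
    _ = _ := by
        rw [← ENNReal.ofReal_mul hR, ENNReal.ofReal_mul (by norm_num : (0 : ℝ) ≤ 2)]
        norm_num

/-- The exponent of `|u_j|²`. -/
def actionIndex (j : ℤ) : MultiIndex := Finsupp.single (Sum.inl j) 1 + Finsupp.single (Sum.inr j) 1

theorem actionIndex_injective : Function.Injective actionIndex := fun i j h => by
  have h1 := DFunLike.congr_fun h (Sum.inl i)
  simp only [actionIndex, Finsupp.add_apply, Finsupp.single_apply] at h1
  by_contra hij
  simp [Ne.symm hij] at h1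

theorem coeff_actionIndex (ω : ℤ → ℝ) (j : ℤ) : coeff (actionIndex j) (quadPS ω) = ω j :=
  coeff_quadPS ω (Sum.inl j)

theorem support_subset_range_actionIndex (ω : ℤ → ℝ) {A : Type*} [Zero A] {f : MultiIndex → A}
    (hf : ∀ n, coeff n (quadPS ω) = 0 → f n = 0) :
    Function.support f ⊆ Set.range actionIndex := fun n hn => by
  by_contra h
  exact hn (hf n (coeff_quadPS_eq_zero ω fun j hj => h ⟨j, hj.symm⟩))

theorem maj_quadPS (ω : ℤ → ℝ) (a : ℤ → ℝ≥0∞) :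
    maj (quadPS ω) a = ∑' j, ‖(ω j : ℂ)‖ₑ * (a j * a j) := by
  rw [maj, ← actionIndex_injective.tsum_eq
    (support_subset_range_actionIndex ω fun n hn => by rw [hn]; simp)]
  refine tsum_congr fun j => ?_
  rw [coeff_actionIndex, actionIndex, mon_add, mon_single, mon_single]
  rfl

/-- The frequencies grow more slowly than the weights. -/
theorem exists_abs_le_weight {s p θ : ℝ} (hs : 0 < s) (hp : 0 ≤ p) (hθ : 0 < θ) {ω : ℤ → ℝ}
    (hω : ω ∈ frequencies) : ∃ K : ℝ, 0 ≤ K ∧ ∀ j, |ω j| ≤ K * weight s p θ j := by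
  obtain ⟨c, hc, hωc⟩ := hω
  obtain ⟨m, hm⟩ := exists_nat_ge (2 / θ)
  refine ⟨2 * (m.factorial / s ^ m), by positivity, fun j => ?_⟩
  have hb : 1 ≤ bracket j := le_max_right _ _
  have hb0 := bracket_pos j
  have h1 : |ω j| ≤ 2 * bracket j ^ 2 := by
    have h2 := hωc j
    have h3 : (j : ℝ) ^ 2 ≤ bracket j ^ 2 := by
      rw [← sq_abs (j : ℝ)]
      exact pow_le_pow_left₀ (abs_nonneg _) (le_max_left _ _) 2
    have h4 := abs_sub_abs_le_abs_sub (ω j) ((j : ℝ) ^ 2)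
    rw [abs_of_nonneg (sq_nonneg (j : ℝ))] at h4
    nlinarith
  set x := bracket j ^ θ with hx
  have hx1 : 1 ≤ x := Real.one_le_rpow hb hθ.le
  have h2 : bracket j ^ 2 ≤ x ^ m := by
    rw [hx, ← Real.rpow_natCast, ← Real.rpow_natCast, ← Real.rpow_mul hb0.le]
    refine Real.rpow_le_rpow_of_exponent_le hb ?_
    rw [div_le_iff₀ hθ] at hm
    push_cast
    linarith
  have h3 : x ^ m ≤ m.factorial / s ^ m * Real.exp (s * x) := by
    have h4 := Real.pow_div_factorial_le_exp (s * x) (by positivity) m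
    rw [div_le_iff₀ (by positivity), mul_pow] at h4
    rw [div_mul_eq_mul_div, le_div_iff₀ (by positivity)]
    linarith
  have h4 : Real.exp (s * x) ≤ weight s p θ j :=
    le_mul_of_one_le_left (Real.exp_pos _).le (Real.one_le_rpow hb hp)
  calc |ω j| ≤ 2 * (m.factorial / s ^ m * Real.exp (s * x)) := by linarith
    _ ≤ 2 * (m.factorial / s ^ m * weight s p θ j) := by gcongr
    _ = _ := by ring

theorem maj_quadPS_ne_top {s p θ : ℝ} (hs : 0 < s) (hp : 0 ≤ p) (hθ : 0 < θ) {ω : ℤ → ℝ}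
    (hω : ω ∈ frequencies) {a : ℤ → ℝ≥0∞} (ha : wnorm (gw s p θ) a ≠ ⊤) :
    maj (quadPS ω) a ≠ ⊤ := by
  obtain ⟨K, hK, hωK⟩ := exists_abs_le_weight hs hp hθ hω
  have h1 : ∑' j, (gw s p θ j * a j) ^ (2 : ℝ) ≠ ⊤ := by
    intro h
    refine ha ?_
    rw [wnorm, h]
    exact ENNReal.top_rpow_of_pos (by norm_num)
  rw [maj_quadPS]
  refine ne_top_of_le_ne_top (ENNReal.mul_ne_top ENNReal.ofReal_ne_top h1 :
    ENNReal.ofReal K * ∑' j, (gw s p θ j * a j) ^ (2 : ℝ) ≠ ⊤) ?_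
  rw [← ENNReal.tsum_mul_left]
  refine ENNReal.tsum_le_tsum fun j => ?_
  have h2 : ‖(ω j : ℂ)‖ₑ ≤ ENNReal.ofReal K * gw s p θ j := by
    rw [← ofReal_norm, Complex.norm_real, Real.norm_eq_abs, gw, ← ENNReal.ofReal_mul hK]
    exact ENNReal.ofReal_le_ofReal (hωK j)
  calc ‖(ω j : ℂ)‖ₑ * (a j * a j) ≤ ENNReal.ofReal K * gw s p θ j * (a j * (gw s p θ j * a j)) :=
        mul_le_mul' h2 (mul_le_mul' le_rfl (le_mul_of_one_le_left' (one_le_gw hs.le hp j)))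
    _ = ENNReal.ofReal K * (gw s p θ j * a j) ^ (2 : ℝ) := by
        rw [ENNReal.rpow_two]; ring

theorem mon_actionIndex (j : ℤ) (u : ℤ → ℂ) :
    mon (actionIndex j) (vars u) = ((‖u j‖ ^ 2 : ℝ) : ℂ) := by
  rw [actionIndex, mon_add, mon_single, mon_single]
  change u j * (starRingEnd ℂ) (u j) = _
  rw [Complex.mul_conj, Complex.normSq_eq_norm_sq]

/-- The value of the quadratic part. -/
theorem hasSum_quadPS {ω : ℤ → ℝ} {u : ℤ → ℂ} (h : maj (quadPS ω) (fun j => ‖u j‖ₑ) ≠ ⊤) :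
    ∃ E : ℝ, ev (quadPS ω) (vars u) = E ∧ HasSum (fun j : ℤ => ω j * ‖u j‖ ^ 2) E := by
  have h1 := (summable_ev (z := vars u) (fun w => (enorm_vars u w).le) h).hasSum
  rw [← actionIndex_injective.hasSum_iff fun n hn => by
    by_contra h0
    exact hn (support_subset_range_actionIndex ω (f := fun n => coeff n (quadPS ω) *
      mon n (vars u)) (fun n hn => by rw [hn, zero_mul]) h0)] at h1
  have e : (fun n => coeff n (quadPS ω) * mon n (vars u)) ∘ actionIndex =
      fun j => ((ω j * ‖u j‖ ^ 2 : ℝ) : ℂ) := by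
    funext j
    rw [Function.comp_apply, coeff_actionIndex, mon_actionIndex]
    push_cast; rfl
  rw [e] at h1
  have h2 : Summable fun j : ℤ => ω j * ‖u j‖ ^ 2 := Complex.summable_ofReal.1 h1.summable
  refine ⟨_, ?_, h2.hasSum⟩
  exact h1.unique (Complex.hasSum_ofReal.2 h2.hasSum)

theorem tendsto_mon {ι : Type*} {l : Filter ι} {z : ι → Var → ℂ} {x : Var → ℂ}
    (h : ∀ w, Filter.Tendsto (fun i => z i w) l (nhds (x w))) (n : MultiIndex) :
    Filter.Tendsto (fun i => mon n (z i)) l (nhds (mon n x)) :=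
  tendsto_finsetProd _ fun w _ => (h w).pow _

/-- Continuity of power series along dominated sequences. -/
theorem tendsto_ev {F : PS} {A : ℤ → ℝ≥0∞} (hF : maj F A ≠ ⊤) {z : ℕ → Var → ℂ} {x : Var → ℂ}
    (hz : ∀ k w, ‖z k w‖ₑ ≤ A (site w))
    (h : ∀ w, Filter.Tendsto (fun k => z k w) Filter.atTop (nhds (x w))) :
    Filter.Tendsto (fun k => ev F (z k)) Filter.atTop (nhds (ev F x)) := by
  have hs : Summable fun n => (‖coeff n F‖ₑ * mon n (A ∘ site)).toReal := ENNReal.summable_toReal hF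
  refine tendsto_tsum_of_dominated_convergence hs (fun n => (tendsto_mon h n).const_mul _)
    (Filter.Eventually.of_forall fun k n => ?_)
  rw [← toReal_enorm]
  refine ENNReal.toReal_mono (ne_top_of_le_ne_top hF (ENNReal.le_tsum n)) ?_
  rw [enorm_mul, enorm_mon]
  exact mul_le_mul' le_rfl (mon_mono n fun w => hz k w)

namespace GeneratorSeq

variable {s p θ R μ : ℝ} {S : ℕ → PS}

/-- The partial compositions pull the Hamiltonian back to its successive transforms. -/
theorem ev_compFlow (h : GeneratorSeq s p θ R μ S) {H : ℕ → PS}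
    (hH : ∀ k, H (k + 1) = expPb (S k) (H k))
    (hfin : ∀ k (a : ℤ → ℝ≥0∞), wnorm (gw s p θ) a ≤ ENNReal.ofReal (R / 2) → maj (H k) a ≠ ⊤)
    (k : ℕ) : ∀ u : GevreySpace s p θ, ‖u‖ < R / 16 * (1 + (1 / 2) ^ k) →
      ev (H k) (vars u) = ev (H 0) (vars (evFam s p θ (compFlow S k) u)) := by
  have hR := h.R_pos
  induction k with
  | zero =>
    intro u _
    change _ = ev (H 0) (vars (evFam s p θ (fun j => X (Sum.inl j)) u))
    rw [evFam_X]; rfl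
  | succ k ih =>
    intro u hu
    obtain ⟨hu8, hΦ⟩ := h.norm_flow_lt hu
    have hg := h.gen k
    have hb := hg.flow_bound (R' := ‖u‖) (by linarith) (norm_nonneg u)
    rw [h.evFam_compFlow_succ hu, ← ih _ hΦ, hH]
    refine ev_expPb_vars hg.real hg.mom hg.vanish (fun j => (hb.evFam_apply le_rfl j).symm)
      (hb.maj_ne_top le_rfl) (hfin k _ ((hb _ (wnorm_enorm_le_ofReal le_rfl)).trans
        (ENNReal.ofReal_le_ofReal ?_)))
    linarith [hg.small]

/-- A common majorant of all partial compositions. -/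
def domin (S : ℕ → PS) (u : ℤ → ℂ) (j : ℤ) : ℝ≥0∞ :=
  ‖u j‖ₑ + ∑' k, maj (compFlow S (k + 1) j - compFlow S k j) fun j => ‖u j‖ₑ

theorem maj_compFlow_le (S : ℕ → PS) (u : ℤ → ℂ) (k : ℕ) (j : ℤ) :
    maj (compFlow S k j) (fun j => ‖u j‖ₑ) ≤ domin S u j := by
  have key : maj (compFlow S k j) (fun j => ‖u j‖ₑ) ≤ ‖u j‖ₑ + ∑ i ∈ Finset.range k,
      maj (compFlow S (i + 1) j - compFlow S i j) fun j => ‖u j‖ₑ := by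
    induction k with
    | zero => rw [Finset.sum_range_zero, add_zero]; exact (maj_X _ _).le
    | succ k ih =>
      have h1 := maj_add_le (compFlow S k j) (compFlow S (k + 1) j - compFlow S k j)
        fun j => ‖u j‖ₑ
      rw [add_sub_cancel] at h1
      rw [Finset.sum_range_succ, ← add_assoc]
      exact h1.trans (add_le_add ih le_rfl)
  exact key.trans (add_le_add le_rfl (ENNReal.sum_le_tsum _))

/-- The common majorant stays in the ball on which the Hamiltonians converge. -/
theorem wnorm_domin_le (h : GeneratorSeq s p θ R μ S) {u : GevreySpace s p θ} (hu : ‖u‖ < R / 16) :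
    wnorm (gw s p θ) (domin S u) ≤ ENNReal.ofReal (R / 2) := by
  have hR := h.R_pos
  have hμ := h.pos
  have hs : HasSum (fun i : ℕ => 48 * μ * R * (1 / 2) ^ i) (48 * μ * R * 2) :=
    hasSum_geometric_two.mul_left (48 * μ * R)
  refine (wnorm_add_le (gw_ne_top s p θ) _ _).trans ?_
  refine (add_le_add (wnorm_enorm_le_ofReal le_rfl)
    ((wnorm_tsum_le (gw_ne_top s p θ) _).trans (ENNReal.tsum_le_tsum fun k =>
      h.famBound_compFlow_sub k _ (wnorm_enorm_le_ofReal (by linarith))))).trans ?_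
  rw [← ENNReal.ofReal_tsum_of_nonneg (fun k => by positivity) hs.summable, hs.tsum_eq,
    ← ENNReal.ofReal_add (norm_nonneg u) (by positivity)]
  refine ENNReal.ofReal_le_ofReal ?_
  nlinarith [h.small]

theorem tendsto_evFam_compFlow (h : GeneratorSeq s p θ R μ S) {u : GevreySpace s p θ}
    (hu : ‖u‖ ≤ R / 2) (j : ℤ) :
    Filter.Tendsto (fun k => evFam s p θ (compFlow S k) u j) Filter.atTop
      (nhds (evFam s p θ (limitFlow S) u j)) := by
  have hR := h.R_pos
  have hμ := h.pos
  have h1 : Filter.Tendsto (fun k => evFam s p θ (compFlow S k) u) Filter.atTop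
      (nhds (evFam s p θ (limitFlow S) u)) := by
    rw [tendsto_iff_norm_sub_tendsto_zero]
    have h2 := (tendsto_pow_atTop_nhds_zero_of_lt_one (r := (1 / 2 : ℝ))
      (by norm_num) (by norm_num)).const_mul (96 * μ * R)
    rw [mul_zero] at h2
    refine squeeze_zero (fun k => norm_nonneg _) (fun k => ?_) h2
    rw [norm_sub_rev, ← evFam_sub h.famBound_limitFlow (h.famBound_compFlow k)
      (h.famBound_limitFlow.sub (gw_ne_top s p θ) (h.famBound_compFlow k) hR.le
        (by positivity)) hu]
    exact (h.famBound_limitFlow_sub k).norm_evFam_le (by positivity) hu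
  exact ((coord s p θ j).continuous.tendsto _).comp h1

/-- If the Hamiltonians `Q + P k`, obtained from each other by the successive time-one maps, tend to
`Q`, then the limit map conjugates `Q + P 0` to `Q`. -/
theorem ev_limitFlow (h : GeneratorSeq s p θ R μ S) {Q : PS} {P : ℕ → PS}
    (hP : ∀ k, Q + P (k + 1) = expPb (S k) (Q + P k))
    (hQ : ∀ a : ℤ → ℝ≥0∞, wnorm (gw s p θ) a ≤ ENNReal.ofReal (R / 2) → maj Q a ≠ ⊤)
    {c : ℕ → ℝ} (hc : Filter.Tendsto c Filter.atTop (nhds 0))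
    (hPc : ∀ k (a : ℤ → ℝ≥0∞), wnorm (gw s p θ) a ≤ ENNReal.ofReal (R / 2) →
      maj (P k) a ≤ ENNReal.ofReal (c k))
    {u : GevreySpace s p θ} (hu : ‖u‖ < R / 16) :
    ev (Q + P 0) (vars (evFam s p θ (limitFlow S) u)) = ev Q (vars u) := by
  have hR := h.R_pos
  have hP' : ∀ k (a : ℤ → ℝ≥0∞), wnorm (gw s p θ) a ≤ ENNReal.ofReal (R / 2) → maj (P k) a ≠ ⊤ :=
    fun k a ha => ne_top_of_le_ne_top ENNReal.ofReal_ne_top (hPc k a ha)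
  have hfin : ∀ k (a : ℤ → ℝ≥0∞), wnorm (gw s p θ) a ≤ ENNReal.ofReal (R / 2) →
      maj (Q + P k) a ≠ ⊤ := fun k a ha =>
    ne_top_of_le_ne_top (ENNReal.add_ne_top.2 ⟨hQ a ha, hP' k a ha⟩) (maj_add_le _ _ _)
  have hdom := h.wnorm_domin_le hu
  have h1 : Filter.Tendsto (fun k => ev (Q + P 0) (vars (evFam s p θ (compFlow S k) u)))
      Filter.atTop (nhds (ev (Q + P 0) (vars (evFam s p θ (limitFlow S) u)))) := by
    refine tendsto_ev (hfin 0 _ hdom) (fun k w => ?_) fun w => ?_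
    · rw [enorm_vars, (h.famBound_compFlow k).evFam_apply (by linarith)]
      exact (enorm_ev_le _ fun w => (enorm_vars u w).le).trans (maj_compFlow_le S u k _)
    · have h2 := h.tendsto_evFam_compFlow (u := u) (by linarith)
      rcases w with w | w
      · exact h2 w
      · exact (Complex.continuous_conj.tendsto _).comp (h2 w)
  have hun := wnorm_enorm_le_ofReal (R := R / 2) (u := u) (by linarith)
  have h2 : ∀ k, ev (Q + P 0) (vars (evFam s p θ (compFlow S k) u)) =
      ev Q (vars u) + ev (P k) (vars u) := by
    intro k
    have hx0 : (0 : ℝ) < (1 / 2) ^ k := by positivity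
    rw [← h.ev_compFlow (H := fun k => Q + P k) hP hfin k u (by nlinarith),
      ev_add (fun w => (enorm_vars u w).le) (hQ _ hun) (hP' k _ hun)]
  have h3 : Filter.Tendsto (fun k => ev (P k) (vars u)) Filter.atTop (nhds 0) := by
    refine squeeze_zero_norm (a := fun k => |c k|) (fun k => ?_) (by simpa using hc.abs)
    have h4 : ‖ev (P k) (vars u)‖ₑ ≤ ENNReal.ofReal |c k| :=
      (enorm_ev_le _ fun w => (enorm_vars u w).le).trans
        ((hPc k _ hun).trans (ENNReal.ofReal_le_ofReal (le_abs_self _)))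
    rwa [← ofReal_norm, ENNReal.ofReal_le_ofReal_iff (abs_nonneg _)] at h4
  have h5 := h3.const_add (ev Q (vars u))
  rw [add_zero] at h5
  refine tendsto_nhds_unique h1 ?_
  simpa only [h2] using h5

end GeneratorSeq

/-! ### The normalizing transformation -/

theorem add_mem_hamiltoniansGE {d e : ℕ} {F G : FormalSeries} (hF : F ∈ hamiltoniansGE d)
    (hG : G ∈ hamiltoniansGE e) (hde : d ≤ e) : F + G ∈ hamiltoniansGE d := by
  refine ⟨⟨?_, ?_, ?_, fun α β => ?_, fun m hm => ?_⟩, fun m hm => ?_⟩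
  · rw [Pi.add_apply, hF.1.const, hG.1.const, add_zero]
  · rw [Pi.add_apply, hF.1.lin, hG.1.lin, add_zero]
  · rw [Pi.add_apply, hF.1.lin_conj, hG.1.lin_conj, add_zero]
  · rw [Pi.add_apply, Pi.add_apply, map_add, ← hF.1.real, ← hG.1.real]
  · rw [Pi.add_apply, hF.1.momentum m hm, hG.1.momentum m hm, add_zero]
  · rw [Pi.add_apply, hF.2 m hm, hG.2 m (by omega), add_zero]

theorem perturbation_toPS {ω : ℤ → ℝ} {P₀ G : FormalSeries} (hP₀ : P₀ ∈ hamiltoniansGE 1)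
    (hG : G ∈ hamiltoniansGE 1) (h : expAd G (quadratic ω + P₀) = quadratic ω) :
    Perturbation ω 1 (toPS P₀) where
  real := isReal_toPS hP₀.1
  mom := momentumFree_toPS hP₀.1
  vanish := vanishBelow_toPS hP₀
  lin := by
    refine linearizable_of_expPb_eq (momentumFree_toPS hG.1) (vanishBelow_toPS hG) ?_
    rw [quadPS, ← toPS_add,
      ← toPS_expAd hG (add_mem_hamiltoniansGE (quadratic_mem ω) hP₀ (Nat.zero_le 1)), h]

/-- The generators solving the homological equations of the Newton scheme. -/
theorem Perturbation.generatorSeq {ω : ℤ → ℝ} {P : PS} (hP : Perturbation ω 1 P)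
    {s p θ R μ : ℝ} (hs : 0 ≤ s) (hp : 0 ≤ p) (hR : 0 < R) (hμ : 0 < μ) (hμ1 : μ ≤ 1 / 1000)
    (hS : ∀ k, HamBound (gw s p θ) R (homSol ω (GevreyBirkhoff.newtonSeq ω P k))
      (μ * R / 4 ^ k)) :
    GeneratorSeq s p θ R μ fun k => homSol ω (GevreyBirkhoff.newtonSeq ω P k) where
  gen k :=
    { real := (hP.newtonSeq k).real.homSol
      mom := (hP.newtonSeq k).mom.homSol
      vanish := (hP.newtonSeq k).vanish.homSol.mono (by
        have := Nat.one_le_two_pow (n := k); omega)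
      bound := hS k
      pos := by positivity
      small := by
        have h1 : μ * R / 4 ^ k ≤ μ * R := div_le_self (by positivity) (one_le_pow₀ (by norm_num))
        nlinarith
      s_nonneg := hs
      p_nonneg := hp }
  vanish k := (hP.newtonSeq k).vanish.homSol
  R_pos := hR
  pos := hμ
  small := hμ1

section

variable {s p θ R μ : ℝ} {S : ℕ → PS}

theorem GeneratorSeq.analyticOnNhd (h : GeneratorSeq s p θ R μ S) {r : ℝ} (hr : r ≤ R / 16) :
    AnalyticOnNhd ℝ (evFam s p θ (limitFlow S)) (Metric.ball 0 r) := by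
  have hR := h.R_pos
  exact (h.famBound_limitFlow.analyticOnNhd (by positivity) hR.le).mono
    (Metric.ball_subset_ball (by linarith))

theorem GeneratorSeq.approximatesLinearOn (h : GeneratorSeq s p θ R μ S) {r : ℝ} (hr : r ≤ R / 16) :
    ApproximatesLinearOn (evFam s p θ (limitFlow S))
      (ContinuousLinearEquiv.refl ℝ (GevreySpace s p θ) :
        GevreySpace s p θ →L[ℝ] GevreySpace s p θ) (Metric.ball 0 r) (1 / 2) := by
  have hR := h.R_pos
  intro x hx y hy
  have := (convex_ball (0 : GevreySpace s p θ) r).norm_image_sub_le_of_norm_fderiv_le'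
    (𝕜 := ℝ) (φ := ContinuousLinearMap.id ℝ _) (C := 1 / 2)
    (fun z hz => (h.analyticOnNhd hr z hz).differentiableAt)
    (fun z hz => h.norm_fderiv_limitFlow_sub_le (by
      rw [mem_ball_zero_iff] at hz; linarith)) hy hx
  simpa using this

/-- The limit of the compositions, as a homeomorphism of a ball onto an open set. -/
def GeneratorSeq.homeo (h : GeneratorSeq s p θ R μ S) {r : ℝ} (hr : r ≤ R / 16) :
    OpenPartialHomeomorph (GevreySpace s p θ) (GevreySpace s p θ) :=
  (h.approximatesLinearOn hr).toOpenPartialHomeomorph _ _ (by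
    rcases subsingleton_or_nontrivial (GevreySpace s p θ) with h0 | h0
    · exact Or.inl h0
    · right
      have h1 : ‖((ContinuousLinearEquiv.refl ℝ (GevreySpace s p θ)).symm :
          GevreySpace s p θ →L[ℝ] GevreySpace s p θ)‖₊ = 1 := by
        rw [← NNReal.coe_inj]
        exact ContinuousLinearMap.norm_id
      rw [h1, inv_one]
      exact NNReal.half_lt_self one_ne_zero) Metric.isOpen_ball

theorem GeneratorSeq.homeo_coe (h : GeneratorSeq s p θ R μ S) {r : ℝ} (hr : r ≤ R / 16) :
    ⇑(h.homeo hr) = evFam s p θ (limitFlow S) := rfl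

theorem GeneratorSeq.analyticOnNhd_symm (h : GeneratorSeq s p θ R μ S) {r : ℝ} (hr : r ≤ R / 16) :
    AnalyticOnNhd ℝ (h.homeo hr).symm (h.homeo hr).target := by
  intro a ha
  have hx : (h.homeo hr).symm a ∈ Metric.ball 0 r := (h.homeo hr).map_target ha
  set x := (h.homeo hr).symm a with hxdef
  have hxr := mem_ball_zero_iff.1 hx
  set D := fderiv ℝ (evFam s p θ (limitFlow S)) x with hD
  have h1 : ‖(1 : GevreySpace s p θ →L[ℝ] GevreySpace s p θ) - D‖ < 1 := by
    rw [norm_sub_rev]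
    have := h.norm_fderiv_limitFlow_sub_le (u := x) (by linarith [h.R_pos])
    exact this.trans_lt (by norm_num)
  refine (h.homeo hr).analyticAt_symm
    (i := ContinuousLinearEquiv.unitsEquiv ℝ _ (Units.oneSub (1 - D) h1)) ha
    (h.analyticOnNhd hr x hx) ?_
  rw [h.homeo_coe hr, ← hxdef, ← hD]
  ext v
  rw [ContinuousLinearEquiv.coe_coe, ContinuousLinearEquiv.unitsEquiv_apply, Units.val_oneSub,
    sub_sub_cancel]

end

/-- The Hamiltonian, in the coordinates given by the limit of the compositions. -/
theorem Perturbation.exists_energy {ω : ℤ → ℝ} {P₀ : FormalSeries} {s p θ R μ : ℝ}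
    (hP : Perturbation ω 1 (toPS P₀)) (hs : 0 < s) (hp : 0 ≤ p) (hθ : 0 < θ)
    (hω : ω ∈ frequencies)
    (h : GeneratorSeq s p θ R μ fun k => homSol ω (GevreyBirkhoff.newtonSeq ω (toPS P₀) k))
    (hPb : ∀ k, HamBound (gw s p θ) R (GevreyBirkhoff.newtonSeq ω (toPS P₀) k) (μ * R / 4 ^ k))
    {u : GevreySpace s p θ} (hu : ‖u‖ < R / 16) :
    ∃ E : ℝ, HasSum (fun m => (quadratic ω + P₀) m * monomial m (evFam s p θ
        (limitFlow fun k => homSol ω (GevreyBirkhoff.newtonSeq ω (toPS P₀) k)) u)) (E : ℂ) ∧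
      HasSum (fun j : ℤ => ω j * ‖u j‖ ^ 2) E := by
  have hR := h.R_pos
  have hμ := h.pos
  set Ψ := evFam s p θ (limitFlow fun k => homSol ω (GevreyBirkhoff.newtonSeq ω (toPS P₀) k))
  have hQ : ∀ a : ℤ → ℝ≥0∞, wnorm (gw s p θ) a ≤ ENNReal.ofReal (R / 2) →
      maj (quadPS ω) a ≠ ⊤ := fun a ha =>
    maj_quadPS_ne_top hs hp hθ hω (ne_top_of_le_ne_top ENNReal.ofReal_ne_top ha)
  have hPc : ∀ k (a : ℤ → ℝ≥0∞), wnorm (gw s p θ) a ≤ ENNReal.ofReal (R / 2) →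
      maj (GevreyBirkhoff.newtonSeq ω (toPS P₀) k) a ≤
        ENNReal.ofReal (2 * (R * (μ * R / 4 ^ k))) := fun k a ha =>
    (hPb k).maj_le hs.le hp hR.le (hP.newtonSeq k).real ((hP.newtonSeq k).vanish.mono (by
      have := Nat.one_le_two_pow (n := k); omega))
      (ha.trans (ENNReal.ofReal_le_ofReal (by linarith)))
  have hc : Filter.Tendsto (fun k : ℕ => 2 * (R * (μ * R / 4 ^ k))) Filter.atTop (nhds 0) := by
    have h1 := (tendsto_pow_atTop_nhds_zero_of_lt_one (r := (1 / 4 : ℝ))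
      (by norm_num) (by norm_num)).const_mul (2 * (R * (μ * R)))
    rw [mul_zero] at h1
    refine h1.congr fun k => ?_
    rw [one_div_pow]; ring
  have key := h.ev_limitFlow (Q := quadPS ω) (P := GevreyBirkhoff.newtonSeq ω (toPS P₀))
    (fun k => add_sub_cancel _ _) hQ hc hPc hu
  obtain ⟨E, hE, hsum⟩ := hasSum_quadPS (hQ _ (wnorm_enorm_le_ofReal (R := R / 2) (u := u)
    (by linarith)))
  refine ⟨E, ?_, hsum⟩
  have hΨ : ‖Ψ u‖ ≤ R / 2 := by
    have h1 := h.norm_evFam_limitFlow_sub_le (u := u) (by linarith)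
    have h2 : 1 / R * ‖u‖ ^ 2 ≤ R / 16 := by
      rw [div_mul_eq_mul_div, one_mul, div_le_iff₀ hR]
      nlinarith [norm_nonneg u]
    have h3 := norm_le_norm_add_norm_sub' (Ψ u) u
    linarith
  have hb := wnorm_enorm_le_ofReal hΨ
  have hfin : maj (quadPS ω + toPS P₀) (fun j => ‖Ψ u j‖ₑ) ≠ ⊤ :=
    ne_top_of_le_ne_top (ENNReal.add_ne_top.2 ⟨hQ _ hb,
      ne_top_of_le_ne_top ENNReal.ofReal_ne_top (hPc 0 _ hb)⟩) (maj_add_le _ _ _)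
  have h4 := (summable_ev (z := vars (Ψ u)) (fun w => (enorm_vars _ w).le) hfin).hasSum
  rw [← toExponent.toEquiv.hasSum_iff]
  have h5 : ev (quadPS ω + toPS P₀) (vars (Ψ u)) = E := key.trans hE
  rw [← h5]
  refine h4.congr_fun fun n => ?_
  change (quadratic ω + P₀) (toExponent n) * monomial (toExponent n) (Ψ u) = _
  rw [monomial_toExponent]
  rfl

end GevreyBirkhoff

end

theorem mainTheorem1 (p θ γ r s₀ : ℝ) (hp : 1 / 2 ≤ p) (hθ₀ : 0 < θ) (hθ₁ : θ < 1) (hγ : 0 < γ)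
    (hr : 0 < r) (hs₀ : 0 < s₀) (ω : ℤ → ℝ) (hω : ω ∈ GevreyBirkhoff.diophantine γ)
    (P₀ : GevreyBirkhoff.FormalSeries) (hP₀ : P₀ ∈ GevreyBirkhoff.hamiltoniansGE 1)
    (hreg : GevreyBirkhoff.IsMRegular r s₀ p θ P₀)
    (hconj : ∃ G ∈ GevreyBirkhoff.hamiltoniansGE 1,
      GevreyBirkhoff.expAd G (GevreyBirkhoff.quadratic ω + P₀) = GevreyBirkhoff.quadratic ω) :
    ∀ ε : ℝ, 0 < ε → ∃ r₁ s₁ : ℝ, 0 < r₁ ∧ r₁ < r ∧ s₀ < s₁ ∧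
      ∃ Ψ : OpenPartialHomeomorph (GevreyBirkhoff.GevreySpace s₁ p θ)
          (GevreyBirkhoff.GevreySpace s₁ p θ),
        Ψ.source = Metric.ball 0 r₁ ∧
        AnalyticOnNhd ℝ Ψ Ψ.source ∧
        AnalyticOnNhd ℝ Ψ.symm Ψ.target ∧
        GevreyBirkhoff.IsSymplecticOn Ψ Ψ.source ∧
        (∃ C : ℝ, C * r₁ ≤ ε ∧ ∀ u ∈ Ψ.source, ‖Ψ u - u‖ ≤ C * ‖u‖ ^ 2) ∧
        ∀ u ∈ Ψ.source, ∃ E : ℝ,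
          HasSum (fun m => (GevreyBirkhoff.quadratic ω + P₀) m * GevreyBirkhoff.monomial m (Ψ u))
            (E : ℂ) ∧
          HasSum (fun j : ℤ => ω j * ‖u j‖ ^ 2) E := by
  intro ε hε
  obtain ⟨G, hG, hGconj⟩ := hconj
  have hP := GevreyBirkhoff.perturbation_toPS hP₀ hG hGconj
  obtain ⟨C, hC, hb⟩ := hreg.hamBound hr.le
  have hp0 : 0 ≤ p := by linarith
  obtain ⟨s₁, R, hs, hR, hRr, hN⟩ := GevreyBirkhoff.exists_newton_bounds hθ₀ hθ₁ hγ hr hω hP hC hb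
    (μ := 1 / 1000) (by norm_num) (by norm_num)
  have h := hP.generatorSeq (s := s₁) (by linarith) hp0 hR (by norm_num) le_rfl fun k => (hN k).2
  obtain ⟨r₁, hr₁0, hr₁R, hr₁ε⟩ : ∃ r₁ : ℝ, 0 < r₁ ∧ r₁ ≤ R / 16 ∧ r₁ ≤ ε * R :=
    ⟨min (R / 16) (ε * R), lt_min (by positivity) (by positivity), min_le_left _ _,
      min_le_right _ _⟩
  have hlt : ∀ {u : GevreyBirkhoff.GevreySpace s₁ p θ}, u ∈ Metric.ball 0 r₁ → ‖u‖ < R / 16 :=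
    fun hu => (mem_ball_zero_iff.1 hu).trans_le hr₁R
  refine ⟨r₁, s₁, hr₁0, by linarith, hs, h.homeo hr₁R, rfl, h.analyticOnNhd hr₁R,
    h.analyticOnNhd_symm hr₁R, fun u hu v w => h.symplecticForm_fderiv_limitFlow (hlt hu) v w,
    ⟨1 / R, ?_, fun u hu => h.norm_evFam_limitFlow_sub_le (by linarith [hlt hu])⟩,
    fun u hu => hP.exists_energy (by linarith) hp0 hθ₀ hω.1 h (fun k => (hN k).1) (hlt hu)⟩
  rw [div_mul_eq_mul_div, one_mul, div_le_iff₀ hR]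
  exact hr₁ε
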